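/- Let $\ell$ be an odd prime and let $\mathbb{F}_q$ be a finite field with $\ell \nmid q$ (no congruence condition on $q$ modulo $\ell$ is imposed). An $\ell$-cyclic cover is a smooth projective geometrically irreducible curve $C$ over $\mathbb{F}_q$ with a map to $\mathbb{P}^1_{\mathbb{F}_q}$ for which $\mathbb{F}_q(C)/\mathbb{F}_q(t)$ is cyclic of degree $\ell$; covers are counted up to isomorphism over $\mathbb{P}^1_{\mathbb{F}_q}$, i.e. as cyclic extensions of $\mathbb{F}_q(t)$ inside a fixed algebraic closure. The conductor of $C$ is the (reduced) divisor on $\mathbb{P}^1_{\mathbb{F}_q}$ which is the sum of all places of $\mathbb{F}_q(t)$ ramified in $\mathbb{F}_q(C)$, the place at infinity included when it ramifies; its degree is the sum of the degrees of these places. Fix an $\ell$-cyclic cover $C_0$ over $\mathbb{F}_q$ whose conductor has degree $d_0$. Then there are $\gg q^{2n/d_0}$ $\ell$-cyclic covers $C$ over $\mathbb{F}_q$ with conductor of degree at most $n$ that admit a non-constant map $C \to C_0$ over $\mathbb{F}_q$. That is, there are $c>0$ and $N$, depending only on $q$, $\ell$ and $C_0$, such that for every integer $n \ge N$ there are at least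 $c\,q^{2n/d_0}$ such covers. -/

import Mathlib

open Polynomial IsDedekindDomain

/-- The place of `k` given by the valuation `v` ramifies in the extension `L / k`: some valuation
ring `W` of `L` lying above the valuation ring of `v` has a value group strictly larger than that
of `k`, i.e. its ramification index is `> 1`. (In this file all residue fields are finite, so the
residue extensions are separable and this is the usual notion.) -/
def IsRamifiedIn {k Γ : Type*} [Field k] [LinearOrderedCommGroupWithZero Γ] (v : Valuation k Γ)
    (L : Type*) [Field L] [Algebra k L] : Prop :=
  ∃ W : ValuationSubring L, W.comap (algebraMap k L) = v.valuationSubring ∧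
    ∃ y : L, ∀ x : k, W.valuation (algebraMap k L x) ≠ W.valuation y

/-- `K = F(C)` is the function field of an `ℓ`-cyclic cover `C` of the projective line over `F`:
a cyclic Galois extension of `F(t)` of degree `ℓ` in which `F` is algebraically closed
(so that the smooth projective curve `C` is geometrically irreducible).
The extension is taken inside a fixed algebraic closure of `F(t)`, so that each cover
occurs exactly once up to isomorphism of covers. -/
structure IsCyclicCover (F : Type*) [Field F] (ℓ : ℕ)
    (K : IntermediateField (RatFunc F) (AlgebraicClosure (RatFunc F))) : Prop where
  isGalois : IsGalois (RatFunc F) K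
  isCyclic : IsCyclic (K ≃ₐ[RatFunc F] K)
  finrank_eq : Module.finrank (RatFunc F) K = ℓ
  constants : ∀ x : K, IsAlgebraic F x → x ∈ (algebraMap F K).range

open Classical in
/-- The degree of the conductor of an abelian extension `K / F(t)` all of whose ramification is
tame (e.g. a cyclic extension of prime degree different from the characteristic).
The conductor is then the sum of the ramified places, each with multiplicity one; the finite
places are the nonzero primes `v` of `F[t]`, of degree `[F[t]/v : F]`, and the place at infinity
has degree one. -/
noncomputable def conductorDegree (F : Type*) [Field F]
    (K : Type*) [Field K] [Algebra (RatFunc F) K] : ℕ :=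
  (∑ᶠ (v : HeightOneSpectrum F[X]) (_ : IsRamifiedIn (v.valuation (RatFunc F)) K),
      Module.finrank F (F[X] ⧸ v.asIdeal)) +
    if IsRamifiedIn (RatFunc.inftyValuation F) K then 1 else 0

/-- For function fields `K₀ = F(C₀)` and `K = F(C)`, the curve `C` admits a non-constant morphism
`C → C₀` over `F`. Such morphisms of smooth projective curves are the same as the
`F`-algebra homomorphisms `F(C₀) → F(C)`. -/
def HasNonconstantMap (F : Type*) [Field F] (K K₀ : Type*) [Field K] [Algebra F K]
    [Field K₀] [Algebra F K₀] : Prop :=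
  Nonempty (K₀ →ₐ[F] K)

/-! Pull C₀ back along rational functions h = a/b with a, b monic over F of degrees e + 1 and e,
where e + 1 = ⌊n/d₀⌋. The pullback maps to C₀, and it ramifies only over the ramified places of C₀,
so its conductor has degree at most (e + 1)d₀ ≤ n (`conductorDegree_pullback_le`). There are
q^(2e+1) pairs (a, b), and q^(2e) equals q^(2n/d₀) up to a constant. It remains to see that a
positive proportion of the pairs give genuine covers and that among these each field comes from
boundedly many pairs.

Since q is arbitrary modulo ℓ, Kummer theory is used only over k(t), with k an algebraic closure of
F. There K₀ becomes k(t)(f^(1/ℓ)) and the pullback becomes k(t)(f(a/b)^(1/ℓ)). The field determines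
the orders modulo ℓ of its Kummer generator up to one common factor in (ℤ/ℓ)ˣ
(`IsKummerPolynomial.exists_eq_mul`), and the ramified places are those where the order is nonzero
modulo ℓ (`conductorDegree_eq`). The count thus becomes one about orders at points of the projective
line.

Let B be the set of points of the projective line over k where f has order nonzero modulo ℓ; |B| ≥ 2
because the orders add up to zero. For at least half of the pairs (`exists_card_good_ge`) the forms
a − βb (and b for β = ∞), β ∈ B, have, away from points of bounded degree, only simple roots and no
common ones. This is a sieve: a union bound over points of degree at most e/2 and, beyond that, the
fact that replacing a by a + s^p does not change the derivative in characteristic p. At a root θ of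
large degree the order of f(h) is then the order of f at h(θ), and there are |B|(e + 1) − O(1) such
θ.

If two good pairs give the same field, then h and h' both send these θ into B. When they agree at 2e
+ 1 points, ab' − a'b, of degree at most 2e, vanishes there and so is zero. For |B| ≥ 3
(`card_fibre_le_of_three_le`), the roots left after discarding degrees at most e/(8|B|) still number
2e + 1 and form boundedly many Galois orbits, so the orbits can be assigned to points of B in
boundedly many ways. For |B| = 2 (`card_fibre_le_of_two`), the two orders are opposite, hence
distinct because ℓ is odd, so the common factor decides which point of B is hit; the points fall
short of 2e + 1 by a constant, which costs a bounded factor. -/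

set_option linter.unusedSectionVars false

/-! ### Counting pairs of monic polynomials under local conditions at one point -/

section Counting

variable {F : Type*} [Field F] [Fintype F]

/-- A family of polynomials whose pairwise differences have degree `< n`, and are zero as soon as
they have degree `< s`, has at most `q ^ (n - s)` members. -/
lemma card_le_pow_of_degree_sub_lt (A : Finset F[X]) (n s : ℕ)
    (h1 : ∀ a ∈ A, ∀ b ∈ A, (a - b).degree < n)
    (h2 : ∀ a ∈ A, ∀ b ∈ A, (a - b).degree < s → a = b) :
    A.card ≤ Fintype.card F ^ (n - s) := by
  classical
  have : A.card ≤ (Finset.univ : Finset (Fin (n - s) → F)).card := by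
    refine Finset.card_le_card_of_injOn (fun a i => a.coeff (s + i)) (fun _ _ => by simp) ?_
    intro a ha b hb hab
    refine h2 a ha b hb ?_
    rw [degree_lt_iff_coeff_zero]
    intro i hi
    by_cases hin : i < n
    · have := congrFun hab ⟨i - s, by omega⟩
      simp only [Nat.add_sub_cancel' hi] at this
      simp [this]
    · exact (degree_lt_iff_coeff_zero _ _).1 (h1 a ha b hb) i (by omega)
  simpa using this

variable (F) in
/-- The polynomials of degree `< n`. -/
noncomputable def polysLT (n : ℕ) : Finset F[X] :=
  (Finset.univ : Finset (Fin n → F)).map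
    ⟨fun c => ((degreeLTEquiv F n).symm c : F[X]),
      Subtype.val_injective.comp (degreeLTEquiv F n).symm.injective⟩

lemma mem_polysLT {n : ℕ} {a : F[X]} : a ∈ polysLT F n ↔ a.degree < n := by
  simp only [polysLT, Finset.mem_map, Finset.mem_univ, true_and, Function.Embedding.coeFn_mk]
  constructor
  · rintro ⟨c, rfl⟩
    exact mem_degreeLT.1 ((degreeLTEquiv F n).symm c).2
  · intro h
    exact ⟨degreeLTEquiv F n ⟨a, mem_degreeLT.2 h⟩, by simp⟩

lemma card_polysLT (n : ℕ) : (polysLT F n).card = Fintype.card F ^ n := by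
  simp [polysLT]

variable (F) in
/-- The monic polynomials of degree `n`. -/
noncomputable def monics (n : ℕ) : Finset F[X] :=
  (polysLT F n).map (addLeftEmbedding (X ^ n))

lemma mem_monics {n : ℕ} {a : F[X]} : a ∈ monics F n ↔ a.Monic ∧ a.natDegree = n := by
  simp only [monics, Finset.mem_map, mem_polysLT, addLeftEmbedding_apply]
  constructor
  · rintro ⟨b, hb, rfl⟩
    refine ⟨monic_X_pow_add (n := n) hb, ?_⟩
    exact natDegree_eq_of_degree_eq_some (by rw [degree_add_eq_left_of_degree_lt] <;> simp [hb])
  · rintro ⟨h1, rfl⟩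
    refine ⟨a - X ^ a.natDegree, ?_, by ring⟩
    have := degree_sub_lt_left (p := a) (q := X ^ a.natDegree) (by
      rw [degree_X_pow, degree_eq_natDegree h1.ne_zero]) h1.ne_zero (by simp [h1.leadingCoeff])
    rwa [degree_eq_natDegree h1.ne_zero] at this

lemma card_monics (n : ℕ) : (monics F n).card = Fintype.card F ^ n := by
  simp [monics, card_polysLT]

lemma degree_sub_lt_of_mem_monics {n : ℕ} {a b : F[X]} (ha : a ∈ monics F n)
    (hb : b ∈ monics F n) : (a - b).degree < n := by
  rw [mem_monics] at ha hb
  have := degree_sub_lt_left (p := a) (q := b) (by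
      rw [degree_eq_natDegree ha.1.ne_zero, degree_eq_natDegree hb.1.ne_zero, ha.2, hb.2])
      ha.1.ne_zero (by simp [ha.1.leadingCoeff, hb.1.leadingCoeff])
  rwa [degree_eq_natDegree ha.1.ne_zero, ha.2] at this

lemma eq_of_dvd_sub_of_degree_lt {Q a b : F[X]} {s : ℕ} (hQ : s ≤ Q.natDegree) (h : Q ∣ a - b)
    (hd : (a - b).degree < s) : a = b := by
  by_contra hne
  have hne' : a - b ≠ 0 := sub_ne_zero.2 hne
  have := natDegree_le_of_dvd h hne'
  rw [degree_eq_natDegree hne'] at hd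
  have : (a - b).natDegree < s := by exact_mod_cast hd
  omega

/-- The members are pairwise congruent modulo Q, so the coefficients in degrees s to n − 1 determine
them. The subtraction truncates: for s ≥ n at most one member is left. -/
lemma card_filter_monics_le {n s : ℕ} (P : F[X] → Prop) [DecidablePred P] (Q : F[X])
    (hQ : s ≤ Q.natDegree)
    (h : ∀ a b, P a → P b → Q ∣ a - b) :
    ((monics F n).filter P).card ≤ Fintype.card F ^ (n - s) := by
  refine card_le_pow_of_degree_sub_lt _ n s ?_ ?_
  · intro a ha b hb
    exact degree_sub_lt_of_mem_monics (Finset.mem_filter.1 ha).1 (Finset.mem_filter.1 hb).1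
  · intro a ha b hb hd
    exact eq_of_dvd_sub_of_degree_lt hQ
      (h a b (Finset.mem_filter.1 ha).2 (Finset.mem_filter.1 hb).2) hd

lemma card_filter_product_le_left {α β : Type*} (A : Finset α) (B : Finset β) (P : α × β → Prop)
    [DecidablePred P] (N : ℕ) (h : ∀ b ∈ B, (A.filter fun a => P (a, b)).card ≤ N) :
    ((A ×ˢ B).filter P).card ≤ N * B.card := by
  rw [Finset.card_filter, Finset.sum_product_right, mul_comm]
  refine (Finset.sum_le_card_nsmul _ _ N fun b hb => ?_).trans_eq (smul_eq_mul ..)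
  rw [← Finset.card_filter]
  exact h b hb

lemma card_filter_product_le_right {α β : Type*} (A : Finset α) (B : Finset β) (P : α × β → Prop)
    [DecidablePred P] (N : ℕ) (h : ∀ a ∈ A, (B.filter fun b => P (a, b)).card ≤ N) :
    ((A ×ˢ B).filter P).card ≤ A.card * N := by
  rw [Finset.card_filter, Finset.sum_product]
  refine (Finset.sum_le_card_nsmul _ _ N fun b hb => ?_).trans_eq (smul_eq_mul ..)
  rw [← Finset.card_filter]
  exact h b hb

variable {k : Type*} [Field k] [Algebra F k] [Algebra.IsAlgebraic F k]

variable (F) in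
/-- The degree of a geometric point of the affine line. -/
noncomputable def pointDegree (θ : k) : ℕ := (minpoly F θ).natDegree

lemma pointDegree_pos (θ : k) : 0 < pointDegree F θ :=
  minpoly.natDegree_pos (Algebra.IsIntegral.isIntegral θ)

/-- F is perfect, so θ is a simple root of its minimal polynomial. Dividing out one copy of `minpoly
F θ` therefore uses up exactly one factor X − θ, and induction applies. This turns geometric
multiplicity conditions into congruences over F, which can be counted. -/
lemma minpoly_pow_dvd_of_pow_dvd_map (θ : k) (e : ℕ) (p : F[X])
    (h : (X - C θ) ^ e ∣ p.map (algebraMap F k)) : (minpoly F θ) ^ e ∣ p := by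
  have hint : IsIntegral F θ := Algebra.IsIntegral.isIntegral θ
  have hsep : (minpoly F θ).Separable :=
    PerfectField.separable_of_irreducible (minpoly.irreducible hint)
  induction e generalizing p with
  | zero => simp
  | succ e ih =>
    have h1 : minpoly F θ ∣ p := by
      refine minpoly.dvd F θ ?_
      have : (X - C θ) ∣ p.map (algebraMap F k) := (dvd_pow_self _ (by omega)).trans h
      rw [dvd_iff_isRoot, IsRoot.def, eval_map_algebraMap] at this
      exact this
    obtain ⟨s, rfl⟩ := h1
    rw [pow_succ']
    refine mul_dvd_mul_left _ (ih s ?_)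
    have hroot : (X - C θ) ∣ (minpoly F θ).map (algebraMap F k) := by
      rw [dvd_iff_isRoot, IsRoot.def, eval_map_algebraMap, minpoly.aeval]
    obtain ⟨u, hu⟩ := hroot
    have hu0 : ¬ (X - C θ) ∣ u := by
      rintro ⟨w, rfl⟩
      have hs := hsep.map (f := algebraMap F k)
      rw [hu, ← mul_assoc] at hs
      have := hs.of_mul_left.squarefree (X - C θ) dvd_rfl
      exact (not_isUnit_X_sub_C θ) this
    rw [Polynomial.map_mul, hu, pow_succ', mul_assoc] at h
    have h2 := (mul_dvd_mul_iff_left (X_sub_C_ne_zero θ)).1 h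
    exact ((prime_X_sub_C θ).coprime_iff_not_dvd.2 hu0).pow_left.dvd_of_dvd_mul_left h2

open Classical in
variable (F k) in
/-- The geometric points of degree `r`. -/
noncomputable def pointsOfDegree (r : ℕ) : Finset k :=
  ((X ^ (Fintype.card F ^ r) - X : k[X]).roots.toFinset).filter fun θ => pointDegree F θ = r

/-- A point of degree r generates a field with q^r elements, so it is a root of X^(q^r) − X. The
restriction to such roots only serves to make the set finite, with at most q^r elements. -/
lemma mem_pointsOfDegree {r : ℕ} {θ : k} : θ ∈ pointsOfDegree F k r ↔ pointDegree F θ = r := by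
  classical
  simp only [pointsOfDegree, Finset.mem_filter, Multiset.mem_toFinset, and_iff_right_iff_imp]
  rintro rfl
  have hint : IsIntegral F θ := Algebra.IsIntegral.isIntegral θ
  have hq : 1 < Fintype.card F ^ pointDegree F θ :=
    Nat.one_lt_pow (pointDegree_pos θ).ne' Fintype.one_lt_card
  rw [mem_roots (FiniteField.X_pow_card_sub_X_ne_zero k hq), IsRoot.def]
  have : FiniteDimensional F (IntermediateField.adjoin F {θ}) :=
    IntermediateField.adjoin.finiteDimensional hint
  have : Finite (IntermediateField.adjoin F {θ}) := Module.finite_of_finite F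
  have := Fintype.ofFinite (IntermediateField.adjoin F {θ})
  have hc := FiniteField.pow_card (IntermediateField.AdjoinSimple.gen F θ)
  rw [Module.card_eq_pow_finrank (K := F), IntermediateField.adjoin.finrank hint] at hc
  have := congrArg (algebraMap _ k) hc
  rw [map_pow, IntermediateField.AdjoinSimple.algebraMap_gen] at this
  simp [pointDegree, this]

lemma card_pointsOfDegree_le (r : ℕ) (hr : 0 < r) :
    (pointsOfDegree F k r).card ≤ Fintype.card F ^ r := by
  classical
  have hq : 1 < Fintype.card F ^ r := Nat.one_lt_pow hr.ne' Fintype.one_lt_card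
  calc _ ≤ _ := Finset.card_filter_le _ _
    _ ≤ _ := Multiset.toFinset_card_le _
    _ ≤ _ := card_roots' _
    _ = _ := FiniteField.X_pow_card_sub_X_natDegree_eq k hq

/-- The family of pairs defining the rational functions `a / b` with `a`, `b` monic of degrees
`e + 1` and `e`. -/
noncomputable def monicPairs (F : Type*) [Field F] [Fintype F] (e : ℕ) : Finset (F[X] × F[X]) :=
  monics F (e + 1) ×ˢ monics F e

lemma card_monicPairs (e : ℕ) : (monicPairs F e).card = Fintype.card F ^ (2 * e + 1) := by
  rw [monicPairs, Finset.card_product, card_monics, card_monics, ← pow_add]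
  congr 1; omega

/-- The linear form `a - β b` attached to the point `β`, and `b` attached to the point `∞`. -/
noncomputable def form (o : Option k) (v : F[X] × F[X]) : k[X] :=
  match o with
  | some β => v.1.map (algebraMap F k) - C β * v.2.map (algebraMap F k)
  | none => v.2.map (algebraMap F k)

open Classical in
-- For finite β and fixed b, all solutions a lie in one residue class modulo `minpoly F θ ^ s`; for
-- ∞ the condition concerns b alone. The hypothesis `hs` makes the truncated exponents exact.
lemma card_pow_dvd_form_le (e : ℕ) (o : Option k) (θ : k) (s : ℕ)
    (hs : pointDegree F θ * s ≤ e) :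
    ((monicPairs F e).filter fun v => (X - C θ) ^ s ∣ form o v).card
      * Fintype.card F ^ (pointDegree F θ * s) ≤ Fintype.card F ^ (2 * e + 1) := by
  have hdeg : pointDegree F θ * s ≤ ((minpoly F θ) ^ s).natDegree := by
    rw [natDegree_pow, mul_comm]; rfl
  cases o with
  | none =>
    have := card_filter_product_le_right (monics F (e + 1)) (monics F e)
      (fun v => (X - C θ) ^ s ∣ form (none : Option k) v)
      (Fintype.card F ^ (e - pointDegree F θ * s)) (fun a _ =>
        card_filter_monics_le _ ((minpoly F θ) ^ s) hdeg (fun b b' hb hb' => by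
          refine minpoly_pow_dvd_of_pow_dvd_map θ s _ ?_
          rw [Polynomial.map_sub]
          exact dvd_sub hb hb'))
    rw [card_monics] at this
    calc _ ≤ _ := Nat.mul_le_mul_right _ this
      _ = _ := by rw [mul_assoc, ← pow_add, ← pow_add]; congr 1; omega
  | some β =>
    have := card_filter_product_le_left (monics F (e + 1)) (monics F e)
      (fun v => (X - C θ) ^ s ∣ form (some β : Option k) v)
      (Fintype.card F ^ (e + 1 - pointDegree F θ * s)) (fun a _ =>
        card_filter_monics_le _ ((minpoly F θ) ^ s) hdeg (fun b b' hb hb' => by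
          refine minpoly_pow_dvd_of_pow_dvd_map θ s _ ?_
          rw [Polynomial.map_sub]
          have := dvd_sub hb hb'
          simpa [form] using this))
    rw [card_monics] at this
    calc _ ≤ _ := Nat.mul_le_mul_right _ this
      _ = _ := by rw [mul_right_comm, ← pow_add, ← pow_add]; congr 1; omega

open Classical in
-- The conditions on a and on b are independent, each saving q^r for a point of degree r. The total
-- saving q^(2r) beats the at most q^r points of that degree.
lemma card_common_zero_le (e : ℕ) (θ : k) (hs : pointDegree F θ ≤ e) :
    ((monicPairs F e).filter fun v => aeval θ v.1 = 0 ∧ aeval θ v.2 = 0).card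
      * Fintype.card F ^ (2 * pointDegree F θ) ≤ Fintype.card F ^ (2 * e + 1) := by
  have key : ∀ n, ((monics F n).filter fun a => aeval θ a = 0).card
      ≤ Fintype.card F ^ (n - pointDegree F θ) := fun n =>
    card_filter_monics_le _ (minpoly F θ) le_rfl (fun a b ha hb => by
      refine minpoly.dvd F θ ?_
      rw [map_sub, ha, hb, sub_zero])
  have := Nat.mul_le_mul (key (e + 1)) (key e)
  rw [← Finset.card_product, ← Finset.filter_product] at this
  calc _ ≤ _ := Nat.mul_le_mul_right _ this
    _ = _ := by rw [← pow_add, ← pow_add]; congr 1; omega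

end Counting

/-! ### Union bounds over points of moderate degree -/

section BadSets

variable {F : Type*} [Field F] [Fintype F]
variable {k : Type*} [Field k] [Algebra F k] [Algebra.IsAlgebraic F k]

lemma sum_Ioc_inv_pow_le {Q : ℝ} (hQ : 2 ≤ Q) (D N : ℕ) :
    ∑ r ∈ Finset.Ioc D N, (Q ^ r)⁻¹ ≤ (Q ^ D)⁻¹ := by
  rcases le_total N D with h | h
  · rw [Finset.Ioc_eq_empty (by omega)]; simp; positivity
  · have hpos : 0 < (Q ^ N)⁻¹ := by positivity
    -- The sharper bound is the one that passes through induction: since Q ≥ 2, each term is at most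
    -- the next difference of the telescoping right side.
    suffices ∑ r ∈ Finset.Ioc D N, (Q ^ r)⁻¹ ≤ (Q ^ D)⁻¹ - (Q ^ N)⁻¹ by linarith
    clear hpos
    induction N, h using Nat.le_induction with
    | base => simp
    | succ n hn ih =>
      rw [← Finset.insert_Ioc_right_eq_Ioc_add_one (by omega), Finset.sum_insert (by simp)]
      have : 2 * (Q ^ (n + 1))⁻¹ ≤ (Q ^ n)⁻¹ := by
        rw [pow_succ, mul_inv]
        have h1 : 2 * Q⁻¹ ≤ 1 := by
          rw [← div_eq_mul_inv, div_le_one (by linarith)]; exact hQ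
        have h2 : 0 < (Q ^ n)⁻¹ := by positivity
        nlinarith
      linarith

lemma two_le_card_real : (2 : ℝ) ≤ Fintype.card F := by
  exact_mod_cast Fintype.one_lt_card (α := F)

open Classical in
/-- A union bound over the geometric points with degree in `(D, N]`. -/
lemma card_filter_exists_point_le {α : Type*} (V : Finset α) (T : ℝ) (hT : 0 ≤ T) (D N : ℕ)
    (P : k → α → Prop) (C : ℝ) (hC : 0 ≤ C)
    (h : ∀ θ : k, D < pointDegree F θ → pointDegree F θ ≤ N →
      ((V.filter (P θ)).card : ℝ) ≤ C * T * ((Fintype.card F : ℝ) ^ (2 * pointDegree F θ))⁻¹) :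
    ((V.filter fun v => ∃ θ : k, D < pointDegree F θ ∧ pointDegree F θ ≤ N ∧ P θ v).card : ℝ)
      ≤ C * T * ((Fintype.card F : ℝ) ^ D)⁻¹ := by
  have hQ := two_le_card_real (F := F)
  have hsub : (V.filter fun v => ∃ θ : k, D < pointDegree F θ ∧ pointDegree F θ ≤ N ∧ P θ v) ⊆
      (Finset.Ioc D N).biUnion fun r => (pointsOfDegree F k r).biUnion fun θ => V.filter (P θ) := by
    intro v hv
    obtain ⟨hv, θ, h1, h2, h3⟩ := Finset.mem_filter.1 hv
    simp only [Finset.mem_biUnion, Finset.mem_Ioc, Finset.mem_filter]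
    exact ⟨_, ⟨h1, h2⟩, θ, mem_pointsOfDegree.2 rfl, hv, h3⟩
  calc _ ≤ (((Finset.Ioc D N).biUnion fun r => (pointsOfDegree F k r).biUnion
              fun θ => V.filter (P θ)).card : ℝ) := by exact_mod_cast Finset.card_le_card hsub
    _ ≤ ∑ r ∈ Finset.Ioc D N, ∑ θ ∈ pointsOfDegree F k r, ((V.filter (P θ)).card : ℝ) := by
        have := (Finset.card_biUnion_le (s := Finset.Ioc D N) (t := fun r =>
          (pointsOfDegree F k r).biUnion fun θ => V.filter (P θ))).trans
          (Finset.sum_le_sum fun r _ => Finset.card_biUnion_le)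
        exact_mod_cast this
    _ ≤ ∑ r ∈ Finset.Ioc D N, C * T * ((Fintype.card F : ℝ) ^ r)⁻¹ := by
        refine Finset.sum_le_sum fun r hr => ?_
        rw [Finset.mem_Ioc] at hr
        calc _ ≤ ∑ θ ∈ pointsOfDegree F k r, C * T * ((Fintype.card F : ℝ) ^ (2 * r))⁻¹ := by
              refine Finset.sum_le_sum fun θ hθ => ?_
              rw [mem_pointsOfDegree] at hθ
              have := h θ (by omega) (by omega)
              rwa [hθ] at this
          _ = (pointsOfDegree F k r).card * (C * T * ((Fintype.card F : ℝ) ^ (2 * r))⁻¹) := by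
              rw [Finset.sum_const, nsmul_eq_mul]
          _ ≤ (Fintype.card F : ℝ) ^ r * (C * T * ((Fintype.card F : ℝ) ^ (2 * r))⁻¹) := by
              gcongr
              exact_mod_cast card_pointsOfDegree_le r (by omega)
          _ = _ := by
              rw [two_mul, pow_add]; field_simp
    _ = C * T * ∑ r ∈ Finset.Ioc D N, ((Fintype.card F : ℝ) ^ r)⁻¹ := by rw [Finset.mul_sum]
    _ ≤ _ := by gcongr; exact sum_Ioc_inv_pow_le hQ D N

open Classical in
lemma card_exists_pow_dvd_form_le (e : ℕ) (B : Finset (Option k)) (θ : k) (s : ℕ)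
    (hs : pointDegree F θ * s ≤ e) :
    (((monicPairs F e).filter fun v => ∃ o ∈ B, (X - C θ) ^ s ∣ form o v).card : ℝ) ≤
      B.card * (Fintype.card F : ℝ) ^ (2 * e + 1) *
        ((Fintype.card F : ℝ) ^ (pointDegree F θ * s))⁻¹ := by
  have hQ := two_le_card_real (F := F)
  have hsub : ((monicPairs F e).filter fun v => ∃ o ∈ B, (X - C θ) ^ s ∣ form o v) ⊆
      B.biUnion fun o => (monicPairs F e).filter fun v => (X - C θ) ^ s ∣ form o v := by
    intro v hv
    obtain ⟨hv, o, ho, h⟩ := Finset.mem_filter.1 hv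
    simp only [Finset.mem_biUnion, Finset.mem_filter]
    exact ⟨o, ho, hv, h⟩
  have h1 := (Finset.card_le_card hsub).trans Finset.card_biUnion_le
  calc _ ≤ ∑ o ∈ B, (((monicPairs F e).filter fun v => (X - C θ) ^ s ∣ form o v).card : ℝ) := by
        exact_mod_cast h1
    _ ≤ ∑ o ∈ B, ((Fintype.card F : ℝ) ^ (2 * e + 1) *
          ((Fintype.card F : ℝ) ^ (pointDegree F θ * s))⁻¹) := by
        refine Finset.sum_le_sum fun o _ => ?_
        rw [← div_eq_mul_inv, le_div_iff₀ (by positivity)]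
        exact_mod_cast card_pow_dvd_form_le e o θ s hs
    _ = _ := by rw [Finset.sum_const, nsmul_eq_mul, mul_assoc]

open Classical in
-- Up to degree e/2 the congruence modulo the square of the minimal polynomial still has modulus of
-- degree at most e, so it saves the full q^(2r). Larger degrees need `card_bad_large_square_le`.
lemma card_bad_square_le (e D : ℕ) (B : Finset (Option k)) :
    (((monicPairs F e).filter fun v => ∃ θ : k, D < pointDegree F θ ∧ pointDegree F θ ≤ e / 2 ∧
      ∃ o ∈ B, (X - C θ) ^ 2 ∣ form o v).card : ℝ) ≤
      B.card * (Fintype.card F : ℝ) ^ (2 * e + 1) * ((Fintype.card F : ℝ) ^ D)⁻¹ := by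
  have := card_filter_exists_point_le (F := F) (monicPairs F e)
    ((Fintype.card F : ℝ) ^ (2 * e + 1)) (by positivity) D (e / 2)
    (fun θ v => ∃ o ∈ B, (X - C θ) ^ 2 ∣ form o v) B.card (by positivity) ?_
  · convert this
  intro θ h1 h2
  have key := card_exists_pow_dvd_form_le (F := F) e B θ 2 (by omega)
  rw [mul_comm (pointDegree F θ)] at key
  convert key

open Classical in
lemma card_bad_common_zero_le (e D : ℕ) :
    (((monicPairs F e).filter fun v => ∃ θ : k, D < pointDegree F θ ∧ pointDegree F θ ≤ e ∧
      (aeval θ v.1 = 0 ∧ aeval θ v.2 = 0)).card : ℝ) ≤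
      1 * (Fintype.card F : ℝ) ^ (2 * e + 1) * ((Fintype.card F : ℝ) ^ D)⁻¹ := by
  have hQ := two_le_card_real (F := F)
  refine card_filter_exists_point_le (F := F) (monicPairs F e) _ (by positivity) D e
    (fun θ v => aeval θ v.1 = 0 ∧ aeval θ v.2 = 0) 1 (by positivity) ?_
  intro θ h1 h2
  rw [one_mul, ← div_eq_mul_inv, le_div_iff₀ (by positivity)]
  exact_mod_cast card_common_zero_le e θ h2

open Classical in
-- For r ≥ 1 one has rM ≥ (M − 2) + 2r. The part 2r makes the sum over points converge, and M − 2 is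
-- left as a saving that can be made as strong as desired.
lemma card_bad_power_le (e D M : ℕ) (B : Finset (Option k)) (hM : 2 ≤ M) (he : D * M ≤ e) :
    (((monicPairs F e).filter fun v => ∃ θ : k, 0 < pointDegree F θ ∧ pointDegree F θ ≤ D ∧
      ∃ o ∈ B, (X - C θ) ^ M ∣ form o v).card : ℝ) ≤
      B.card * ((Fintype.card F : ℝ) ^ (M - 2))⁻¹ * (Fintype.card F : ℝ) ^ (2 * e + 1) := by
  have hQ := two_le_card_real (F := F)
  have := card_filter_exists_point_le (F := F) (monicPairs F e)
    ((Fintype.card F : ℝ) ^ (2 * e + 1)) (by positivity) 0 D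
    (fun θ v => ∃ o ∈ B, (X - C θ) ^ M ∣ form o v)
    (B.card * ((Fintype.card F : ℝ) ^ (M - 2))⁻¹) (by positivity) ?_
  · rw [pow_zero, inv_one, mul_one] at this
    convert this
  intro θ h1 h2
  have key := card_exists_pow_dvd_form_le e B θ M ((Nat.mul_le_mul_right M h2).trans he)
  refine le_trans (le_of_eq ?_) (key.trans ?_)
  · congr!
  have hle : ((Fintype.card F : ℝ) ^ (pointDegree F θ * M))⁻¹ ≤
      ((Fintype.card F : ℝ) ^ (M - 2))⁻¹ * ((Fintype.card F : ℝ) ^ (2 * pointDegree F θ))⁻¹ := by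
    rw [← mul_inv, ← pow_add]
    gcongr
    · linarith
    · obtain ⟨M, rfl⟩ := Nat.exists_eq_add_of_le hM
      have : M ≤ pointDegree F θ * M := Nat.le_mul_of_pos_left _ h1
      rw [mul_add, Nat.add_sub_cancel_left]
      omega
  calc _ ≤ B.card * (Fintype.card F : ℝ) ^ (2 * e + 1) * (((Fintype.card F : ℝ) ^ (M - 2))⁻¹ *
        ((Fintype.card F : ℝ) ^ (2 * pointDegree F θ))⁻¹) := by gcongr
    _ = _ := by ring

open Classical in
-- Markov's inequality. Each of the at most q^r points of degree r is a root of some form for a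
-- proportion at most |B|q^(−r) of the pairs, so the average number of roots of degree at most ρ is
-- at most ρ|B|.
lemma card_many_small_roots_le (e ρ : ℕ) (B : Finset (Option k)) (hρ : ρ ≤ e) :
    (e : ℝ) * ((monicPairs F e).filter fun v => e < 2 * (((Finset.Ioc 0 ρ).biUnion fun r =>
        pointsOfDegree F k r).filter fun θ => ∃ o ∈ B, (X - C θ) ∣ form o v).card).card ≤
      2 * (ρ * B.card * (Fintype.card F : ℝ) ^ (2 * e + 1)) := by
  have hQ := two_le_card_real (F := F)
  set Sm := (Finset.Ioc 0 ρ).biUnion fun r => pointsOfDegree F k r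
  set N : F[X] × F[X] → ℕ := fun v => (Sm.filter fun θ => ∃ o ∈ B, (X - C θ) ∣ form o v).card
  have h1 : e * ((monicPairs F e).filter fun v => e < 2 * N v).card ≤
      2 * ∑ v ∈ monicPairs F e, N v := by
    rw [Finset.mul_sum]
    calc _ = ∑ v ∈ (monicPairs F e).filter fun v => e < 2 * N v, e := by
          rw [Finset.sum_const, smul_eq_mul, mul_comm]
      _ ≤ ∑ v ∈ (monicPairs F e).filter fun v => e < 2 * N v, 2 * N v :=
          Finset.sum_le_sum fun v hv => (Finset.mem_filter.1 hv).2.le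
      _ ≤ _ := Finset.sum_le_sum_of_subset (Finset.filter_subset _ _)
  have h2 : ∑ v ∈ monicPairs F e, N v =
      ∑ θ ∈ Sm, ((monicPairs F e).filter fun v => ∃ o ∈ B, (X - C θ) ^ 1 ∣ form o v).card := by
    simp only [N, Finset.card_filter, pow_one]
    exact Finset.sum_comm
  have h3 : ((∑ v ∈ monicPairs F e, N v : ℕ) : ℝ) ≤
      ρ * B.card * (Fintype.card F : ℝ) ^ (2 * e + 1) := by
    rw [h2]
    push_cast
    rw [Finset.sum_biUnion]
    · calc _ ≤ ∑ r ∈ Finset.Ioc 0 ρ, ∑ θ ∈ pointsOfDegree F k r,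
            (B.card * (Fintype.card F : ℝ) ^ (2 * e + 1) * ((Fintype.card F : ℝ) ^ r)⁻¹) := by
            refine Finset.sum_le_sum fun r hr => Finset.sum_le_sum fun θ hθ => ?_
            rw [mem_pointsOfDegree] at hθ
            rw [Finset.mem_Ioc] at hr
            have := card_exists_pow_dvd_form_le e B θ 1 (by rw [hθ]; omega)
            rwa [mul_one, hθ] at this
        _ ≤ ∑ r ∈ Finset.Ioc 0 ρ, (B.card * (Fintype.card F : ℝ) ^ (2 * e + 1)) := by
            refine Finset.sum_le_sum fun r hr => ?_
            rw [Finset.mem_Ioc] at hr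
            rw [Finset.sum_const, nsmul_eq_mul]
            have := card_pointsOfDegree_le (F := F) (k := k) r hr.1
            calc _ ≤ (Fintype.card F : ℝ) ^ r * (B.card * (Fintype.card F : ℝ) ^ (2 * e + 1) *
                  ((Fintype.card F : ℝ) ^ r)⁻¹) := by gcongr; exact_mod_cast this
              _ = _ := by field_simp
        _ = _ := by simp [mul_assoc]
    · intro r _ r' _ hrr
      rw [Function.onFun, Finset.disjoint_left]
      intro θ h h'
      rw [mem_pointsOfDegree] at h h'
      exact hrr (h.symm.trans h')
  calc _ ≤ ((2 * ∑ v ∈ monicPairs F e, N v : ℕ) : ℝ) := by exact_mod_cast h1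
    _ = 2 * ((∑ v ∈ monicPairs F e, N v : ℕ) : ℝ) := by push_cast; ring
    _ ≤ _ := by gcongr

end BadSets

/-! ### Double roots of large degree, by derivatives in characteristic p -/

section LargeSquares

variable {F : Type*} [Field F] [Fintype F]
variable {k : Type*} [Field k] [Algebra F k] [Algebra.IsAlgebraic F k]

lemma derivative_add_pow_char (p : ℕ) [CharP F p] (a s : F[X]) :
    derivative (a + s ^ p) = derivative a := by
  rw [derivative_add, derivative_pow, CharP.cast_eq_zero]
  simp

lemma sub_pow_char_aeval_eq_zero (p : ℕ) [Fact p.Prime] [CharP F p] (s s' : F[X]) (θ : k)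
    (h : aeval θ (s ^ p - s' ^ p) = 0) : aeval θ (s - s') = 0 := by
  rw [← sub_pow_char s s', map_pow] at h
  exact eq_zero_of_pow_eq_zero h

open Classical in
/-- Given `b`, few `a` satisfy `a' = β b'`. -/
lemma card_derivative_eq_le (p : ℕ) [Fact p.Prime] [CharP F p] (e : ℕ) (β : k) (b : F[X]) :
    ((monics F (e + 1)).filter fun a =>
      derivative (a.map (algebraMap F k) - C β * b.map (algebraMap F k)) = 0).card ≤
      Fintype.card F ^ (e / p + 1) := by
  have hp : 0 < p := (Fact.out : p.Prime).pos
  have : ((monics F (e + 1)).filter fun a =>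
      derivative (a.map (algebraMap F k) - C β * b.map (algebraMap F k)) = 0).card ≤
      (Finset.univ : Finset (Fin (e / p + 1) → F)).card := by
    refine Finset.card_le_card_of_injOn (fun a i => a.coeff (p * i)) (fun _ _ => by simp) ?_
    intro a ha a' ha' haa
    rw [Finset.mem_coe, Finset.mem_filter] at ha ha'
    have hd : derivative (a - a') = 0 := by
      have := sub_eq_zero.2 (ha.2.trans ha'.2.symm)
      rw [← derivative_sub, sub_sub_sub_cancel_right, ← Polynomial.map_sub, derivative_map] at this
      exact (Polynomial.map_eq_zero _).1 this
    have hlt := degree_sub_lt_of_mem_monics ha.1 ha'.1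
    rw [← sub_eq_zero]
    ext n
    rw [coeff_zero]
    by_cases hn : e + 1 ≤ n
    · exact coeff_eq_zero_of_degree_lt (hlt.trans_le (by exact_mod_cast hn))
    -- A vanishing derivative kills the coefficients at indices prime to p; those at multiples of p
    -- are the ones recorded by the map.
    by_cases hpn : p ∣ n
    · obtain ⟨i, rfl⟩ := hpn
      have hi : i < e / p + 1 := by
        rw [Nat.lt_succ_iff, Nat.le_div_iff_mul_le hp, mul_comm]; omega
      have := congrFun haa ⟨i, hi⟩
      simp only at this
      rw [coeff_sub, this, sub_self]
    · obtain ⟨n, rfl⟩ : ∃ m, n = m + 1 := Nat.exists_eq_succ_of_ne_zero (by rintro rfl; simp at hpn)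
      have := congrArg (fun f => f.coeff n) hd
      simp only [coeff_derivative, coeff_zero] at this
      rcases mul_eq_zero.1 this with h | h
      · exact h
      · exfalso
        apply hpn
        rw [← CharP.cast_eq_zero_iff F p]
        push_cast; exact h
  simpa using this

open Classical in
-- To each bad a with chosen double root t(a), and each s of degree at most e/p, attach the pair (a
-- + s^p, t(a)). Adding s^p leaves the derivative of a − βb unchanged, so t(a) is among its at most
-- e roots: there are at most q^(e+1)·e values. The map is injective because t(a) has degree larger
-- than e/p.
lemma card_square_mul_le (p : ℕ) [Fact p.Prime] [CharP F p] (e : ℕ) (β : k) (b : F[X])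
    (hb : b ∈ monics F e) :
    ((monics F (e + 1)).filter fun a =>
      derivative (a.map (algebraMap F k) - C β * b.map (algebraMap F k)) ≠ 0 ∧
      ∃ θ : k, e < 2 * pointDegree F θ ∧
        (X - C θ) ^ 2 ∣ (a.map (algebraMap F k) - C β * b.map (algebraMap F k))).card *
      Fintype.card F ^ (e / p + 1) ≤ Fintype.card F ^ (e + 1) * e := by
  have hp2 : 2 ≤ p := (Fact.out : p.Prime).two_le
  set l : F[X] → k[X] := fun a => a.map (algebraMap F k) - C β * b.map (algebraMap F k) with hl
  set A := (monics F (e + 1)).filter fun a => derivative (l a) ≠ 0 ∧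
      ∃ θ : k, e < 2 * pointDegree F θ ∧ (X - C θ) ^ 2 ∣ l a with hA
  have hder : ∀ a s, derivative (l (a + s ^ p)) = derivative (l a) := by
    intro a s
    simp only [hl, derivative_sub, derivative_map, derivative_add_pow_char]
  have hdeg : ∀ a ∈ monics F (e + 1), (derivative (l a)).natDegree ≤ e := by
    intro a ha
    rw [mem_monics] at ha hb
    have : (l a).natDegree ≤ e + 1 := by
      refine (natDegree_sub_le _ _).trans (max_le ?_ ?_)
      · exact natDegree_map_le.trans ha.2.le
      · exact (natDegree_C_mul_le _ _).trans (natDegree_map_le.trans (by omega))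
    have := natDegree_derivative_le (l a)
    omega
  have hmem : ∀ a ∈ A, ∃ θ : k, e < 2 * pointDegree F θ ∧ (X - C θ) ^ 2 ∣ l a := fun a ha =>
    (Finset.mem_filter.1 ha).2.2
  choose! t ht using hmem
  have hcard : (A ×ˢ polysLT F (e / p + 1)).card ≤
      ((monics F (e + 1)).sigma fun c => (derivative (l c)).roots.toFinset).card := by
    refine Finset.card_le_card_of_injOn (fun x => ⟨x.1 + x.2 ^ p, t x.1⟩) ?_ ?_
    · rintro ⟨a, s⟩ h
      rw [Finset.mem_coe, Finset.mem_product] at h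
      obtain ⟨ha, hs⟩ := h
      simp only at ha hs
      have ha' := (Finset.mem_filter.1 ha)
      have hs' : (s ^ p).degree < (e + 1 : ℕ) := by
        rw [mem_polysLT] at hs
        by_cases hs0 : s = 0
        · rw [hs0, zero_pow (by omega), degree_zero]; exact WithBot.bot_lt_coe _
        rw [degree_eq_natDegree hs0] at hs
        rw [degree_eq_natDegree (pow_ne_zero _ hs0), natDegree_pow]
        have h1 : s.natDegree ≤ e / p := by
          have : s.natDegree < e / p + 1 := by exact_mod_cast hs
          omega
        have h2 := (Nat.le_div_iff_mul_le (by omega)).1 h1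
        rw [mul_comm] at h2
        exact_mod_cast Nat.lt_succ_of_le h2
      simp only [Finset.coe_sigma, Set.mem_sigma_iff, Finset.mem_coe, Multiset.mem_toFinset]
      refine ⟨?_, ?_⟩
      · have h0 := mem_monics.1 ha'.1
        have hd : (s ^ p).degree < a.degree := by
          rw [degree_eq_natDegree h0.1.ne_zero, h0.2]; exact hs'
        exact mem_monics.2 ⟨h0.1.add_of_left hd, by
          rw [← h0.2]; exact natDegree_add_eq_left_of_degree_lt hd⟩
      · rw [hder, mem_roots ha'.2.1, IsRoot.def]
        have h2 := (ht a ha).2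
        obtain ⟨w, hw⟩ := h2
        rw [hw]
        simp [derivative_mul, derivative_pow]
    · rintro ⟨a, s⟩ h ⟨a', s'⟩ h' heq
      rw [Finset.mem_coe, Finset.mem_product] at h h'
      simp only [Sigma.mk.injEq, heq_eq_eq] at heq h h'
      obtain ⟨h1, h2⟩ := heq
      -- Injectivity: if a + s^p = a' + s'^p with the same double root t, then a and a' both take
      -- the value βb(t) at t. So (s − s')^p vanishes at t, and s − s' has degree below that of t.
      have hroot : ∀ a ∈ A, aeval (t a) a = β * aeval (t a) b := by
        intro a ha
        have : (X - C (t a)) ∣ l a := (dvd_pow_self _ two_ne_zero).trans (ht a ha).2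
        rw [dvd_iff_isRoot, IsRoot.def] at this
        simpa [hl, sub_eq_zero] using this
      have h3 : aeval (t a) (s ^ p - s' ^ p) = 0 := by
        have e1 : s ^ p - s' ^ p = a' - a := by linear_combination h1
        rw [e1, map_sub]
        have e2 := hroot a h.1
        have e3 := hroot a' h'.1
        rw [← h2] at e3
        rw [e2, e3, sub_self]
      have h4 := minpoly.dvd F _ (sub_pow_char_aeval_eq_zero p s s' _ h3)
      have h5 : s = s' := by
        refine eq_of_dvd_sub_of_degree_lt (s := e / p + 1) ?_ h4 ?_
        · have := (ht a h.1).1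
          have h6 : e / p ≤ e / 2 := Nat.div_le_div_left hp2 (by norm_num)
          rw [pointDegree] at this
          omega
        · exact (degree_sub_le _ _).trans_lt
            (max_lt (mem_polysLT.1 h.2) (mem_polysLT.1 h'.2))
      subst h5
      simpa using h1
  rw [Finset.card_product, card_polysLT, Finset.card_sigma] at hcard
  refine hcard.trans ?_
  rw [← card_monics (F := F) (e + 1), ← smul_eq_mul]
  refine Finset.sum_le_card_nsmul _ _ _ fun c hc => ?_
  exact (Multiset.toFinset_card_le _).trans ((card_roots' _).trans (hdeg c hc))

open Classical in
-- For each b, the a with a' = βb' identically are few for lack of free coefficients; the others are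
-- handled by `card_square_mul_le`.
lemma card_bad_large_square_some_le (p : ℕ) [Fact p.Prime] [CharP F p] (e : ℕ) (β : k) :
    (((monicPairs F e).filter fun v => ∃ θ : k, e < 2 * pointDegree F θ ∧
      (X - C θ) ^ 2 ∣ form (some β) v).card : ℝ) ≤
      (Fintype.card F : ℝ) ^ (2 * e + 1) *
        (((Fintype.card F : ℝ) ^ (e / 2))⁻¹ + e * ((Fintype.card F : ℝ) ^ (e / p))⁻¹) := by
  have hQ := two_le_card_real (F := F)
  have hp2 : 2 ≤ p := (Fact.out : p.Prime).two_le
  have hmain : ∀ b ∈ monics F e, (((monics F (e + 1)).filter fun a => ∃ θ : k,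
      e < 2 * pointDegree F θ ∧ (X - C θ) ^ 2 ∣ form (some β) (a, b)).card : ℝ) ≤
      (Fintype.card F : ℝ) ^ (e + 1) *
        (((Fintype.card F : ℝ) ^ (e / 2))⁻¹ + e * ((Fintype.card F : ℝ) ^ (e / p))⁻¹) := by
    intro b hb
    have h1 := card_derivative_eq_le p e β b
    have h2 := card_square_mul_le p e β b hb
    have hsub : ((monics F (e + 1)).filter fun a => ∃ θ : k,
        e < 2 * pointDegree F θ ∧ (X - C θ) ^ 2 ∣ form (some β) (a, b)) ⊆
        ((monics F (e + 1)).filter fun a =>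
          derivative (a.map (algebraMap F k) - C β * b.map (algebraMap F k)) = 0) ∪
        ((monics F (e + 1)).filter fun a =>
          derivative (a.map (algebraMap F k) - C β * b.map (algebraMap F k)) ≠ 0 ∧
          ∃ θ : k, e < 2 * pointDegree F θ ∧
            (X - C θ) ^ 2 ∣ (a.map (algebraMap F k) - C β * b.map (algebraMap F k))) := by
      intro a ha
      obtain ⟨ha, hθ⟩ := Finset.mem_filter.1 ha
      simp only [Finset.mem_union, Finset.mem_filter]
      by_cases hd : derivative (a.map (algebraMap F k) - C β * b.map (algebraMap F k)) = 0
      · exact Or.inl ⟨ha, hd⟩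
      · exact Or.inr ⟨ha, hd, hθ⟩
    have h3 := (Finset.card_le_card hsub).trans (Finset.card_union_le _ _)
    refine (Nat.cast_le (α := ℝ).2 h3).trans ?_
    push_cast
    rw [mul_add]
    refine add_le_add ?_ ?_
    · calc _ ≤ ((Fintype.card F : ℝ) ^ (e / p + 1)) := by exact_mod_cast h1
        _ ≤ _ := by
          rw [← div_eq_mul_inv, le_div_iff₀ (by positivity), ← pow_add]
          have h6 : e / p ≤ e / 2 := Nat.div_le_div_left hp2 (by norm_num)
          exact pow_le_pow_right₀ (by linarith) (by omega)
    · have h2' := (Nat.cast_le (α := ℝ)).2 h2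
      push_cast at h2'
      rw [← mul_assoc, ← div_eq_mul_inv, le_div_iff₀ (by positivity)]
      refine le_trans ?_ h2'
      gcongr
      · linarith
      · omega
  have hsum : ((monicPairs F e).filter fun v => ∃ θ : k, e < 2 * pointDegree F θ ∧
      (X - C θ) ^ 2 ∣ form (some β) v).card = ∑ b ∈ monics F e, ((monics F (e + 1)).filter
        fun a => ∃ θ : k, e < 2 * pointDegree F θ ∧ (X - C θ) ^ 2 ∣ form (some β) (a, b)).card := by
    simp only [monicPairs, Finset.card_filter, Finset.sum_product_right]
  rw [hsum]
  push_cast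
  refine (Finset.sum_le_card_nsmul _ _ _ hmain).trans_eq ?_
  rw [card_monics, nsmul_eq_mul, ← mul_assoc]
  push_cast
  rw [← pow_add]
  congr 2; omega

open Classical in
lemma card_bad_large_square_le (p : ℕ) [Fact p.Prime] [CharP F p] (e : ℕ)
    (B : Finset (Option k)) :
    (((monicPairs F e).filter fun v => ∃ θ : k, e < 2 * pointDegree F θ ∧
      ∃ o ∈ B, (X - C θ) ^ 2 ∣ form o v).card : ℝ) ≤
      B.card * ((Fintype.card F : ℝ) ^ (2 * e + 1) *
        (((Fintype.card F : ℝ) ^ (e / 2))⁻¹ + e * ((Fintype.card F : ℝ) ^ (e / p))⁻¹)) := by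
  have hsub : ((monicPairs F e).filter fun v => ∃ θ : k, e < 2 * pointDegree F θ ∧
      ∃ o ∈ B, (X - C θ) ^ 2 ∣ form o v) ⊆ B.biUnion fun o => (monicPairs F e).filter fun v =>
        ∃ θ : k, e < 2 * pointDegree F θ ∧ (X - C θ) ^ 2 ∣ form o v := by
    intro v hv
    obtain ⟨hv, θ, hθ, o, ho, h⟩ := Finset.mem_filter.1 hv
    simp only [Finset.mem_biUnion, Finset.mem_filter]
    exact ⟨o, ho, hv, θ, hθ, h⟩
  have h1 := (Finset.card_le_card hsub).trans Finset.card_biUnion_le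
  refine (Nat.cast_le (α := ℝ).2 h1).trans ?_
  push_cast
  rw [← nsmul_eq_mul]
  refine Finset.sum_le_card_nsmul _ _ _ fun o _ => ?_
  cases o with
  | some β => exact card_bad_large_square_some_le p e β
  -- At ∞ the form is b itself, of degree e, which cannot be divisible by the square of a polynomial
  -- of degree greater than e/2.
  | none =>
    rw [Finset.filter_false_of_mem]
    · simp; positivity
    · rintro ⟨a, b⟩ hv ⟨θ, hθ, h⟩
      have h2 := minpoly_pow_dvd_of_pow_dvd_map θ 2 b h
      have hb := mem_monics.1 (Finset.mem_product.1 hv).2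
      have := natDegree_le_of_dvd h2 hb.1.ne_zero
      rw [natDegree_pow, hb.2] at this
      rw [pointDegree] at hθ
      omega

end LargeSquares

/-! ### At least half of all pairs are good, and what good pairs satisfy -/

section GoodPairs

variable {F : Type*} [Field F] [Fintype F]
variable {k : Type*} [Field k] [Algebra F k] [Algebra.IsAlgebraic F k]

open Classical in
variable (F k) in
/-- The geometric points of degree at most `D`. -/
noncomputable def smallPoints (D : ℕ) : Finset k :=
  (Finset.Ioc 0 D).biUnion fun r => pointsOfDegree F k r

lemma mem_smallPoints {D : ℕ} {θ : k} : θ ∈ smallPoints F k D ↔ pointDegree F θ ≤ D := by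
  simp only [smallPoints, Finset.mem_biUnion, Finset.mem_Ioc, mem_pointsOfDegree]
  constructor
  · rintro ⟨r, hr, rfl⟩; exact hr.2
  · intro h; exact ⟨_, ⟨pointDegree_pos θ, h⟩, rfl⟩

open Classical in
/-- The pairs `(a, b)` for which the multiple roots of the product of the forms attached to `B` are
under control, and which do not have too many roots of small degree. -/
structure IsGoodPair (B : Finset (Option k)) (D M e : ℕ) (v : F[X] × F[X]) : Prop where
  mem : v ∈ monicPairs F e
  simple : ∀ θ : k, D < pointDegree F θ → ∀ o ∈ B, ¬ (X - C θ) ^ 2 ∣ form o v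
  coprime : ∀ θ : k, D < pointDegree F θ → ¬ (aeval θ v.1 = 0 ∧ aeval θ v.2 = 0)
  power : ∀ θ : k, pointDegree F θ ≤ D → ∀ o ∈ B, ¬ (X - C θ) ^ M ∣ form o v
  few_small : 2 * ((smallPoints F k (e / (8 * B.card))).filter
    fun θ => ∃ o ∈ B, (X - C θ) ∣ form o v).card ≤ e

lemma eventually_large_square_small {Q : ℝ} (hQ : 2 ≤ Q) (p m : ℕ) (hp : 0 < p) :
    ∃ e₀ : ℕ, ∀ e : ℕ, e₀ ≤ e →
      (m : ℝ) * ((Q ^ (e / 2))⁻¹ + e * (Q ^ (e / p))⁻¹) ≤ 1 / 16 := by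
  have h1 : Filter.Tendsto (fun n : ℕ => ((1 / 2 : ℝ)) ^ n) Filter.atTop (nhds 0) :=
    tendsto_pow_atTop_nhds_zero_of_lt_one (by norm_num) (by norm_num)
  have h2 : Filter.Tendsto (fun n : ℕ => (n : ℝ) * ((1 / 2 : ℝ)) ^ n) Filter.atTop (nhds 0) :=
    tendsto_self_mul_const_pow_of_lt_one (by norm_num) (by norm_num)
  have h3 := (h1.comp (Nat.tendsto_div_const_atTop (n := 2) (by norm_num))).add
    (((h2.add h1).const_mul (p : ℝ)).comp (Nat.tendsto_div_const_atTop (n := p) hp.ne'))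
  have h4 := h3.const_mul (m : ℝ)
  simp only [add_zero, mul_zero, Function.comp_def] at h4
  have h5 := (h4.eventually (gt_mem_nhds (show (0 : ℝ) < 1 / 16 by norm_num)))
  obtain ⟨e₀, he₀⟩ := Filter.eventually_atTop.1 h5
  refine ⟨e₀, fun e he => le_trans ?_ (he₀ e he).le⟩
  have hinv : ∀ n : ℕ, (Q ^ n)⁻¹ ≤ (1 / 2 : ℝ) ^ n := by
    intro n
    rw [one_div, inv_pow]
    gcongr
  gcongr (m : ℝ) * ?_
  refine add_le_add (hinv _) ?_
  have h6 : (e : ℝ) ≤ p * ((e / p : ℕ) + 1) := by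
    exact_mod_cast (Nat.lt_mul_div_succ e hp).le
  calc (e : ℝ) * (Q ^ (e / p))⁻¹ ≤ (p * ((e / p : ℕ) + 1)) * (1 / 2 : ℝ) ^ (e / p) := by
        gcongr; exact hinv _
    _ = _ := by ring

open Classical in
-- With T the number of pairs, the bad events cost at most T/16 (moderate double roots together with
-- common zeros), T/16 (high multiplicity at small points), T/16 (large double roots) and T/4 (too
-- many small roots). The sum is below T/2.
theorem exists_card_good_ge (B : Finset (Option k)) (hB : 0 < B.card) :
    ∃ D M e₀ : ℕ, ∀ e : ℕ, e₀ ≤ e → (Fintype.card F : ℝ) ^ (2 * e + 1) / 2 ≤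
      ((monicPairs F e).filter (IsGoodPair B D M e)).card := by
  obtain ⟨p, hp⟩ := CharP.exists F
  have hpp : Fact p.Prime := ⟨(CharP.char_is_prime_or_zero F p).resolve_right
    (CharP.char_ne_zero_of_finite F p)⟩
  have hQ := two_le_card_real (F := F)
  -- The choice gives q^D ≥ 2^D ≥ D = 16(|B| + 1), and M = D + 2 turns the saving q^(M−2) of
  -- `card_bad_power_le` into q^D.
  set D := 16 * (B.card + 1) with hD
  set M := D + 2 with hM
  obtain ⟨e₁, he₁⟩ := eventually_large_square_small hQ p B.card hpp.out.pos
  have hQD : 16 * ((B.card : ℝ) + 1) ≤ (Fintype.card F : ℝ) ^ D := by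
    calc 16 * ((B.card : ℝ) + 1) = (D : ℕ) := by rw [hD]; push_cast; ring
      _ ≤ ((2 ^ D : ℕ) : ℝ) := by exact_mod_cast Nat.lt_two_pow_self.le
      _ ≤ _ := by push_cast; gcongr
  refine ⟨D, M, max e₁ (D * M + 1), fun e he => ?_⟩
  have hDM : D * M + 1 ≤ e := (le_max_right _ _).trans he
  set T := (Fintype.card F : ℝ) ^ (2 * e + 1) with hT
  have hT0 : 0 < T := by positivity
  set V := monicPairs F e
  set B1 := V.filter fun v => ∃ θ : k, D < pointDegree F θ ∧ pointDegree F θ ≤ e / 2 ∧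
      ∃ o ∈ B, (X - C θ) ^ 2 ∣ form o v
  set B2 := V.filter fun v => ∃ θ : k, D < pointDegree F θ ∧ pointDegree F θ ≤ e ∧
      (aeval θ v.1 = 0 ∧ aeval θ v.2 = 0)
  set B3 := V.filter fun v => ∃ θ : k, 0 < pointDegree F θ ∧ pointDegree F θ ≤ D ∧
      ∃ o ∈ B, (X - C θ) ^ M ∣ form o v
  set B4 := V.filter fun v => ∃ θ : k, e < 2 * pointDegree F θ ∧
      ∃ o ∈ B, (X - C θ) ^ 2 ∣ form o v
  set B5 := V.filter fun v => e < 2 * (((Finset.Ioc 0 (e / (8 * B.card))).biUnion fun r =>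
        pointsOfDegree F k r).filter fun θ => ∃ o ∈ B, (X - C θ) ∣ form o v).card
  have c1 : (B1.card : ℝ) ≤ B.card * T * ((Fintype.card F : ℝ) ^ D)⁻¹ := card_bad_square_le e D B
  have c2 : (B2.card : ℝ) ≤ 1 * T * ((Fintype.card F : ℝ) ^ D)⁻¹ := card_bad_common_zero_le e D
  have c3 : (B3.card : ℝ) ≤ B.card * ((Fintype.card F : ℝ) ^ (M - 2))⁻¹ * T :=
    card_bad_power_le e D M B (by omega) (by omega)
  have c4 : (B4.card : ℝ) ≤ B.card * (T * (((Fintype.card F : ℝ) ^ (e / 2))⁻¹ +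
      e * ((Fintype.card F : ℝ) ^ (e / p))⁻¹)) := card_bad_large_square_le p e B
  have c5 : (e : ℝ) * B5.card ≤ 2 * ((e / (8 * B.card) : ℕ) * B.card * T) :=
    card_many_small_roots_le e _ B (Nat.div_le_self _ _)
  have hx : (B.card + 1) * ((Fintype.card F : ℝ) ^ D)⁻¹ ≤ 1 / 16 := by
    rw [← div_eq_mul_inv, div_le_iff₀ (by positivity)]; linarith
  have d4 : (B4.card : ℝ) ≤ T / 16 := by
    have := mul_le_mul_of_nonneg_left (he₁ e ((le_max_left _ _).trans he)) hT0.le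
    linarith
  have d5 : (B5.card : ℝ) ≤ T / 4 := by
    have h1 : ((e / (8 * B.card) : ℕ) : ℝ) * B.card ≤ e / 8 := by
      have := Nat.div_mul_le_self e (8 * B.card)
      have h2 : ((e / (8 * B.card) : ℕ) : ℝ) * (8 * B.card) ≤ e := by exact_mod_cast this
      linarith
    have h2 : (0 : ℝ) < e := by
      have : 0 < e := by omega
      exact_mod_cast this
    have h3 : (e : ℝ) * B5.card ≤ e * (T / 4) := by
      refine c5.trans ?_
      have := mul_le_mul_of_nonneg_right h1 hT0.le
      linarith
    exact le_of_mul_le_mul_left h3 h2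
  have d1 : (B1.card : ℝ) + B2.card ≤ T / 16 := by
    have := mul_le_mul_of_nonneg_left hx hT0.le
    linarith
  have d3 : (B3.card : ℝ) ≤ T / 16 := by
    rw [show M - 2 = D by omega] at c3
    have := mul_le_mul_of_nonneg_left hx hT0.le
    have h0 : 0 < ((Fintype.card F : ℝ) ^ D)⁻¹ * T := by positivity
    linarith
  have hcov : V ⊆ (V.filter (IsGoodPair B D M e)) ∪ (B1 ∪ B2 ∪ B3 ∪ B4 ∪ B5) := by
    intro v hv
    by_contra hcon
    simp only [Finset.mem_union, not_or] at hcon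
    obtain ⟨hg, ⟨⟨⟨h1, h2⟩, h3⟩, h4⟩, h5⟩ := hcon
    apply hg
    simp only [B1, B2, B3, B4, B5, Finset.mem_filter, hv, true_and] at h1 h2 h3 h4 h5
    refine Finset.mem_filter.2 ⟨hv, hv, ?_, ?_, ?_, ?_⟩
    · intro θ hθ o ho hdvd
      by_cases hle : pointDegree F θ ≤ e / 2
      · exact h1 ⟨θ, hθ, hle, o, ho, hdvd⟩
      · exact h4 ⟨θ, by omega, o, ho, hdvd⟩
    · intro θ hθ hz
      refine h2 ⟨θ, hθ, ?_, hz⟩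
      have hb := mem_monics.1 (Finset.mem_product.1 hv).2
      have := natDegree_le_of_dvd (minpoly.dvd F θ hz.2) hb.1.ne_zero
      rwa [hb.2] at this
    · intro θ hθ o ho hdvd
      exact h3 ⟨θ, pointDegree_pos θ, hθ, o, ho, hdvd⟩
    · exact not_lt.1 h5
  have hle := (Finset.card_le_card hcov).trans (Finset.card_union_le _ _)
  have hle2 : (B1 ∪ B2 ∪ B3 ∪ B4 ∪ B5).card ≤ B1.card + B2.card + B3.card + B4.card + B5.card := by
    have e1 := Finset.card_union_le (B1 ∪ B2 ∪ B3 ∪ B4) B5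
    have e2 := Finset.card_union_le (B1 ∪ B2 ∪ B3) B4
    have e3 := Finset.card_union_le (B1 ∪ B2) B3
    have e4 := Finset.card_union_le B1 B2
    omega
  have hV : (V.card : ℝ) = T := by
    rw [hT, ← Nat.cast_pow, ← card_monicPairs]
  have hle3 := (Nat.cast_le (α := ℝ)).2 (hle.trans (Nat.add_le_add_left hle2 _))
  push_cast at hle3
  rw [hV] at hle3
  linarith

lemma aeval_eq_zero_of_forms {v : F[X] × F[X]} {o o' : Option k} (hne : o ≠ o') {θ : k}
    (h : (form o v).eval θ = 0) (h' : (form o' v).eval θ = 0) :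
    aeval θ v.1 = 0 ∧ aeval θ v.2 = 0 := by
  match o, o' with
  | none, none => exact absurd rfl hne
  | none, some β =>
    simp only [form, eval_sub, eval_mul, eval_C, eval_map_algebraMap] at h h'
    simpa [h] using h'
  | some β, none =>
    simp only [form, eval_sub, eval_mul, eval_C, eval_map_algebraMap] at h h'
    simpa [h'] using h
  | some β, some β' =>
    simp only [form, eval_sub, eval_mul, eval_C, eval_map_algebraMap] at h h'
    have : (β - β') * aeval θ v.2 = 0 := by linear_combination h' - h
    rcases mul_eq_zero.1 this with h0 | h0
    · exact absurd (by rw [sub_eq_zero.1 h0]) hne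
    · simpa [h0] using h

lemma form_monic {e : ℕ} {v : F[X] × F[X]} (hv : v ∈ monicPairs F e) (o : Option k) :
    (form o v).Monic ∧ (form o v).natDegree = if o = none then e else e + 1 := by
  have ha := mem_monics.1 (Finset.mem_product.1 hv).1
  have hb := mem_monics.1 (Finset.mem_product.1 hv).2
  match o with
  | none => exact ⟨hb.1.map _, by simp [form, hb.2]⟩
  | some β =>
    have hlt : (C β * v.2.map (algebraMap F k)).degree < (v.1.map (algebraMap F k)).degree := by
      rw [degree_map, degree_eq_natDegree ha.1.ne_zero, ha.2]
      refine (degree_mul_le _ _).trans_lt ?_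
      refine (add_le_add_left degree_C_le _).trans_lt ?_
      rw [zero_add, degree_map, degree_eq_natDegree hb.1.ne_zero, hb.2]
      exact_mod_cast Nat.lt_succ_self e
    refine ⟨(ha.1.map _).sub_of_left hlt, ?_⟩
    rw [form, natDegree_sub_eq_left_of_natDegree_lt]
    · simp [ha.2]
    · refine (natDegree_C_mul_le _ _).trans_lt ?_
      simp [ha.2, hb.2]

open Classical in
/-- The roots of degree `> D` of the forms attached to `B`. -/
noncomputable def largeRoots (B : Finset (Option k)) (D : ℕ) (v : F[X] × F[X]) : Finset k :=
  B.biUnion fun o => (form o v).roots.toFinset.filter fun θ => D < pointDegree F θ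

lemma mem_largeRoots {B : Finset (Option k)} {D e : ℕ} {v : F[X] × F[X]}
    (hv : v ∈ monicPairs F e) {θ : k} : θ ∈ largeRoots B D v ↔
      D < pointDegree F θ ∧ ∃ o ∈ B, (form o v).eval θ = 0 := by
  simp only [largeRoots, Finset.mem_biUnion, Finset.mem_filter, Multiset.mem_toFinset]
  constructor
  · rintro ⟨o, ho, h1, h2⟩
    exact ⟨h2, o, ho, (mem_roots'.1 h1).2⟩
  · rintro ⟨h2, o, ho, h1⟩
    exact ⟨o, ho, (mem_roots (form_monic hv o).1.ne_zero).2 h1, h2⟩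

lemma IsGoodPair.rootMultiplicity_eq_one {B : Finset (Option k)} {D M e : ℕ} {v : F[X] × F[X]}
    (hv : IsGoodPair B D M e v) {θ : k} (hθ : D < pointDegree F θ) {o : Option k} (ho : o ∈ B)
    (h : (form o v).eval θ = 0) : (form o v).rootMultiplicity θ = 1 := by
  have h0 := (form_monic hv.mem o).1.ne_zero
  have h1 := (rootMultiplicity_pos h0).2 h
  have h2 : ¬ 2 ≤ (form o v).rootMultiplicity θ := by
    rw [le_rootMultiplicity_iff h0]
    exact hv.simple θ hθ o ho
  omega

lemma card_le_of_roots_small [IsAlgClosed k] {D M : ℕ} (f : k[X])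
    (h1 : ∀ θ : k, f.eval θ = 0 → pointDegree F θ ≤ D)
    (h2 : ∀ θ : k, pointDegree F θ ≤ D → f.rootMultiplicity θ ≤ M) :
    f.natDegree ≤ (smallPoints F k D).card * M := by
  classical
  rw [← (IsAlgClosed.splits f).natDegree_eq_card_roots.symm, ← Multiset.toFinset_sum_count_eq,
    ← smul_eq_mul]
  have hs : f.roots.toFinset ⊆ smallPoints F k D := by
    intro θ hθ
    exact mem_smallPoints.2 (h1 θ (mem_roots'.1 (Multiset.mem_toFinset.1 hθ)).2)
  refine (Finset.sum_le_sum_of_subset hs).trans (Finset.sum_le_card_nsmul _ _ _ fun θ hθ => ?_)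
  rw [count_roots]
  exact h2 θ (mem_smallPoints.1 hθ)

open Classical in
-- Roots of degree greater than D are simple and the boundedly many others have multiplicity below
-- M, so all but a constant part of the degree is visible as distinct large roots.
lemma IsGoodPair.natDegree_form_le [IsAlgClosed k] {B : Finset (Option k)} {D M e : ℕ}
    {v : F[X] × F[X]} (hv : IsGoodPair B D M e v) {o : Option k} (ho : o ∈ B) :
    (form o v).natDegree ≤ ((form o v).roots.toFinset.filter
      fun θ => D < pointDegree F θ).card + (smallPoints F k D).card * M := by
  have h0 := (form_monic hv.mem o).1.ne_zero
  rw [← (IsAlgClosed.splits (form o v)).natDegree_eq_card_roots.symm,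
    ← Multiset.toFinset_sum_count_eq,
    ← Finset.sum_filter_add_sum_filter_not _ (fun θ => D < pointDegree F θ)]
  refine add_le_add ?_ ?_
  · rw [Finset.card_eq_sum_ones]
    refine Finset.sum_le_sum fun θ hθ => ?_
    obtain ⟨h1, h2⟩ := Finset.mem_filter.1 hθ
    rw [count_roots, hv.rootMultiplicity_eq_one h2 ho
      (mem_roots'.1 (Multiset.mem_toFinset.1 h1)).2]
  · have hs : (form o v).roots.toFinset.filter (fun θ => ¬ D < pointDegree F θ) ⊆
        smallPoints F k D := by
      intro θ hθ
      exact mem_smallPoints.2 (not_lt.1 (Finset.mem_filter.1 hθ).2)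
    rw [← smul_eq_mul]
    refine (Finset.sum_le_sum_of_subset hs).trans (Finset.sum_le_card_nsmul _ _ _ fun θ hθ => ?_)
    rw [count_roots]
    by_contra hcon
    exact hv.power θ (mem_smallPoints.1 hθ) o ho
      ((le_rootMultiplicity_iff h0).1 (by omega))

/-- Distinct branch points have disjoint sets of large roots, since a common root would be a common
zero of a and b. The final 1 allows for the form at ∞, of degree e instead of e + 1. -/
lemma IsGoodPair.card_largeRoots [IsAlgClosed k] {B : Finset (Option k)} {D M e : ℕ}
    {v : F[X] × F[X]} (hv : IsGoodPair B D M e v) :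
    B.card * (e + 1) ≤ (largeRoots B D v).card + B.card * ((smallPoints F k D).card * M) + 1 := by
  classical
  rw [largeRoots, Finset.card_biUnion]
  · have h1 := Finset.sum_le_sum fun o (ho : o ∈ B) => hv.natDegree_form_le ho
    rw [Finset.sum_add_distrib, Finset.sum_const, smul_eq_mul] at h1
    have h2 : B.card * (e + 1) ≤ ∑ o ∈ B, (form o v).natDegree + 1 := by
      have h3 : ∑ o ∈ B, (e + 1) ≤ ∑ o ∈ B, ((form o v).natDegree + if o = none then 1 else 0) := by
        refine Finset.sum_le_sum fun o _ => ?_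
        rw [(form_monic hv.mem o).2]
        split_ifs <;> omega
      rw [Finset.sum_const, smul_eq_mul, Finset.sum_add_distrib, Finset.sum_ite_eq'] at h3
      split_ifs at h3 <;> omega
    omega
  · intro o _ o' _ hne
    rw [Function.onFun, Finset.disjoint_left]
    intro θ h h'
    obtain ⟨h1, h2⟩ := Finset.mem_filter.1 h
    obtain ⟨h1', -⟩ := Finset.mem_filter.1 h'
    exact hv.coprime θ h2 (aeval_eq_zero_of_forms hne
      (mem_roots'.1 (Multiset.mem_toFinset.1 h1)).2 (mem_roots'.1 (Multiset.mem_toFinset.1 h1')).2)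

/-- A common divisor of a and b divides every form; its roots have degree at most D and multiplicity
below M. This bounds how many good pairs can define the same rational function. -/
lemma IsGoodPair.natDegree_gcd_le [IsAlgClosed k] {B : Finset (Option k)} (hB : B.Nonempty)
    {D M e : ℕ} {v : F[X] × F[X]} (hv : IsGoodPair B D M e v) {g : F[X]} (h1 : g ∣ v.1)
    (h2 : g ∣ v.2) : g.natDegree ≤ (smallPoints F k D).card * M := by
  obtain ⟨o, ho⟩ := hB
  have h0 := (form_monic hv.mem o).1.ne_zero
  have hdvd : g.map (algebraMap F k) ∣ form o v := by
    have e1 := Polynomial.map_dvd (algebraMap F k) h1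
    have e2 := Polynomial.map_dvd (algebraMap F k) h2
    cases o with
    | none => exact e2
    | some β => exact dvd_sub e1 (e2.mul_left _)
  rw [← natDegree_map (algebraMap F k)]
  refine card_le_of_roots_small (F := F) _ ?_ ?_
  · intro θ hθ
    by_contra hcon
    rw [eval_map_algebraMap] at hθ
    refine hv.coprime θ (not_le.1 hcon) ⟨?_, ?_⟩
    · obtain ⟨w, hw⟩ := h1; rw [hw, map_mul, hθ, zero_mul]
    · obtain ⟨w, hw⟩ := h2; rw [hw, map_mul, hθ, zero_mul]
  · intro θ hθ
    refine (rootMultiplicity_le_rootMultiplicity_of_dvd h0 hdvd θ).trans ?_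
    by_contra hcon
    exact hv.power θ hθ o ho ((le_rootMultiplicity_iff h0).1 (by omega))

end GoodPairs

/-! ### Boundedly many good pairs share the same local orders up to scaling -/

section Fibres

variable {F : Type*} [Field F] [Fintype F]
variable {k : Type*} [Field k] [Algebra F k] [Algebra.IsAlgebraic F k]

lemma eq_zero_of_aeval_eq_zero {z : F[X]} (Z : Finset k) (hz : z.degree < Z.card)
    (h : ∀ θ ∈ Z, aeval θ z = 0) : z = 0 := by
  refine (Polynomial.map_eq_zero (algebraMap F k)).1
    (eq_zero_of_degree_lt_of_eval_finset_eq_zero Z ?_ ?_)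
  · rwa [degree_map]
  · intro θ hθ; rw [eval_map_algebraMap]; exact h θ hθ

/-- Two members differ by a multiple of (a₁, b₁)/gcd(a₁, b₁). Hence the second entries agree modulo
b₁/gcd, of degree at least e − N, and the second entry determines the first. -/
lemma card_pairs_cross_product_eq_le {e N : ℕ} {a₁ b₁ : F[X]} (hb₁ : b₁ ∈ monics F e)
    (hg : ∀ g : F[X], g ∣ a₁ → g ∣ b₁ → g.natDegree ≤ N)
    (S : Finset (F[X] × F[X])) (hS : S ⊆ monicPairs F e)
    (h : ∀ v ∈ S, ∀ v' ∈ S, v.1 * b₁ - a₁ * v.2 = v'.1 * b₁ - a₁ * v'.2) :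
    S.card ≤ Fintype.card F ^ N := by
  classical
  have hb := mem_monics.1 hb₁
  have hb0 := hb.1.ne_zero
  set g := EuclideanDomain.gcd a₁ b₁ with hgdef
  have hg0 : g ≠ 0 := fun h0 => hb0 (EuclideanDomain.gcd_eq_zero_iff.1 h0).2
  obtain ⟨a₀, ha₀⟩ := EuclideanDomain.gcd_dvd_left a₁ b₁
  obtain ⟨b₀, hb₀⟩ := EuclideanDomain.gcd_dvd_right a₁ b₁
  rw [← hgdef] at ha₀ hb₀
  have hcop : IsCoprime a₀ b₀ := by
    have hbez := EuclideanDomain.gcd_eq_gcd_ab a₁ b₁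
    rw [← hgdef] at hbez
    refine ⟨EuclideanDomain.gcdA a₁ b₁, EuclideanDomain.gcdB a₁ b₁, mul_left_cancel₀ hg0 ?_⟩
    rw [mul_one]
    conv_rhs => rw [hbez]
    linear_combination (-EuclideanDomain.gcdA a₁ b₁) * ha₀ - EuclideanDomain.gcdB a₁ b₁ * hb₀
  have hdeg : e ≤ N + b₀.natDegree := by
    have h1 := hg g ⟨a₀, ha₀⟩ ⟨b₀, hb₀⟩
    have h2 := congrArg natDegree hb₀
    rw [natDegree_mul hg0 (by rintro rfl; simp at hb₀; exact hb0 hb₀), hb.2] at h2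
    omega
  have hdvd : ∀ v ∈ S, ∀ v' ∈ S, b₀ ∣ v.2 - v'.2 := by
    intro v hv v' hv'
    have h1 := h v hv v' hv'
    have h2 : a₀ * (v.2 - v'.2) = (v.1 - v'.1) * b₀ := by
      apply mul_left_cancel₀ hg0
      linear_combination (-1 : F[X]) * h1 - (v.2 - v'.2) * ha₀ + (v.1 - v'.1) * hb₀
    exact hcop.symm.dvd_of_dvd_mul_left ⟨v.1 - v'.1, by rw [h2, mul_comm]⟩
  have hmem2 : ∀ v ∈ S, v.2 ∈ monics F e := fun v hv => (Finset.mem_product.1 (hS hv)).2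
  calc S.card = (S.image Prod.snd).card := by
        rw [Finset.card_image_of_injOn]
        intro v hv v' hv' heq
        have h1 := h v hv v' hv'
        have h2 : (v.1 - v'.1) * b₁ = 0 := by
          linear_combination h1 + a₁ * heq
        rcases mul_eq_zero.1 h2 with h3 | h3
        · exact Prod.ext (sub_eq_zero.1 h3) heq
        · exact absurd h3 hb0
    _ ≤ Fintype.card F ^ (e - b₀.natDegree) := by
        refine card_le_pow_of_degree_sub_lt _ e _ ?_ ?_
        · intro b hb b' hb'
          obtain ⟨v, hv, rfl⟩ := Finset.mem_image.1 hb
          obtain ⟨v', hv', rfl⟩ := Finset.mem_image.1 hb'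
          exact degree_sub_lt_of_mem_monics (hmem2 v hv) (hmem2 v' hv')
        · intro b hb b' hb' hd
          obtain ⟨v, hv, rfl⟩ := Finset.mem_image.1 hb
          obtain ⟨v', hv', rfl⟩ := Finset.mem_image.1 hb'
          exact eq_of_dvd_sub_of_degree_lt le_rfl (hdvd v hv v' hv') hd
    _ ≤ _ := Nat.pow_le_pow_right Fintype.card_pos (by omega)

/-- Pairs that agree, as points of the projective line, with a fixed pair at sufficiently many
geometric points are bounded in number. -/
lemma card_pairs_agreeing_le {e N K : ℕ} {v₁ : F[X] × F[X]} (hv₁ : v₁ ∈ monicPairs F e)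
    (hg : ∀ g : F[X], g ∣ v₁.1 → g ∣ v₁.2 → g.natDegree ≤ N)
    (Z : Finset k) (hZ : 2 * e + 1 ≤ Z.card + K)
    (S : Finset (F[X] × F[X])) (hS : S ⊆ monicPairs F e)
    (h : ∀ v ∈ S, ∀ θ ∈ Z, aeval θ (v.1 * v₁.2 - v₁.1 * v.2) = 0) :
    S.card ≤ Fintype.card F ^ N * Fintype.card F ^ K := by
  classical
  set f : F[X] × F[X] → F[X] := fun v => v.1 * v₁.2 - v₁.1 * v.2
  have hm : ∀ v ∈ monicPairs F e, v.1 ∈ monics F (e + 1) ∧ v.2 ∈ monics F e := fun v hv =>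
    Finset.mem_product.1 hv
  -- Both products are monic of degree 2e + 1, so the leading terms cancel. This is why 2e + 1
  -- points of agreement suffice.
  have hdeg : ∀ v ∈ S, (f v).degree < (2 * e + 1 : ℕ) := by
    intro v hv
    have h1 := mem_monics.1 (hm v (hS hv)).1
    have h2 := mem_monics.1 (hm v (hS hv)).2
    have h3 := mem_monics.1 (hm v₁ hv₁).1
    have h4 := mem_monics.1 (hm v₁ hv₁).2
    refine degree_sub_lt_of_mem_monics (mem_monics.2 ⟨h1.1.mul h4.1, ?_⟩)
      (mem_monics.2 ⟨h3.1.mul h2.1, ?_⟩)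
    · rw [h1.1.natDegree_mul h4.1]; omega
    · rw [h3.1.natDegree_mul h2.1]; omega
  have h1 : (S.image f).card ≤ Fintype.card F ^ K := by
    refine (card_le_pow_of_degree_sub_lt _ (2 * e + 1) Z.card ?_ ?_).trans
      (Nat.pow_le_pow_right Fintype.card_pos (by omega))
    · intro b hb b' hb'
      obtain ⟨v, hv, rfl⟩ := Finset.mem_image.1 hb
      obtain ⟨v', hv', rfl⟩ := Finset.mem_image.1 hb'
      exact (degree_sub_le _ _).trans_lt (max_lt (hdeg v hv) (hdeg v' hv'))
    · intro b hb b' hb' hd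
      obtain ⟨v, hv, rfl⟩ := Finset.mem_image.1 hb
      obtain ⟨v', hv', rfl⟩ := Finset.mem_image.1 hb'
      rw [← sub_eq_zero]
      refine eq_zero_of_aeval_eq_zero Z hd fun θ hθ => ?_
      rw [map_sub, h v hv θ hθ, h v' hv' θ hθ, sub_zero]
  have h2 : S.card ≤ Fintype.card F ^ N * (S.image f).card := by
    refine Finset.card_le_mul_card_image S _ fun z _ => ?_
    refine card_pairs_cross_product_eq_le (hm v₁ hv₁).2 hg _
      ((Finset.filter_subset _ _).trans hS) ?_
    intro v hv v' hv'
    exact (Finset.mem_filter.1 hv).2.trans (Finset.mem_filter.1 hv').2.symm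
  exact h2.trans (Nat.mul_le_mul_left _ h1)

/-- The homogenization of `w` evaluated at `(a, b)`. -/
noncomputable def homEval (w a b : F[X]) : F[X] :=
  ∑ i ∈ Finset.range (w.natDegree + 1), C (w.coeff i) * a ^ i * b ^ (w.natDegree - i)

/-- Because deg b < deg a, the term a^(deg w) dominates. Its degree deg w · (e + 1) is the source of
the factor e + 1 in the conductor bound. -/
lemma homEval_monic {w a b : F[X]} {e : ℕ} (hw : w.Monic) (ha : a ∈ monics F (e + 1))
    (hb : b ∈ monics F e) :
    (homEval w a b).Monic ∧ (homEval w a b).natDegree = w.natDegree * (e + 1) := by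
  rw [mem_monics] at ha hb
  have hm : (a ^ w.natDegree).Monic := ha.1.pow _
  have hd : (a ^ w.natDegree).natDegree = w.natDegree * (e + 1) := by
    rw [natDegree_pow, ha.2]
  rw [homEval, Finset.sum_range_succ, hw.coeff_natDegree, Nat.sub_self, pow_zero, mul_one,
    map_one, one_mul]
  have hlt : (∑ i ∈ Finset.range w.natDegree,
      C (w.coeff i) * a ^ i * b ^ (w.natDegree - i)).degree < (a ^ w.natDegree).degree := by
    rw [degree_eq_natDegree hm.ne_zero, hd, ← mem_degreeLT]
    refine Submodule.sum_mem _ fun i hi => ?_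
    rw [Finset.mem_range] at hi
    rw [mem_degreeLT]
    refine (degree_le_natDegree).trans_lt ?_
    have h1 : (C (w.coeff i) * a ^ i * b ^ (w.natDegree - i)).natDegree ≤
        i * (e + 1) + (w.natDegree - i) * e := by
      refine natDegree_mul_le.trans (add_le_add ?_ ?_)
      · refine (natDegree_C_mul_le _ _).trans ?_
        rw [natDegree_pow, ha.2]
      · rw [natDegree_pow, hb.2]
    have h2 : i * (e + 1) + (w.natDegree - i) * e < w.natDegree * (e + 1) := by
      obtain ⟨j, hj⟩ := Nat.exists_eq_add_of_lt hi
      rw [hj, show i + j + 1 - i = j + 1 by omega]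
      nlinarith
    exact_mod_cast h1.trans_lt h2
  exact ⟨by rw [add_comm]; exact hm.add_of_left hlt,
    by rw [add_comm, natDegree_add_eq_left_of_degree_lt hlt, hd]⟩

lemma aeval_homEval_eq_zero {w a b : F[X]} {θ β : k} (hβ : aeval β w = 0)
    (h : aeval θ a = β * aeval θ b) : aeval θ (homEval w a b) = 0 := by
  have : aeval θ (homEval w a b) = (aeval θ b) ^ w.natDegree * aeval β w := by
    rw [aeval_eq_sum_range (p := w), homEval, map_sum, Finset.mul_sum]
    refine Finset.sum_congr rfl fun i hi => ?_
    rw [Finset.mem_range] at hi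
    rw [map_mul, map_mul, map_pow, map_pow, aeval_C, h, mul_pow, Algebra.smul_def]
    rw [show w.natDegree = i + (w.natDegree - i) by omega, pow_add]
    rw [show i + (w.natDegree - i) - i = w.natDegree - i by omega]
    ring
  rw [this, hβ, mul_zero]

variable (F) in
/-- The form over `F` attached to the place below a geometric point of the projective line. -/
noncomputable def placeForm (o : Option k) (v : F[X] × F[X]) : F[X] :=
  match o with
  | some β => homEval (minpoly F β) v.1 v.2
  | none => v.2

variable (F) in
/-- The degree of the place below a geometric point of the projective line. -/
noncomputable def placeFormDegree (o : Option k) : ℕ :=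
  match o with
  | some β => pointDegree F β
  | none => 1

lemma placeForm_ne_zero {e : ℕ} {v : F[X] × F[X]} (hv : v ∈ monicPairs F e) (o : Option k) :
    placeForm F o v ≠ 0 ∧ (placeForm F o v).natDegree ≤ placeFormDegree F o * (e + 1) := by
  obtain ⟨ha, hb⟩ := Finset.mem_product.1 hv
  match o with
  | some β =>
    have := homEval_monic (minpoly.monic (Algebra.IsIntegral.isIntegral (R := F) β)) ha hb
    exact ⟨this.1.ne_zero, this.2.le⟩
  | none =>
    have := mem_monics.1 hb
    exact ⟨this.1.ne_zero, by simp [placeForm, placeFormDegree, this.2]⟩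

lemma minpoly_dvd_placeForm {v : F[X] × F[X]} {o : Option k} {θ : k}
    (h : (form o v).eval θ = 0) : minpoly F θ ∣ placeForm F o v := by
  refine minpoly.dvd F θ ?_
  match o with
  | some β =>
    refine aeval_homEval_eq_zero (β := β) (minpoly.aeval F β) ?_
    simpa [form, sub_eq_zero] using h
  | none => simpa [form, placeForm] using h

open Classical in
-- The minimal polynomials of the points of Z are coprime divisors, each of degree greater than ρ,
-- of one nonzero polynomial over F whose degree is at most the right side. So the points form few
-- Galois orbits.
lemma card_image_minpoly_le {B : Finset (Option k)} {e ρ : ℕ} {v : F[X] × F[X]}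
    (hv : v ∈ monicPairs F e) (Z : Finset k) (hZ : ∀ θ ∈ Z, ∃ o ∈ B, (form o v).eval θ = 0)
    (hρ : ∀ θ ∈ Z, ρ < pointDegree F θ) :
    (Z.image (minpoly F)).card * (ρ + 1) ≤ (∑ o ∈ B, placeFormDegree F o) * (e + 1) := by
  have hne : ∏ o ∈ B, placeForm F o v ≠ 0 :=
    Finset.prod_ne_zero_iff.2 fun o _ => (placeForm_ne_zero hv o).1
  have hint : ∀ θ : k, IsIntegral F θ := Algebra.IsIntegral.isIntegral
  have hdvd : ∏ π ∈ Z.image (minpoly F), π ∣ ∏ o ∈ B, placeForm F o v := by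
    refine Finset.prod_dvd_of_coprime ?_ ?_
    · intro π hπ π' hπ' hne
      obtain ⟨θ, hθ, rfl⟩ := Finset.mem_image.1 hπ
      obtain ⟨θ', hθ', rfl⟩ := Finset.mem_image.1 hπ'
      refine ((minpoly.irreducible (hint θ)).coprime_iff_not_dvd).2 fun hd => hne ?_
      exact eq_of_monic_of_associated (minpoly.monic (hint θ)) (minpoly.monic (hint θ'))
        ((minpoly.irreducible (hint θ)).associated_of_dvd (minpoly.irreducible (hint θ')) hd)
    · intro π hπ
      obtain ⟨θ, hθ, rfl⟩ := Finset.mem_image.1 hπ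
      obtain ⟨o, ho, h⟩ := hZ θ hθ
      exact (minpoly_dvd_placeForm h).trans (Finset.dvd_prod_of_mem _ ho)
  have h1 := natDegree_le_of_dvd hdvd hne
  rw [natDegree_prod _ _ (fun o _ => (placeForm_ne_zero hv o).1), natDegree_prod] at h1
  · calc _ = ∑ π ∈ Z.image (minpoly F), (ρ + 1) := by rw [Finset.sum_const, smul_eq_mul]
      _ ≤ ∑ π ∈ Z.image (minpoly F), π.natDegree := by
        refine Finset.sum_le_sum fun π hπ => ?_
        obtain ⟨θ, hθ, rfl⟩ := Finset.mem_image.1 hπ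
        exact hρ θ hθ
      _ ≤ _ := h1
      _ ≤ _ := by
        rw [Finset.sum_mul]
        exact Finset.sum_le_sum fun o _ => (placeForm_ne_zero hv o).2
  · intro π hπ
    obtain ⟨θ, hθ, rfl⟩ := Finset.mem_image.1 hπ
    exact minpoly.ne_zero (hint θ)

lemma cross_eq_zero_of_form {v v' : F[X] × F[X]} {o : Option k} {θ : k}
    (h : (form o v).eval θ = 0) (h' : (form o v').eval θ = 0) :
    aeval θ (v.1 * v'.2 - v'.1 * v.2) = 0 := by
  rw [map_sub, map_mul, map_mul]
  match o with
  | some β =>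
    have e1 : aeval θ v.1 = β * aeval θ v.2 := by simpa [form, sub_eq_zero] using h
    have e2 : aeval θ v'.1 = β * aeval θ v'.2 := by simpa [form, sub_eq_zero] using h'
    rw [e1, e2]; ring
  | none =>
    have e1 : aeval θ v.2 = 0 := by simpa [form] using h
    have e2 : aeval θ v'.2 = 0 := by simpa [form] using h'
    rw [e1, e2]; ring

/-- The local invariants of a family of covers attached to `monicPairs`. The number `γ v θ` is the
order modulo `ℓ` of the Kummer generator attached to `v` at `θ`, and `c o` is the order of the
Kummer generator of the base cover at its branch point `o`. -/
structure IsLocalInvariant (ℓ : ℕ) (B : Finset (Option k)) (c : Option k → ZMod ℓ)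
    (γ : F[X] × F[X] → k → ZMod ℓ) : Prop where
  ne_zero : ∀ o ∈ B, c o ≠ 0
  sum_eq_zero : ∑ o ∈ B, c o = 0
  exists_form : ∀ v θ, γ v θ ≠ 0 → ∃ o ∈ B, (form o v).eval θ = 0
  eq_color : ∀ v θ, ∀ o ∈ B, (form o v).rootMultiplicity θ = 1 →
    ¬ (aeval θ v.1 = 0 ∧ aeval θ v.2 = 0) → γ v θ = c o

section
variable {ℓ : ℕ} {B : Finset (Option k)} {c : Option k → ZMod ℓ} {γ : F[X] × F[X] → k → ZMod ℓ}

lemma IsLocalInvariant.color_eq (hγ : IsLocalInvariant ℓ B c γ) {D M e : ℕ} {v : F[X] × F[X]}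
    (hv : IsGoodPair B D M e v) {θ : k} (hθ : D < pointDegree F θ) {o : Option k} (ho : o ∈ B)
    (h : (form o v).eval θ = 0) : γ v θ = c o :=
  hγ.eq_color v θ o ho (hv.rootMultiplicity_eq_one hθ ho h) (hv.coprime θ hθ)

lemma IsLocalInvariant.ne_zero_of_mem_largeRoots (hγ : IsLocalInvariant ℓ B c γ) {D M e : ℕ}
    {v : F[X] × F[X]} (hv : IsGoodPair B D M e v) {θ : k} (hθ : θ ∈ largeRoots B D v) :
    γ v θ ≠ 0 := by
  obtain ⟨h1, o, ho, h2⟩ := (mem_largeRoots hv.mem).1 hθ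
  rw [hγ.color_eq hv h1 ho h2]
  exact hγ.ne_zero o ho

open Classical in
/-- With at least three branch points, the pairs with the same invariants up to scaling are bounded
in number. -/
lemma card_fibre_le_of_three_le [IsAlgClosed k] [Fact ℓ.Prime] (hB : 3 ≤ B.card)
    (hγ : IsLocalInvariant ℓ B c γ) (D M e : ℕ)
    (he : 4 * (B.card * ((smallPoints F k D).card * M)) ≤ e)
    (S : Finset (F[X] × F[X])) (hS : ∀ v ∈ S, IsGoodPair B D M e v)
    (h : ∀ v ∈ S, ∀ v' ∈ S, ∃ j : ZMod ℓ, j ≠ 0 ∧ ∀ θ, γ v' θ = j * γ v θ) :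
    S.card ≤ Fintype.card F ^ ((smallPoints F k D).card * M) *
      B.card ^ (8 * B.card * ∑ o ∈ B, placeFormDegree F o) := by
  rcases S.eq_empty_or_nonempty with rfl | ⟨v₁, hv₁⟩
  · simp
  have hg₁ := hS v₁ hv₁
  set κ := (smallPoints F k D).card * M with hκ
  set ρ := e / (8 * B.card) with hρ
  set Z := (largeRoots B D v₁).filter fun θ => ρ < pointDegree F θ with hZ
  have hZlarge : ∀ θ ∈ Z, θ ∈ largeRoots B D v₁ := fun θ hθ => (Finset.mem_filter.1 hθ).1
  have hZform : ∀ v ∈ S, ∀ θ ∈ Z, ∃ o ∈ B, (form o v).eval θ = 0 := by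
    intro v hv θ hθ
    obtain ⟨j, hj, hjv⟩ := h v₁ hv₁ v hv
    refine hγ.exists_form v θ ?_
    rw [hjv]
    exact mul_ne_zero hj (hγ.ne_zero_of_mem_largeRoots hg₁ (hZlarge θ hθ))
  -- Of at least 3(e + 1) − e/4 − 1 large roots, at most e/2 are lost by requiring degree greater
  -- than ρ.
  have hZcard : 2 * e + 1 ≤ Z.card := by
    have h1 := hg₁.card_largeRoots
    rw [← hκ] at h1
    have h2 := Finset.card_filter_add_card_filter_not (s := largeRoots B D v₁)
      (fun θ => ρ < pointDegree F θ)
    rw [← hZ] at h2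
    have h3 : ((largeRoots B D v₁).filter fun θ => ¬ ρ < pointDegree F θ).card ≤
        ((smallPoints F k ρ).filter fun θ => ∃ o ∈ B, (X - C θ) ∣ form o v₁).card := by
      refine Finset.card_le_card fun θ hθ => ?_
      obtain ⟨h4, h5⟩ := Finset.mem_filter.1 hθ
      obtain ⟨-, o, ho, h6⟩ := (mem_largeRoots hg₁.mem).1 h4
      exact Finset.mem_filter.2 ⟨mem_smallPoints.2 (not_lt.1 h5), o, ho, dvd_iff_isRoot.2 h6⟩
    have h4 : 2 * _ ≤ e := hg₁.few_small
    have h5 : 3 * (e + 1) ≤ B.card * (e + 1) := Nat.mul_le_mul_right _ hB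
    rw [← hρ] at h4
    omega
  set P := Z.image (minpoly F) with hP
  -- The ratio (e + 1)/(ρ + 1) is at most 8|B| by the choice of ρ, so the number of orbits is
  -- bounded independently of e.
  have hPcard : P.card ≤ 8 * B.card * ∑ o ∈ B, placeFormDegree F o := by
    have h1 := card_image_minpoly_le hg₁.mem Z (hZform v₁ hv₁)
      (fun θ hθ => (Finset.mem_filter.1 hθ).2)
    have h2 : e + 1 ≤ 8 * B.card * (ρ + 1) := by
      have := Nat.lt_mul_div_succ e (show 0 < 8 * B.card by omega)
      rwa [← hρ] at this
    have h3 : P.card * (e + 1) ≤ (8 * B.card * ∑ o ∈ B, placeFormDegree F o) * (e + 1) := by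
      calc _ ≤ P.card * (8 * B.card * (ρ + 1)) := Nat.mul_le_mul_left _ h2
        _ = 8 * B.card * (P.card * (ρ + 1)) := by ring
        _ ≤ 8 * B.card * ((∑ o ∈ B, placeFormDegree F o) * (e + 1)) := Nat.mul_le_mul_left _ h1
        _ = _ := by ring
    exact Nat.le_of_mul_le_mul_right h3 (Nat.succ_pos e)
  have hrep : ∀ π : P, ∃ θ ∈ Z, minpoly F θ = π := fun π => Finset.mem_image.1 π.2
  choose rep hrepZ hrepP using hrep
  obtain ⟨o₀, ho₀⟩ : B.Nonempty := Finset.card_pos.1 (by omega)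
  -- The finite datum separating the pairs: the branch point to which a/b sends one representative
  -- of each orbit. Outside S the value is the arbitrary o₀.
  have hdata : ∀ v : F[X] × F[X], ∃ f : P → B, v ∈ S → ∀ π, (form (f π : Option k) v).eval (rep π) = 0 := by
    intro v
    by_cases hv : v ∈ S
    · choose o ho h' using fun π => hZform v hv (rep π) (hrepZ π)
      exact ⟨fun π => ⟨o π, ho π⟩, fun _ => h'⟩
    · exact ⟨fun _ => ⟨o₀, ho₀⟩, fun h => absurd h hv⟩
  choose data hdata using hdata
  refine (Finset.card_le_mul_card_image (f := data) S (Fintype.card F ^ κ) ?_).trans ?_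
  · intro f hf
    obtain ⟨v₂, hv₂, rfl⟩ := Finset.mem_image.1 hf
    have hg₂ := hS v₂ hv₂
    have := card_pairs_agreeing_le (K := 0) (N := κ) hg₂.mem
      (fun g h1 h2 => hg₂.natDegree_gcd_le ⟨o₀, ho₀⟩ h1 h2) Z (by omega)
      (S.filter fun v => data v = data v₂)
      (fun v hv => (hS v (Finset.mem_filter.1 hv).1).mem) ?_
    · simpa using this
    intro v hv θ hθ
    obtain ⟨hv, hvd⟩ := Finset.mem_filter.1 hv
    have hπ : minpoly F θ ∈ P := Finset.mem_image_of_mem _ hθ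
    have e1 := hdata v hv ⟨_, hπ⟩
    rw [hvd] at e1
    have e2 := hdata v₂ hv₂ ⟨_, hπ⟩
    -- The cross product has coefficients in F, so its vanishing at the representative spreads to
    -- the whole Galois orbit.
    have e3 := minpoly.dvd F _ (cross_eq_zero_of_form e1 e2)
    rw [hrepP] at e3
    obtain ⟨w, hw⟩ := e3
    rw [hw, map_mul, minpoly.aeval, zero_mul]
  · refine Nat.mul_le_mul_left _ ((Finset.card_le_univ _).trans ?_)
    rw [Fintype.card_fun, Fintype.card_coe, Fintype.card_coe]
    exact Nat.pow_le_pow_right (by omega) hPcard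

open Classical in
/-- With two branch points, the pairs with the same invariants up to scaling are bounded in
number. -/
lemma card_fibre_le_of_two [IsAlgClosed k] [Fact ℓ.Prime] (hodd : Odd ℓ) (hB : B.card = 2)
    (hγ : IsLocalInvariant ℓ B c γ) (D M e : ℕ)
    (S : Finset (F[X] × F[X])) (hS : ∀ v ∈ S, IsGoodPair B D M e v)
    (h : ∀ v ∈ S, ∀ v' ∈ S, ∃ j : ZMod ℓ, j ≠ 0 ∧ ∀ θ, γ v' θ = j * γ v θ) :
    S.card ≤ Fintype.card F ^ ((smallPoints F k D).card * M) *
      Fintype.card F ^ (2 * ((smallPoints F k D).card * M)) * ℓ := by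
  rcases S.eq_empty_or_nonempty with rfl | ⟨v₁, hv₁⟩
  · simp
  have hg₁ := hS v₁ hv₁
  set κ := (smallPoints F k D).card * M with hκ
  -- Two nonzero orders with sum zero are distinct because 2 is invertible modulo the odd prime ℓ.
  have hcolor : ∀ o ∈ B, ∀ o' ∈ B, c o = c o' → o = o' := by
    intro o ho o' ho' hc
    by_contra hne
    have hBeq : {o, o'} = B := Finset.eq_of_subset_of_card_le
      (by intro x hx; simp at hx; rcases hx with rfl | rfl <;> assumption)
      (by rw [hB, Finset.card_pair hne])
    have h0 := hγ.sum_eq_zero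
    rw [← hBeq, Finset.sum_pair hne, ← hc, ← two_mul] at h0
    rcases mul_eq_zero.1 h0 with h2 | h2
    · have h3 : ((2 : ℕ) : ZMod ℓ) = 0 := by exact_mod_cast h2
      rw [ZMod.natCast_eq_zero_iff] at h3
      have := Nat.le_of_dvd (by norm_num) h3
      have h2l := (Fact.out : ℓ.Prime).two_le
      obtain ⟨r, hr⟩ := hodd
      omega
    · exact hγ.ne_zero o ho h2
  -- The scaling factor relative to v₁ takes at most ℓ values. Once it is fixed, the orders of v at
  -- the large roots of v₁ are known, and so are the branch points hit there.
  choose! j hj0 hj using fun v hv => h v₁ hv₁ v hv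
  have : NeZero ℓ := ⟨(Fact.out : ℓ.Prime).ne_zero⟩
  refine (Finset.card_le_mul_card_image (f := j) S
    (Fintype.card F ^ κ * Fintype.card F ^ (2 * κ)) ?_).trans ?_
  · intro i hi
    obtain ⟨v₂, hv₂, rfl⟩ := Finset.mem_image.1 hi
    have hg₂ := hS v₂ hv₂
    refine card_pairs_agreeing_le (K := 2 * κ) (N := κ) hg₂.mem
      (fun g h1 h2 => hg₂.natDegree_gcd_le (Finset.card_pos.1 (by omega)) h1 h2)
      (largeRoots B D v₁) ?_
      (S.filter fun v => j v = j v₂)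
      (fun v hv => (hS v (Finset.mem_filter.1 hv).1).mem) ?_
    -- There are at least 2(e + 1) − 2κ − 1 large roots, which is 2e + 1 up to the defect K = 2κ.
    · have := hg₁.card_largeRoots
      rw [hB, ← hκ] at this
      omega
    intro v hv θ hθ
    obtain ⟨hv, hvj⟩ := Finset.mem_filter.1 hv
    have hn := hγ.ne_zero_of_mem_largeRoots hg₁ hθ
    have hD := ((mem_largeRoots hg₁.mem).1 hθ).1
    have key : ∀ w ∈ S, ∃ o ∈ B, (form o w).eval θ = 0 ∧ γ w θ = c o := by
      intro w hw
      obtain ⟨o, ho, ho'⟩ := hγ.exists_form w θ (by rw [hj w hw]; exact mul_ne_zero (hj0 w hw) hn)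
      exact ⟨o, ho, ho', hγ.color_eq (hS w hw) hD ho ho'⟩
    obtain ⟨o, ho, ho1, ho2⟩ := key v hv
    obtain ⟨o', ho', ho1', ho2'⟩ := key v₂ hv₂
    have : o = o' := hcolor o ho o' ho' (by rw [← ho2, ← ho2', hj v hv, hj v₂ hv₂, hvj])
    subst this
    exact cross_eq_zero_of_form ho1 ho1'
  · refine Nat.mul_le_mul_left _ ((Finset.card_le_univ _).trans ?_)
    rw [ZMod.card]

open Classical in
/-- The pairs give rise to a positive proportion of pairwise different classes of local
invariants. -/
theorem exists_many_classes [IsAlgClosed k] [Fact ℓ.Prime] (hodd : Odd ℓ) (hB : 2 ≤ B.card)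
    (hγ : IsLocalInvariant ℓ B c γ) :
    ∃ c₀ : ℝ, 0 < c₀ ∧ ∃ e₀ : ℕ, ∀ e : ℕ, e₀ ≤ e → ∃ G ⊆ monicPairs F e,
      (∀ v ∈ G, ∃ θ, γ v θ ≠ 0) ∧
      ∀ {κ : Type _} (K : F[X] × F[X] → κ),
        (∀ v ∈ G, ∀ v' ∈ G, K v = K v' → ∃ j : ZMod ℓ, j ≠ 0 ∧ ∀ θ, γ v' θ = j * γ v θ) →
        c₀ * (Fintype.card F : ℝ) ^ (2 * e) ≤ (G.image K).card := by
  obtain ⟨D, M, e₁, he₁⟩ := exists_card_good_ge (F := F) B (by omega)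
  have hQ := two_le_card_real (F := F)
  obtain ⟨N, hN0, hN⟩ : ∃ N : ℕ, 0 < N ∧ ∀ e,
      4 * (B.card * ((smallPoints F k D).card * M)) ≤ e →
      ∀ S : Finset (F[X] × F[X]), (∀ v ∈ S, IsGoodPair B D M e v) →
      (∀ v ∈ S, ∀ v' ∈ S, ∃ j : ZMod ℓ, j ≠ 0 ∧ ∀ θ, γ v' θ = j * γ v θ) → S.card ≤ N := by
    have hpos : ∀ n, 0 < Fintype.card F ^ n := fun n => pow_pos Fintype.card_pos n
    rcases hB.lt_or_eq with hB3 | hB2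
    · exact ⟨_, Nat.mul_pos (hpos _) (pow_pos (by omega) _), fun e he S hS h =>
        card_fibre_le_of_three_le hB3 hγ D M e he S hS h⟩
    · exact ⟨_, Nat.mul_pos (Nat.mul_pos (hpos _) (hpos _)) (Fact.out : ℓ.Prime).pos,
        fun e _ S hS h => card_fibre_le_of_two hodd hB2.symm hγ D M e S hS h⟩
  refine ⟨((N : ℝ))⁻¹, by positivity,
    max e₁ (4 * (B.card * ((smallPoints F k D).card * M))), fun e he => ?_⟩
  set G := (monicPairs F e).filter (IsGoodPair B D M e) with hG
  have hgood : ∀ v ∈ G, IsGoodPair B D M e v := fun v hv => (Finset.mem_filter.1 hv).2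
  refine ⟨G, Finset.filter_subset _ _, ?_, ?_⟩
  · intro v hv
    have h1 := (hgood v hv).card_largeRoots
    have h2 : 0 < (largeRoots B D v).card := by
      have h3 := (le_max_right _ _).trans he
      have h4 : 2 * (e + 1) ≤ B.card * (e + 1) := Nat.mul_le_mul_right _ hB
      omega
    obtain ⟨θ, hθ⟩ := Finset.card_pos.1 h2
    exact ⟨θ, hγ.ne_zero_of_mem_largeRoots (hgood v hv) hθ⟩
  · intro κ K hK
    have h1 : G.card ≤ N * (G.image K).card := by
      refine Finset.card_le_mul_card_image G N fun x _ => ?_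
      refine hN e ((le_max_right _ _).trans he) _
        (fun v hv => hgood v (Finset.mem_filter.1 hv).1) ?_
      intro v hv v' hv'
      obtain ⟨hv, e1⟩ := Finset.mem_filter.1 hv
      obtain ⟨hv', e2⟩ := Finset.mem_filter.1 hv'
      exact hK v hv v' hv' (e1.trans e2.symm)
    have h2 := he₁ e ((le_max_left _ _).trans he)
    have h3 : (G.card : ℝ) ≤ N * (G.image K).card := by exact_mod_cast h1
    -- The loss of one half in the number of good pairs is absorbed by a factor q ≥ 2.
    have h4 : (Fintype.card F : ℝ) ^ (2 * e) ≤ (Fintype.card F : ℝ) ^ (2 * e + 1) / 2 := by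
      rw [pow_succ, le_div_iff₀ (by norm_num)]
      gcongr
    rw [inv_mul_le_iff₀ (by positivity)]
    exact h4.trans (h2.trans h3)

end

end Fibres

/-! ### Values of a valuation ring on a Kummer extension -/

section ValuationKummer

variable {A E : Type*} [Field A] [Field E] [Algebra A E]

/-- A Kummer generator generates the extension as a module. -/
lemma exists_sum_of_mem_adjoin_root {L : IntermediateField A E} {ℓ : ℕ} (hℓ : 0 < ℓ) {Y : E}
    (hY : Y ^ ℓ ∈ L) {x : E} (hx : x ∈ IntermediateField.adjoin L {Y}) :
    ∃ c : ℕ → E, (∀ i, c i ∈ L) ∧ x = ∑ i ∈ Finset.range ℓ, c i * Y ^ i := by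
  set q : (↥L)[X] := X ^ ℓ - C ⟨Y ^ ℓ, hY⟩ with hq
  have hqm : q.Monic := monic_X_pow_sub_C _ hℓ.ne'
  have hq0 : aeval Y q = 0 := by
    rw [hq, map_sub, map_pow, aeval_X, aeval_C]
    exact sub_self _
  have hint : IsIntegral L Y := ⟨q, hqm, hq0⟩
  rw [← IntermediateField.mem_toSubalgebra,
    IntermediateField.adjoin_simple_toSubalgebra_of_isAlgebraic hint.isAlgebraic,
    Algebra.adjoin_singleton_eq_range_aeval] at hx
  obtain ⟨p, rfl⟩ := hx
  refine ⟨fun i => ((p %ₘ q).coeff i : E), fun i => ((p %ₘ q).coeff i).2, ?_⟩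
  have h1 : aeval Y p = aeval Y (p %ₘ q) := by
    conv_lhs => rw [← modByMonic_add_div p q]
    rw [map_add, map_mul, hq0, zero_mul, add_zero]
  have h2 : (p %ₘ q).natDegree < ℓ := by
    have := natDegree_modByMonic_lt p hqm (by
      intro h
      have := congrArg natDegree h
      rw [hq, natDegree_X_pow_sub_C, natDegree_one] at this
      omega)
    rwa [hq, natDegree_X_pow_sub_C] at this
  change aeval Y p = _
  rw [h1, aeval_eq_sum_range' h2]
  exact Finset.sum_congr rfl fun i _ => Algebra.smul_def _ _

lemma Valuation.exists_map_sum_eq {Γ : Type*} [LinearOrderedCommGroupWithZero Γ]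
    (v : Valuation E Γ) {ι : Type*} (s : Finset ι) (f : ι → E)
    (h : ∀ i ∈ s, ∀ j ∈ s, i ≠ j → f i ≠ 0 → f j ≠ 0 → v (f i) ≠ v (f j))
    (hne : ∃ i ∈ s, f i ≠ 0) : ∃ i ∈ s, f i ≠ 0 ∧ v (∑ i ∈ s, f i) = v (f i) := by
  classical
  obtain ⟨i₀, hi₀, hi₀'⟩ := hne
  obtain ⟨i, hi, hmax⟩ := Finset.exists_max_image s (fun i => v (f i)) ⟨i₀, hi₀⟩
  have hfi : f i ≠ 0 := by
    intro h0
    have := hmax i₀ hi₀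
    rw [h0, map_zero, le_zero_iff, map_eq_zero] at this
    exact hi₀' this
  refine ⟨i, hi, hfi, v.map_sum_eq_of_lt hi fun j hj => ?_⟩
  rw [Finset.mem_sdiff, Finset.mem_singleton] at hj
  by_cases hfj : f j = 0
  · rw [hfj, map_zero]; exact zero_lt_iff.2 ((Valuation.ne_zero_iff v).2 hfi)
  · exact lt_of_le_of_ne (hmax j hj.1) (h j hj.1 i hi hj.2 hfj hfi)

/-- `W` is a valuation ring whose value group on `L` is generated by the value of `π`. -/
structure IsUniformizer (L : IntermediateField A E) (W : ValuationSubring E) (π : E) : Prop where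
  mem : π ∈ L
  ne_zero : π ≠ 0
  lt_one : W.valuation π < 1
  exists_zpow : ∀ x ∈ L, x ≠ 0 → ∃ n : ℤ, W.valuation x = W.valuation π ^ n

namespace IsUniformizer

variable {L : IntermediateField A E} {W : ValuationSubring E} {π : E}

lemma pos (h : IsUniformizer L W π) : 0 < W.valuation π :=
  zero_lt_iff.2 ((Valuation.ne_zero_iff _).2 h.ne_zero)

lemma zpow_inj (h : IsUniformizer L W π) {m n : ℤ}
    (e : W.valuation π ^ m = W.valuation π ^ n) : m = n :=
  (zpow_right_strictAnti₀ h.pos h.lt_one).injective e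

lemma exists_bound (h : IsUniformizer L W π) (c : ℕ → E) (hc : ∀ i, c i ∈ L) (n : ℕ) :
    ∃ K : ℕ, ∀ i < n, W.valuation (c i) * W.valuation π ^ K ≤ 1 := by
  induction n with
  | zero => exact ⟨0, by simp⟩
  | succ n ih =>
    obtain ⟨K, hK⟩ := ih
    obtain ⟨K', hK'⟩ : ∃ K' : ℕ, W.valuation (c n) * W.valuation π ^ K' ≤ 1 := by
      by_cases h0 : c n = 0
      · exact ⟨0, by simp [h0]⟩
      obtain ⟨m, hm⟩ := h.exists_zpow _ (hc n) h0
      refine ⟨m.natAbs, ?_⟩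
      rw [hm, ← zpow_natCast, ← zpow_add₀ h.pos.ne']
      have := (zpow_right_strictAnti₀ h.pos h.lt_one).antitone
        (show (0 : ℤ) ≤ m + (m.natAbs : ℤ) by omega)
      rwa [zpow_zero] at this
    refine ⟨K + K', fun i hi => ?_⟩
    have hle : ∀ m, W.valuation π ^ m ≤ 1 := fun m => pow_le_one₀ h.pos.le h.lt_one.le
    rcases Nat.lt_succ_iff_lt_or_eq.1 hi with hi | rfl
    · rw [pow_add, ← mul_assoc]
      exact mul_le_one' (hK i hi) (hle _)
    · rw [add_comm, pow_add, ← mul_assoc]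
      exact mul_le_one' hK' (hle _)

lemma val_le_of_lt_one (h : IsUniformizer L W π) {x : E} (hx : x ∈ L)
    (hlt : W.valuation x < 1) : W.valuation x ≤ W.valuation π := by
  by_cases h0 : x = 0
  · rw [h0, map_zero]; exact h.pos.le
  obtain ⟨n, hn⟩ := h.exists_zpow x hx h0
  rw [hn] at hlt ⊢
  have hn1 : 0 < n := by
    by_contra hcon
    have := (zpow_right_strictAnti₀ h.pos h.lt_one).antitone (not_lt.1 hcon)
    rw [zpow_zero] at this
    exact absurd hlt (not_lt.2 this)
  have := (zpow_right_strictAnti₀ h.pos h.lt_one).antitone (show (1 : ℤ) ≤ n by omega)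
  rwa [zpow_one] at this

/-- One Newton step, written as an estimate. -/
lemma newton_error (W : ValuationSubring E) {ℓ : ℕ} {s Y : E} (hs : W.valuation s = 1)
    (hY : W.valuation (Y - s) ≤ 1) :
    W.valuation (Y ^ ℓ - s ^ ℓ - ℓ * s ^ (ℓ - 1) * (Y - s)) ≤ W.valuation (Y - s) ^ 2 := by
  obtain ⟨r, hr⟩ := Polynomial.powAddExpansion (⟨s, (W.valuation_le_one_iff s).1 hs.le⟩ : W)
    ⟨Y - s, (W.valuation_le_one_iff _).1 hY⟩ ℓ
  have h1 := congrArg (fun x : W => (x : E)) hr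
  simp only [MulMemClass.coe_mul, AddMemClass.coe_add, SubmonoidClass.coe_pow] at h1
  rw [add_sub_cancel] at h1
  have h2 : Y ^ ℓ - s ^ ℓ - ℓ * s ^ (ℓ - 1) * (Y - s) = r * (Y - s) ^ 2 := by
    rw [h1]; push_cast; ring
  rw [h2, map_mul, map_pow]
  exact mul_le_of_le_one_left' ((W.valuation_le_one_iff _).2 r.2)

/-- Newton's iteration for an ℓ-th root, with all iterates in L. It plays the part of Hensel's lemma
without passing to a completion. -/
lemma exists_approx (h : IsUniformizer L W π) {ℓ : ℕ} (hℓ : 0 < ℓ)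
    (hvℓ : W.valuation (ℓ : E) = 1) {ζ : E} (hζ : IsPrimitiveRoot ζ ℓ) (hζL : ζ ∈ L)
    {Y s₀ : E} (hY : Y ^ ℓ ∈ L) (hs₀ : s₀ ∈ L) (hs₀1 : W.valuation s₀ = 1)
    (happ : W.valuation (Y ^ ℓ - s₀ ^ ℓ) < 1) (N : ℕ) :
    ∃ s ∈ L, W.valuation s = 1 ∧ W.valuation (Y - s) ≤ W.valuation π ^ (N + 1) := by
  have hmain : ∀ s : E, W.valuation s = 1 → W.valuation (Y - s) < 1 →
      W.valuation (Y ^ ℓ - s ^ ℓ) = W.valuation (Y - s) := by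
    intro s hs hlt
    by_cases h0 : Y - s = 0
    · rw [sub_eq_zero.1 h0]; simp
    have h1 := newton_error W (ℓ := ℓ) hs hlt.le
    have h2 : W.valuation (ℓ * s ^ (ℓ - 1) * (Y - s)) = W.valuation (Y - s) := by
      rw [map_mul, map_mul, map_pow, hs, hvℓ, one_pow, one_mul, one_mul]
    have h3 : W.valuation (Y - s) ^ 2 < W.valuation (Y - s) := by
      rw [pow_two]
      exact mul_lt_of_lt_one_left (zero_lt_iff.2 ((Valuation.ne_zero_iff _).2 h0)) hlt
    have h4 : Y ^ ℓ - s ^ ℓ = (Y ^ ℓ - s ^ ℓ - ℓ * s ^ (ℓ - 1) * (Y - s)) +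
      ℓ * s ^ (ℓ - 1) * (Y - s) := by ring
    rw [h4, Valuation.map_add_eq_of_lt_right _ (by rw [h2]; exact h1.trans_lt h3), h2]
  induction N with
  | zero =>
    have hprod := hζ.pow_sub_pow_eq_prod_sub_mul Y s₀ hℓ
    -- The product of the Y − ξs₀ over the ℓ-th roots of unity has value below 1, so some factor
    -- does; that ξs₀ starts the iteration.
    obtain ⟨ξ, hξ, hlt⟩ : ∃ ξ ∈ nthRootsFinset ℓ (1 : E), W.valuation (Y - ξ * s₀) < 1 := by
      by_contra! hcon
      rw [hprod, map_prod] at happ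
      exact absurd happ (not_lt.2 (Finset.one_le_prod' hcon))
    rw [mem_nthRootsFinset hℓ] at hξ
    have : NeZero ℓ := ⟨hℓ.ne'⟩
    obtain ⟨i, -, rfl⟩ := hζ.eq_pow_of_pow_eq_one hξ
    have hξ1 : W.valuation (ζ ^ i * s₀) = 1 := by
      have : W.valuation (ζ ^ i) ^ ℓ = 1 := by rw [← map_pow, hξ, map_one]
      rw [map_mul, hs₀1, mul_one]
      exact (pow_eq_one_iff_of_nonneg zero_le hℓ.ne').1 this
    refine ⟨ζ ^ i * s₀, mul_mem (pow_mem hζL i) hs₀, hξ1, ?_⟩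
    -- The value of Y − s equals that of Y^ℓ − s^ℓ, an element of L. A value below 1 on L is at most
    -- that of π.
    rw [zero_add, pow_one, ← hmain _ hξ1 hlt]
    refine h.val_le_of_lt_one (sub_mem hY (pow_mem (mul_mem (pow_mem hζL i) hs₀) _)) ?_
    rw [hmain _ hξ1 hlt]; exact hlt
  | succ N ih =>
    obtain ⟨s, hsL, hs1, hs⟩ := ih
    have hs0 : s ≠ 0 := by rintro rfl; simp at hs1
    have hℓ0 : (ℓ : E) ≠ 0 := by intro h0; rw [h0] at hvℓ; simp at hvℓ
    have hlt : W.valuation (Y - s) < 1 :=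
      hs.trans_lt (pow_lt_one₀ h.pos.le h.lt_one (Nat.succ_ne_zero N))
    set δ := (Y ^ ℓ - s ^ ℓ) / (ℓ * s ^ (ℓ - 1)) with hδ
    have hval : W.valuation (ℓ * s ^ (ℓ - 1)) = 1 := by
      rw [map_mul, map_pow, hs1, hvℓ, one_pow, one_mul]
    have hδL : δ ∈ L := div_mem (sub_mem hY (pow_mem hsL _))
      (mul_mem (natCast_mem L ℓ) (pow_mem hsL _))
    have herr : Y - (s + δ) = -((Y ^ ℓ - s ^ ℓ - ℓ * s ^ (ℓ - 1) * (Y - s)) /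
        (ℓ * s ^ (ℓ - 1))) := by
      rw [hδ]; field_simp; ring
    have hvalδ : W.valuation δ < 1 := by
      rw [hδ, map_div₀, hval, div_one, hmain s hs1 hlt]; exact hlt
    refine ⟨s + δ, add_mem hsL hδL, ?_, ?_⟩
    · rw [Valuation.map_add_eq_of_lt_left _ (by rw [hs1]; exact hvalδ), hs1]
    · rw [herr, Valuation.map_neg, map_div₀, hval, div_one]
      refine (newton_error W hs1 hlt.le).trans ?_
      calc W.valuation (Y - s) ^ 2 ≤ (W.valuation π ^ (N + 1)) ^ 2 := by gcongr
        _ = W.valuation π ^ ((N + 1) * 2) := by rw [pow_mul]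
        _ ≤ _ := pow_le_pow_of_le_one h.pos.le h.lt_one.le (by omega)

/-- If `Y ^ ℓ` is congruent to the `ℓ`-th power of a unit, then `L(Y) / L` is unramified. -/
lemma exists_zpow_of_unit (h : IsUniformizer L W π) {ℓ : ℕ} (hℓ : 0 < ℓ)
    (hvℓ : W.valuation (ℓ : E) = 1) {ζ : E} (hζ : IsPrimitiveRoot ζ ℓ) (hζL : ζ ∈ L)
    {Y s₀ : E} (hY : Y ^ ℓ ∈ L) (hs₀ : s₀ ∈ L) (hs₀1 : W.valuation s₀ = 1)
    (happ : W.valuation (Y ^ ℓ - s₀ ^ ℓ) < 1) {x : E}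
    (hx : x ∈ IntermediateField.adjoin L {Y}) (hx0 : x ≠ 0) :
    ∃ n : ℤ, W.valuation x = W.valuation π ^ n := by
  obtain ⟨c, hc, hxc⟩ := exists_sum_of_mem_adjoin_root hℓ hY hx
  obtain ⟨d, hd, hxd⟩ := exists_sum_of_mem_adjoin_root hℓ hY (inv_mem hx)
  obtain ⟨K, hK⟩ := h.exists_bound c hc ℓ
  obtain ⟨K', hK'⟩ := h.exists_bound d hd ℓ
  obtain ⟨s, hsL, hs1, hs⟩ := h.exists_approx hℓ hvℓ hζ hζL hY hs₀ hs₀1 happ (K + K')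
  have hYs : W.valuation (Y - s) ≤ 1 := hs.trans (pow_le_one₀ h.pos.le h.lt_one.le)
  have hsW : s ∈ W := (W.valuation_le_one_iff s).1 hs1.le
  have hYW : Y ∈ W := by
    have := add_mem ((W.valuation_le_one_iff _).1 hYs) hsW
    rwa [sub_add_cancel] at this
  have hpow : ∀ i, W.valuation (Y ^ i - s ^ i) ≤ W.valuation (Y - s) := by
    intro i
    obtain ⟨r, hr⟩ := sub_dvd_pow_sub_pow (⟨Y, hYW⟩ : W) ⟨s, hsW⟩ i
    have hr' := congrArg (fun x : W => (x : E)) hr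
    simp only [MulMemClass.coe_mul, AddSubgroupClass.coe_sub, SubmonoidClass.coe_pow] at hr'
    rw [hr', map_mul]
    exact mul_le_of_le_one_right' ((W.valuation_le_one_iff _).2 r.2)
  -- Expanding x⁻¹ in powers of Y bounds the value of x from below by a power of π, which tells how
  -- close to Y the approximation s must be.
  have hxinv : W.valuation x⁻¹ * W.valuation π ^ K' ≤ 1 := by
    rw [← map_pow, ← map_mul, hxd, Finset.sum_mul]
    refine Valuation.map_sum_le _ fun i hi => ?_
    rw [mul_right_comm, map_mul, map_mul, map_pow]
    refine mul_le_one' (hK' i (Finset.mem_range.1 hi)) ?_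
    rw [map_pow]
    exact pow_le_one₀ zero_le ((W.valuation_le_one_iff _).2 hYW)
  -- Replacing Y by s gives an element of L closer to x than the size of x, hence of the same value.
  set x' := ∑ i ∈ Finset.range ℓ, c i * s ^ i with hx'
  have hx'L : x' ∈ L := sum_mem fun i _ => mul_mem (hc i) (pow_mem hsL i)
  have hdiff : W.valuation (x' - x) < W.valuation x := by
    have hxpos : 0 < W.valuation x := zero_lt_iff.2 ((Valuation.ne_zero_iff _).2 hx0)
    have h1 : W.valuation π ^ K' ≤ W.valuation x := by
      rw [map_inv₀, inv_mul_le_iff₀ hxpos, mul_one] at hxinv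
      exact hxinv
    have h2 : W.valuation (x' - x) * W.valuation π ^ K ≤ W.valuation π ^ (K + K' + 1) := by
      rw [hx', hxc, ← Finset.sum_sub_distrib, ← map_pow, ← map_mul, Finset.sum_mul]
      refine Valuation.map_sum_le _ fun i hi => ?_
      rw [← mul_sub, mul_right_comm, map_mul, map_mul, map_pow, Valuation.map_sub_swap]
      exact (mul_le_of_le_one_left' (hK i (Finset.mem_range.1 hi))).trans ((hpow i).trans hs)
    have h3 : W.valuation (x' - x) ≤ W.valuation π ^ (K' + 1) := by
      rw [show K + K' + 1 = (K' + 1) + K by ring, pow_add _ (K' + 1)] at h2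
      exact le_of_mul_le_mul_right h2 (pow_pos h.pos K)
    refine h3.trans_lt (lt_of_lt_of_le ?_ h1)
    exact pow_lt_pow_right_of_lt_one₀ h.pos h.lt_one (Nat.lt_succ_self K')
  have hxx : W.valuation x' = W.valuation x := by
    have := Valuation.map_add_eq_of_lt_left W.valuation hdiff
    rwa [add_sub_cancel] at this
  rw [← hxx]
  refine h.exists_zpow x' hx'L ?_
  rintro h0
  rw [h0, map_zero, eq_comm, map_eq_zero] at hxx
  exact hx0 hxx

/-- If the value of `Y ^ ℓ` is not an `ℓ`-th power, then `L(Y) / L` is ramified. -/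
lemma ne_zpow_of_not_dvd (h : IsUniformizer L W π) {ℓ : ℕ} (hp : ℓ.Prime) {Y : E} {n : ℤ}
    (hY : W.valuation (Y ^ ℓ) = W.valuation π ^ n) (hn : ¬ (ℓ : ℤ) ∣ n) (c : ℕ → E)
    (hc : ∀ i, c i ∈ L) (h0 : c 0 = 0) (hne : ∑ i ∈ Finset.range ℓ, c i * Y ^ i ≠ 0) (m : ℤ) :
    W.valuation (∑ i ∈ Finset.range ℓ, c i * Y ^ i) ≠ W.valuation π ^ m := by
  have hY0 : Y ≠ 0 := by
    rintro rfl
    rw [zero_pow hp.ne_zero, map_zero] at hY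
    exact (zpow_pos h.pos n).ne hY
  have hterm : ∀ i, c i ≠ 0 → ∃ r : ℤ, W.valuation (c i * Y ^ i) ^ ℓ =
      W.valuation π ^ (ℓ * r + i * n) := by
    intro i hi
    obtain ⟨r, hr⟩ := h.exists_zpow _ (hc i) hi
    refine ⟨r, ?_⟩
    rw [map_mul, hr, mul_pow, map_pow, ← pow_mul, mul_comm i ℓ, pow_mul, ← map_pow, hY,
      zpow_add₀ h.pos.ne', mul_comm (ℓ : ℤ) r, zpow_mul, zpow_natCast, mul_comm (i : ℤ) n,
      zpow_mul, zpow_natCast]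
  have hpℤ : Prime (ℓ : ℤ) := Nat.prime_iff_prime_int.1 hp
  have hne' : ∃ i ∈ Finset.range ℓ, c i * Y ^ i ≠ 0 := by
    by_contra! hcon
    exact hne (Finset.sum_eq_zero hcon)
  -- Equal values of the terms i ≠ j would, after raising to the power ℓ, give ℓ ∣ (i − j)n. So the
  -- sum takes the value of a single term, and that term has i ≠ 0 because c 0 = 0.
  obtain ⟨i, hi, hi0, hiv⟩ := Valuation.exists_map_sum_eq W.valuation (Finset.range ℓ)
    (fun i => c i * Y ^ i) (by
      intro i hi j hj hij hi0 hj0 heq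
      obtain ⟨r, hr⟩ := hterm i (left_ne_zero_of_mul hi0)
      obtain ⟨r', hr'⟩ := hterm j (left_ne_zero_of_mul hj0)
      rw [heq, hr'] at hr
      have h1 := h.zpow_inj hr
      have h2 : (ℓ : ℤ) ∣ (i - j) * n := ⟨r' - r, by linear_combination -h1⟩
      rw [Finset.mem_range] at hi hj
      rcases hpℤ.dvd_or_dvd h2 with h3 | h3
      · obtain ⟨w, hw⟩ := h3
        have : w = 0 := by nlinarith
        apply hij
        rw [this] at hw
        omega
      · exact hn h3) hne'
  rw [hiv]
  intro heq
  obtain ⟨r, hr⟩ := hterm i (left_ne_zero_of_mul hi0)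
  rw [heq, ← zpow_natCast, ← zpow_mul] at hr
  have h1 := h.zpow_inj hr
  have h2 : (ℓ : ℤ) ∣ i * n := ⟨m - r, by linear_combination -h1⟩
  rcases hpℤ.dvd_or_dvd h2 with h3 | h3
  · rw [Finset.mem_range] at hi
    have h4 : ℓ ∣ i := by exact_mod_cast h3
    have h5 := Nat.eq_zero_of_dvd_of_lt h4 hi
    rw [h5, h0, zero_mul] at hi0
    exact hi0 rfl
  · exact hn h3

end IsUniformizer

end ValuationKummer

/-! ### Fixed elements of automorphisms in normal extensions -/

section Automorphisms

variable {M E : Type*} [Field M] [Field E] [Algebra M E]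

/-- In a normal extension, a separable element fixed by all automorphisms lies in the base. -/
lemma mem_range_of_forall_algEquiv_eq [Normal M E] {x : E} (hx : IsSeparable M x)
    (h : ∀ σ : E ≃ₐ[M] E, σ x = x) : x ∈ (algebraMap M E).range := by
  have hint := hx.isIntegral
  rw [← minpoly.natDegree_eq_one_iff, ← card_rootSet_eq_natDegree hx (Normal.splits' x),
    Fintype.card_eq_one_iff]
  refine ⟨⟨x, (mem_rootSet_of_ne (minpoly.ne_zero hint)).2 (minpoly.aeval _ _)⟩, ?_⟩
  rintro ⟨y, hy⟩
  obtain ⟨σ, hσ⟩ := minpoly.exists_algEquiv_of_root' hint.isAlgebraic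
    (aeval_eq_zero_of_mem_rootSet hy)
  rw [Subtype.mk.injEq, ← hσ, h]

lemma algEquiv_eq_of_mem_adjoin {S : Set E} (σ τ : E ≃ₐ[M] E) (h : ∀ x ∈ S, σ x = τ x) {x : E}
    (hx : x ∈ IntermediateField.adjoin M S) : σ x = τ x := by
  induction hx using IntermediateField.adjoin_induction with
  | mem x hx => exact h x hx
  | algebraMap x => rw [σ.commutes, τ.commutes]
  | add x y _ _ hx hy => rw [map_add, map_add, hx, hy]
  | inv x _ hx => rw [map_inv₀, map_inv₀, hx]
  | mul x y _ _ hx hy => rw [map_mul, map_mul, hx, hy]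

end Automorphisms

/-! ### Kummer theory by averaging and Lagrange resolvents -/

section KummerAutomorphisms

variable {A E : Type*} [Field A] [Field E] [Algebra A E] {L : IntermediateField A E} {ℓ : ℕ}

lemma algEquiv_eq_self (τ : E ≃ₐ[L] E) {x : E} (hx : x ∈ L) : τ x = x :=
  τ.commutes ⟨x, hx⟩

lemma algEquiv_pow_apply (τ : E ≃ₐ[L] E) {ζ Y : E} (hζL : ζ ∈ L) (hY : τ Y = ζ * Y) (m : ℕ) :
    (τ ^ m) Y = ζ ^ m * Y := by
  induction m with
  | zero => simp
  | succ m ih =>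
    rw [pow_succ', AlgEquiv.mul_apply, ih, map_mul, hY, algEquiv_eq_self τ (pow_mem hζL m)]
    ring

/-- Orthogonality of characters: τ multiplies Y^i by ζ^i, and for 0 < i < ℓ the powers of ζ^i sum to
zero. -/
lemma sum_pow_algEquiv_apply (hp : ℓ.Prime) (τ : E ≃ₐ[L] E) {ζ Y : E}
    (hζ : IsPrimitiveRoot ζ ℓ) (hζL : ζ ∈ L) (hY : τ Y = ζ * Y) (c : ℕ → E)
    (hc : ∀ i, c i ∈ L) :
    ∑ m ∈ Finset.range ℓ, (τ ^ m) (∑ i ∈ Finset.range ℓ, c i * Y ^ i) = ℓ * c 0 := by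
  have h1 : ∀ m, (τ ^ m) (∑ i ∈ Finset.range ℓ, c i * Y ^ i) =
      ∑ i ∈ Finset.range ℓ, c i * Y ^ i * (ζ ^ i) ^ m := by
    intro m
    rw [map_sum]
    refine Finset.sum_congr rfl fun i _ => ?_
    rw [map_mul, map_pow, algEquiv_pow_apply τ hζL hY, algEquiv_eq_self _ (hc i)]
    ring
  simp_rw [h1]
  rw [Finset.sum_comm, Finset.sum_eq_single_of_mem 0 (Finset.mem_range.2 hp.pos)]
  · simp [mul_comm]
  · intro i hi hi0
    rw [← Finset.mul_sum, (hζ.pow_of_coprime i (Nat.Coprime.symm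
      ((Nat.Prime.coprime_iff_not_dvd hp).2 fun hdvd => hi0
        (Nat.eq_zero_of_dvd_of_lt hdvd (Finset.mem_range.1 hi))))).geom_sum_eq_zero hp.one_lt,
      mul_zero]

lemma exists_algEquiv_kummer [Normal L E] (hp : ℓ.Prime) {Y ζ : E} (hY : Y ^ ℓ ∈ L)
    (hnot : ∀ u ∈ L, u ^ ℓ ≠ Y ^ ℓ) (hζ : ζ ^ ℓ = 1) : ∃ τ : E ≃ₐ[L] E, τ Y = ζ * Y := by
  have hirr : Irreducible (X ^ ℓ - C (⟨Y ^ ℓ, hY⟩ : L)) :=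
    X_pow_sub_C_irreducible_of_prime hp fun b hb => hnot b b.2 (congrArg Subtype.val hb)
  have haev : ∀ z : E, z ^ ℓ = Y ^ ℓ → aeval z (X ^ ℓ - C (⟨Y ^ ℓ, hY⟩ : L)) = 0 := by
    intro z hz
    rw [map_sub, map_pow, aeval_X, aeval_C, hz]
    exact sub_self _
  have hmin := minpoly.eq_of_irreducible_of_monic hirr (haev Y rfl)
    (monic_X_pow_sub_C _ hp.ne_zero)
  refine minpoly.exists_algEquiv_of_root' (Algebra.IsAlgebraic.isAlgebraic Y) ?_
  rw [← hmin]
  exact haev _ (by rw [mul_pow, hζ, one_mul])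

/-- Two Kummer generators of the same extension differ by a power and a factor in the base. -/
lemma exists_eq_mul_pow_of_adjoin_eq [Normal L E] (hp : ℓ.Prime) (hℓ : (ℓ : E) ≠ 0) {ζ Y Y' : E}
    (hζ : IsPrimitiveRoot ζ ℓ) (hζL : ζ ∈ L) (hY : Y ^ ℓ ∈ L) (hY' : Y' ^ ℓ ∈ L)
    (hnot : ∀ u ∈ L, u ^ ℓ ≠ Y ^ ℓ) (hmem : Y' ∈ IntermediateField.adjoin L {Y}) :
    ∃ j : ℕ, ∃ u ∈ L, Y' = u * Y ^ j := by
  by_cases h0 : Y' = 0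
  · exact ⟨0, 0, L.zero_mem, by simp [h0]⟩
  have hY0 : Y ≠ 0 := by
    rintro rfl
    exact hnot 0 L.zero_mem rfl
  obtain ⟨τ, hτ⟩ := exists_algEquiv_kummer hp hY hnot hζ.pow_eq_one
  have hroot : (τ Y' / Y') ^ ℓ = 1 := by
    rw [div_pow, ← map_pow, algEquiv_eq_self τ hY', div_self (pow_ne_zero _ h0)]
  have : NeZero ℓ := ⟨hp.ne_zero⟩
  obtain ⟨j, -, hj⟩ := hζ.eq_pow_of_pow_eq_one hroot
  refine ⟨j, Y' / Y ^ j, ?_, (div_mul_cancel₀ _ (pow_ne_zero _ hY0)).symm⟩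
  -- Both Y' and Y^j are multiplied by ζ^j under τ. Averaging the fixed quotient over the powers of
  -- τ then identifies it with its constant coefficient, which lies in L.
  have hfix : τ (Y' / Y ^ j) = Y' / Y ^ j := by
    have h1 : τ Y' = ζ ^ j * Y' := by rw [hj, div_mul_cancel₀ _ h0]
    have hζ0 : ζ ≠ 0 := hζ.ne_zero hp.ne_zero
    rw [map_div₀, map_pow, hτ, h1, mul_pow, mul_div_mul_left _ _ (pow_ne_zero _ hζ0)]
  obtain ⟨c, hc, hu⟩ := exists_sum_of_mem_adjoin_root hp.pos hY
    (x := Y' / Y ^ j) (div_mem hmem (pow_mem (IntermediateField.mem_adjoin_simple_self L Y) j))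
  have hsum := sum_pow_algEquiv_apply hp τ hζ hζL hτ c hc
  rw [← hu] at hsum
  have hpow : ∀ m : ℕ, (τ ^ m) (Y' / Y ^ j) = Y' / Y ^ j := by
    intro m
    induction m with
    | zero => simp
    | succ m ih => rw [pow_succ', AlgEquiv.mul_apply, ih, hfix]
  simp_rw [hpow] at hsum
  rw [Finset.sum_const, Finset.card_range, nsmul_eq_mul] at hsum
  rw [mul_left_cancel₀ hℓ hsum]
  exact hc 0

/-- The Lagrange resolvent of `α` for the character `τ ↦ ζ ^ j`. -/
def lagrangeResolvent (ℓ : ℕ) (ζ : E) (τ : E ≃ₐ[L] E) (α : E) (j : ℕ) : E :=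
  ∑ m ∈ Finset.range ℓ, ((ζ ^ j)⁻¹) ^ m * (τ ^ m) α

/-- The resolvents sum to ℓα. Were all those with j ≠ 0 zero, ℓα would be the resolvent with j = 0,
which τ fixes, against τα ≠ α. -/
lemma exists_lagrange_resolvent_ne_zero (hp : ℓ.Prime) (hℓ : (ℓ : E) ≠ 0) {ζ : E}
    (hζ : IsPrimitiveRoot ζ ℓ) (hζL : ζ ∈ L) (τ : E ≃ₐ[L] E) {α : E} (hτℓ : (τ ^ ℓ) α = α)
    (hτ : τ α ≠ α) : ∃ j < ℓ, j ≠ 0 ∧ lagrangeResolvent ℓ ζ τ α j ≠ 0 ∧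
      τ (lagrangeResolvent ℓ ζ τ α j) = ζ ^ j * lagrangeResolvent ℓ ζ τ α j := by
  have hζ0 : ζ ≠ 0 := hζ.ne_zero hp.ne_zero
  have hηL : ∀ j, (ζ ^ j)⁻¹ ∈ L := fun j => inv_mem (pow_mem hζL j)
  have hτR : ∀ j, τ (lagrangeResolvent ℓ ζ τ α j) = ζ ^ j * lagrangeResolvent ℓ ζ τ α j := by
    intro j
    have h1 : τ (lagrangeResolvent ℓ ζ τ α j) = 
        ∑ m ∈ Finset.range ℓ, ((ζ ^ j)⁻¹) ^ m * (τ ^ (m + 1)) α := by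
      rw [lagrangeResolvent, map_sum]
      refine Finset.sum_congr rfl fun m _ => ?_
      rw [map_mul, algEquiv_eq_self τ (pow_mem (hηL j) m), pow_succ', AlgEquiv.mul_apply]
    have h2 : ∑ m ∈ Finset.range ℓ, ((ζ ^ j)⁻¹) ^ (m + 1) * (τ ^ (m + 1)) α =
        lagrangeResolvent ℓ ζ τ α j := by
      have h3 := Finset.sum_range_succ' (fun m => ((ζ ^ j)⁻¹) ^ m * (τ ^ m) α) ℓ
      have h4 := Finset.sum_range_succ (fun m => ((ζ ^ j)⁻¹) ^ m * (τ ^ m) α) ℓ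
      rw [h4] at h3
      simp only [pow_zero, one_mul, AlgEquiv.one_apply] at h3
      rw [hτℓ, inv_pow, ← pow_mul, mul_comm j ℓ, pow_mul, hζ.pow_eq_one, one_pow, inv_one,
        one_mul] at h3
      exact (add_right_cancel h3).symm
    rw [h1, ← h2, Finset.mul_sum]
    refine Finset.sum_congr rfl fun m _ => ?_
    rw [pow_succ' (ζ ^ j)⁻¹, mul_assoc (ζ ^ j)⁻¹, mul_inv_cancel_left₀ (pow_ne_zero _ hζ0)]
  have hsumR : ∑ j ∈ Finset.range ℓ, lagrangeResolvent ℓ ζ τ α j = ℓ * α := by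
    unfold lagrangeResolvent
    rw [Finset.sum_comm, Finset.sum_eq_single_of_mem 0 (Finset.mem_range.2 hp.pos)]
    · simp
    · intro m hm hm0
      rw [← Finset.sum_mul]
      have hprim : IsPrimitiveRoot (ζ⁻¹ ^ m) ℓ := hζ.inv.pow_of_coprime m (Nat.Coprime.symm
        ((Nat.Prime.coprime_iff_not_dvd hp).2 fun hdvd => hm0
          (Nat.eq_zero_of_dvd_of_lt hdvd (Finset.mem_range.1 hm))))
      have : ∑ j ∈ Finset.range ℓ, ((ζ ^ j)⁻¹) ^ m = ∑ j ∈ Finset.range ℓ, (ζ⁻¹ ^ m) ^ j :=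
        Finset.sum_congr rfl fun j _ => by rw [← inv_pow, ← pow_mul, ← pow_mul, mul_comm]
      rw [this, hprim.geom_sum_eq_zero hp.one_lt, zero_mul]
  suffices ∃ j < ℓ, j ≠ 0 ∧ lagrangeResolvent ℓ ζ τ α j ≠ 0 by
    obtain ⟨j, hj, hj0, hRj⟩ := this
    exact ⟨j, hj, hj0, hRj, hτR j⟩
  by_contra! hcon
  rw [Finset.sum_eq_single_of_mem 0 (Finset.mem_range.2 hp.pos)
    (fun j hj hj0 => hcon j (Finset.mem_range.1 hj) hj0)] at hsumR
  have h1 := hτR 0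
  rw [pow_zero, one_mul, hsumR, map_mul, map_natCast] at h1
  exact hτ (mul_left_cancel₀ hℓ h1)

lemma isSeparable_of_mem (K : IntermediateField A E) [Algebra.IsSeparable A K] {x : E}
    (hx : x ∈ K) : IsSeparable A x := by
  have h : (minpoly A (⟨x, hx⟩ : K)).Separable := Algebra.IsSeparable.isSeparable A (⟨x, hx⟩ : K)
  rwa [IntermediateField.minpoly_eq] at h

/-- Restriction sends automorphisms over L into Gal(K/A), of prime order ℓ. Its image is nontrivial
because K ⊄ L, and any nontrivial element generates. -/
lemma exists_algEquiv_generator [Normal L E] (hp : ℓ.Prime) (K : IntermediateField A E)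
    [IsGalois A K] (hK : Module.finrank A K = ℓ) (hKL : ¬ K ≤ L) :
    ∃ τ : E ≃ₐ[L] E, (∃ α ∈ K, τ α ≠ α) ∧ (∀ x ∈ K, (τ ^ ℓ) x = x) ∧
      (∀ m : ℕ, ∀ x ∈ K, (τ ^ m) x ∈ K) ∧
      ∀ σ : E ≃ₐ[L] E, ∃ m : ℕ, ∀ x ∈ K, σ x = (τ ^ m) x := by
  have : Fact ℓ.Prime := ⟨hp⟩
  have : FiniteDimensional A K := FiniteDimensional.of_finrank_pos (hK ▸ hp.pos)
  have hcard : Nat.card (K ≃ₐ[A] K) = ℓ := by rw [IsGalois.card_aut_eq_finrank, hK]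
  obtain ⟨α, hαK, hαL⟩ := SetLike.not_le_iff_exists.1 hKL
  obtain ⟨τ, hτ⟩ : ∃ τ : E ≃ₐ[L] E, τ α ≠ α := by
    by_contra! hcon
    obtain ⟨y, hy⟩ := mem_range_of_forall_algEquiv_eq
      ((isSeparable_of_mem K hαK).tower_top L) hcon
    exact hαL (hy ▸ y.2)
  have hresap : ∀ (σ : E ≃ₐ[L] E) (x : E) (hx : x ∈ K),
      (IntermediateField.restrictRestrictAlgEquivMapHom A K L E σ ⟨x, hx⟩ : E) = σ x :=
    fun σ x hx => IntermediateField.restrictRestrictAlgEquivMapHom_apply K L σ ⟨x, hx⟩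
  generalize IntermediateField.restrictRestrictAlgEquivMapHom A K L E = res at hresap
  have hτ1 : res τ ≠ 1 := by
    intro h1
    have := hresap τ α hαK
    rw [h1] at this
    exact hτ this.symm
  refine ⟨τ, ⟨α, hαK, hτ⟩, fun x hx => ?_, fun m x hx => ?_, fun σ => ?_⟩
  · rw [← hresap (τ ^ ℓ) x hx, map_pow, ← hcard, pow_card_eq_one']
    rfl
  · rw [← hresap (τ ^ m) x hx]; exact (res (τ ^ m) ⟨x, hx⟩).2
  · obtain ⟨m, hm⟩ := mem_powers_of_prime_card hcard hτ1 (g' := res σ)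
    refine ⟨m, fun x hx => ?_⟩
    rw [← hresap σ x hx, ← hresap (τ ^ m) x hx, map_pow, ← hm]

/-- A Galois subextension of prime degree, not contained in a field with the `ℓ`-th roots of unity,
becomes a Kummer extension over that field. -/
lemma exists_kummer_generator [Normal L E] (hp : ℓ.Prime) (hℓ : (ℓ : E) ≠ 0) {ζ : E}
    (hζ : IsPrimitiveRoot ζ ℓ) (hζL : ζ ∈ L) (K : IntermediateField A E) [IsGalois A K]
    (hK : Module.finrank A K = ℓ) (hKL : ¬ K ≤ L) :
    ∃ Y : E, Y ^ ℓ ∈ L ∧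
      IntermediateField.adjoin L (K : Set E) = IntermediateField.adjoin L {Y} := by
  obtain ⟨τ, ⟨α, hαK, hτ⟩, hτℓ, hpowK, hpowers⟩ := exists_algEquiv_generator hp K hK hKL
  have hsepL : ∀ x ∈ K, IsSeparable L x := fun x hx => (isSeparable_of_mem K hx).tower_top L
  have : Algebra.IsSeparable L (IntermediateField.adjoin L (K : Set E)) :=
    (IntermediateField.isSeparable_adjoin_iff_isSeparable L E).2 hsepL
  have hsepLK : ∀ x ∈ IntermediateField.adjoin L (K : Set E), IsSeparable L x :=
    fun x hx => isSeparable_of_mem _ hx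
  obtain ⟨j, hj, hj0, hRj, hτR⟩ := exists_lagrange_resolvent_ne_zero hp hℓ hζ hζL τ (hτℓ α hαK) hτ
  set R := lagrangeResolvent ℓ ζ τ α with hR
  have hηL : ∀ j, (ζ ^ j)⁻¹ ∈ L := fun j => inv_mem (pow_mem hζL j)
  have hη : IsPrimitiveRoot (ζ ^ j) ℓ := hζ.pow_of_coprime j (Nat.Coprime.symm
    ((Nat.Prime.coprime_iff_not_dvd hp).2 fun hdvd => hj0 (Nat.eq_zero_of_dvd_of_lt hdvd hj)))
  have hηL' : ζ ^ j ∈ L := pow_mem hζL j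
  have hRmem : R j ∈ IntermediateField.adjoin L (K : Set E) := by
    refine sum_mem fun m _ => mul_mem (pow_mem ?_ m)
      (IntermediateField.subset_adjoin L _ (hpowK m α hαK))
    exact (IntermediateField.adjoin L (K : Set E)).algebraMap_mem (⟨_, hηL j⟩ : L)
  have hσR : ∀ σ : E ≃ₐ[L] E, ∃ m : ℕ, (∀ x ∈ K, σ x = (τ ^ m) x) ∧
      σ (R j) = (ζ ^ j) ^ m * R j := by
    intro σ
    obtain ⟨m, hm⟩ := hpowers σ
    refine ⟨m, hm, ?_⟩
    rw [algEquiv_eq_of_mem_adjoin σ (τ ^ m) hm hRmem, algEquiv_pow_apply τ hηL' hτR]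
  refine ⟨R j, ?_, le_antisymm ?_ ?_⟩
  · obtain ⟨y, hy⟩ := mem_range_of_forall_algEquiv_eq (M := L) (x := R j ^ ℓ)
      (hsepLK _ (pow_mem hRmem ℓ)) (fun σ => by
        obtain ⟨m, -, hm⟩ := hσR σ
        rw [map_pow, hm, mul_pow, ← pow_mul, mul_comm m ℓ, pow_mul, hη.pow_eq_one, one_pow,
          one_mul])
    exact hy ▸ y.2
  · rw [IntermediateField.adjoin_le_iff]
    intro x hx
    set M := IntermediateField.adjoin L {R j} with hM
    have : Normal M E := Normal.tower_top_of_normal L M E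
    obtain ⟨y, hy⟩ := mem_range_of_forall_algEquiv_eq (M := M) ((hsepL x hx).tower_top M)
      (fun σ => by
        obtain ⟨m, hm, hmR⟩ := hσR (σ.restrictScalars L)
        have h1 : (σ.restrictScalars L) (R j) = R j :=
          σ.commutes ⟨R j, IntermediateField.mem_adjoin_simple_self L _⟩
        -- An automorphism fixing the resolvent acts on K as a power of τ whose exponent is
        -- divisible by ℓ, so it fixes K. Hence K lies in the field generated by the resolvent.
        have h2 : (ζ ^ j) ^ m = 1 := by
          refine mul_right_cancel₀ hRj ?_
          rw [← hmR, h1, one_mul]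
        obtain ⟨r, rfl⟩ := (hη.pow_eq_one_iff_dvd m).1 h2
        have h3 : ∀ r : ℕ, (τ ^ (ℓ * r)) x = x := by
          intro r
          induction r with
          | zero => simp
          | succ r ih => rw [Nat.mul_succ, pow_add, AlgEquiv.mul_apply, hτℓ x hx, ih]
        exact (hm x hx).trans (h3 r))
    exact hy ▸ y.2
  · rw [IntermediateField.adjoin_le_iff, Set.singleton_subset_iff]
    exact hRmem

end KummerAutomorphisms

/-! ### The field k(t) inside E, and Kummer polynomials over it -/

section GeometricField

variable {F : Type*} [Field F] {k : Type*} [Field k] [Algebra F k] [Algebra.IsAlgebraic F k]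
  {E : Type*} [Field E] [Algebra F E] [Algebra (RatFunc F) E] [Algebra k E]
  [IsScalarTower F (RatFunc F) E] [IsScalarTower F k E]

variable (F k E) in
/-- Evaluation of polynomials over `k` at the variable of `F(t)`, inside `E`. -/
noncomputable def polyEval : k[X] →ₐ[k] E := aeval (algebraMap (RatFunc F) E RatFunc.X)

variable (F k E) in
/-- The compositum of `F(t)` and `k` inside `E`. -/
noncomputable def geometricField : IntermediateField (RatFunc F) E :=
  IntermediateField.adjoin (RatFunc F) (Set.range (algebraMap k E))

/-- The variable t is transcendental over F, hence over k, which is algebraic over F. -/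
lemma polyEval_injective : Function.Injective (polyEval F k E) := by
  have h : Transcendental F (algebraMap (RatFunc F) E RatFunc.X) :=
    (transcendental_algebraMap_iff (algebraMap (RatFunc F) E).injective).2 RatFunc.transcendental_X
  exact transcendental_iff_injective.1 fun halg => h (halg.restrictScalars F)

lemma polyEval_ne_zero {p : k[X]} (hp : p ≠ 0) : polyEval F k E p ≠ 0 :=
  (map_ne_zero_iff _ polyEval_injective).2 hp

lemma polyEval_C (c : k) : polyEval F k E (C c) = algebraMap k E c := aeval_C _ _

lemma polyEval_X : polyEval F k E X = algebraMap (RatFunc F) E RatFunc.X := aeval_X _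

lemma polyEval_map (p : F[X]) : polyEval F k E (p.map (algebraMap F k)) =
    algebraMap (RatFunc F) E (algebraMap F[X] (RatFunc F) p) := by
  rw [polyEval, aeval_map_algebraMap, aeval_algebraMap_apply, ← RatFunc.algebraMap_X,
    aeval_algebraMap_apply, aeval_X_left_apply]

lemma algebraMap_mem_geometricField (c : k) : algebraMap k E c ∈ geometricField F k E :=
  IntermediateField.subset_adjoin _ _ ⟨c, rfl⟩

lemma polyEval_mem (p : k[X]) : polyEval F k E p ∈ geometricField F k E := by
  rw [polyEval, aeval_def, eval₂_eq_sum_range]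
  exact sum_mem fun i _ => mul_mem (algebraMap_mem_geometricField _)
    (pow_mem ((geometricField F k E).algebraMap_mem _) _)

lemma mem_geometricField {x : E} : x ∈ geometricField F k E ↔
    ∃ p q : k[X], q ≠ 0 ∧ x = polyEval F k E p / polyEval F k E q := by
  constructor
  · intro hx
    induction hx using IntermediateField.adjoin_induction with
    | mem x hx =>
      obtain ⟨c, rfl⟩ := hx
      exact ⟨C c, 1, one_ne_zero, by rw [polyEval_C, map_one, div_one]⟩
    | algebraMap x =>
      refine ⟨x.num.map (algebraMap F k), x.denom.map (algebraMap F k),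
        (Polynomial.map_ne_zero_iff (algebraMap F k).injective).2 x.denom_ne_zero, ?_⟩
      rw [polyEval_map, polyEval_map, ← map_div₀, RatFunc.num_div_denom]
    | add x y _ _ hx hy =>
      obtain ⟨p, q, hq, rfl⟩ := hx
      obtain ⟨p', q', hq', rfl⟩ := hy
      refine ⟨p * q' + q * p', q * q', mul_ne_zero hq hq', ?_⟩
      rw [div_add_div _ _ (polyEval_ne_zero hq) (polyEval_ne_zero hq')]
      simp only [map_add, map_mul]
    | inv x _ hx =>
      obtain ⟨p, q, hq, rfl⟩ := hx
      by_cases hp : p = 0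
      · exact ⟨0, 1, one_ne_zero, by simp [hp]⟩
      · exact ⟨q, p, hp, inv_div _ _⟩
    | mul x y _ _ hx hy =>
      obtain ⟨p, q, hq, rfl⟩ := hx
      obtain ⟨p', q', hq', rfl⟩ := hy
      exact ⟨p * p', q * q', mul_ne_zero hq hq', by rw [div_mul_div_comm, map_mul, map_mul]⟩
  · rintro ⟨p, q, -, rfl⟩
    exact div_mem (polyEval_mem p) (polyEval_mem q)

lemma rootMultiplicity_pow_eq (p : k[X]) (n : ℕ) (θ : k) :
    rootMultiplicity θ (p ^ n) = n * rootMultiplicity θ p := by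
  classical
  rw [← count_roots, roots_pow, Multiset.count_nsmul, count_roots]

/-- Multiplicities of roots modulo `ℓ` only depend on the class modulo `ℓ`-th powers of `k(t)`. -/
lemma rootMultiplicity_eq_of_pow_mul {ℓ : ℕ} (hℓ : ℓ ≠ 0) {g g' : k[X]} (hg : g ≠ 0) (hg' : g' ≠ 0) {u : E}
    (hu : u ∈ geometricField F k E) (j : ℕ)
    (h : polyEval F k E g' = u ^ ℓ * polyEval F k E g ^ j) (θ : k) :
    (rootMultiplicity θ g' : ZMod ℓ) = j * rootMultiplicity θ g := by
  obtain ⟨p, q, hq, rfl⟩ := mem_geometricField.1 hu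
  have hp : p ≠ 0 := by
    rintro rfl
    rw [map_zero, zero_div, zero_pow hℓ, zero_mul] at h
    exact polyEval_ne_zero hg' h
  have h1 : q ^ ℓ * g' = p ^ ℓ * g ^ j := by
    apply polyEval_injective (F := F) (E := E)
    rw [map_mul, map_pow, h, map_mul, map_pow, map_pow, div_pow]
    have := polyEval_ne_zero (F := F) (E := E) hq
    field_simp
  have h2 := congrArg (fun f => (rootMultiplicity θ f : ZMod ℓ)) h1
  rw [rootMultiplicity_mul (mul_ne_zero (pow_ne_zero _ hq) hg'), rootMultiplicity_mul
    (mul_ne_zero (pow_ne_zero _ hp) (pow_ne_zero _ hg)), rootMultiplicity_pow_eq,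
    rootMultiplicity_pow_eq, rootMultiplicity_pow_eq] at h2
  simpa using h2

lemma Polynomial.Monic.eq_prod_roots [IsAlgClosed k] [DecidableEq k] {g : k[X]} (hg : g.Monic) :
    g = ∏ a ∈ g.roots.toFinset, (X - C a) ^ rootMultiplicity a g := by
  rw [← prod_multiset_root_eq_finset_root]
  exact (IsAlgClosed.splits g).eq_prod_roots_of_monic hg

/-- A monic polynomial that is not an `ℓ`-th power in `k(t)` has a root of multiplicity prime
to `ℓ`. -/
lemma exists_not_dvd_rootMultiplicity [IsAlgClosed k] {ℓ : ℕ} {g : k[X]} (hg : g.Monic)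
    (hnot : ∀ u ∈ geometricField F k E, u ^ ℓ ≠ polyEval F k E g) :
    ∃ θ, ¬ ℓ ∣ rootMultiplicity θ g := by
  classical
  by_contra! hcon
  choose m hm using hcon
  refine hnot _ (polyEval_mem (∏ a ∈ g.roots.toFinset, (X - C a) ^ m a)) ?_
  rw [← map_pow, ← Finset.prod_pow]
  congr 1
  conv_rhs => rw [hg.eq_prod_roots]
  exact Finset.prod_congr rfl fun a _ => by rw [← pow_mul, hm a, mul_comm]

lemma ne_pow_of_not_dvd_rootMultiplicity {ℓ : ℕ} (hℓ : ℓ ≠ 0) {g : k[X]} (hg : g ≠ 0) {θ : k}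
    (hθ : ¬ ℓ ∣ rootMultiplicity θ g) :
    ∀ u ∈ geometricField F k E, u ^ ℓ ≠ polyEval F k E g := by
  intro u hu h
  have := rootMultiplicity_eq_of_pow_mul hℓ (g := 1) one_ne_zero hg hu 0
    (by rw [h, pow_zero, mul_one]) θ
  rw [Nat.cast_zero, zero_mul, ZMod.natCast_eq_zero_iff] at this
  exact hθ this

variable [IsAlgClosed E] [Algebra.IsAlgebraic (RatFunc F) E]

instance normal_of_isAlgClosed (L : IntermediateField (RatFunc F) E) : Normal L E :=
  have : Algebra.IsAlgebraic L E := Algebra.IsAlgebraic.tower_top (K := RatFunc F) L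
  have : IsAlgClosure L E := ⟨inferInstance, inferInstance⟩
  IsAlgClosure.normal L E

/-- A monic polynomial over `k` whose `ℓ`-th root is a Kummer generator of `K` over `k(t)`. -/
structure IsKummerPolynomial (ℓ : ℕ) (K : IntermediateField (RatFunc F) E) (Y : E) (g : k[X]) :
    Prop where
  monic : g.Monic
  pow_eq : Y ^ ℓ = polyEval F k E g
  adjoin_eq : IntermediateField.adjoin (geometricField F k E) (K : Set E) =
    IntermediateField.adjoin (geometricField F k E) {Y}

lemma IsKummerPolynomial.not_le {ℓ : ℕ} {K : IntermediateField (RatFunc F) E} {Y : E} {g : k[X]}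
    (h : IsKummerPolynomial ℓ K Y g) (hK : ¬ K ≤ geometricField F k E) : 
    Y ∉ geometricField F k E := by
  intro hY
  apply hK
  intro x hx
  have h1 : x ∈ IntermediateField.adjoin (geometricField F k E) {Y} := by
    rw [← h.adjoin_eq]; exact IntermediateField.subset_adjoin _ _ hx
  rw [IntermediateField.adjoin_simple_eq_bot_iff.2 (show Y ∈ ⊥ from
    IntermediateField.mem_bot.2 ⟨⟨Y, hY⟩, rfl⟩), IntermediateField.mem_bot] at h1
  obtain ⟨y, rfl⟩ := h1
  exact y.2

lemma exists_primitiveRoot [IsAlgClosed k] {ℓ : ℕ} (hℓ : (ℓ : k) ≠ 0) :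
    ∃ ζ : E, IsPrimitiveRoot ζ ℓ ∧ ζ ∈ geometricField F k E := by
  have : NeZero (ℓ : k) := ⟨hℓ⟩
  obtain ⟨ζ, hζ⟩ := HasEnoughRootsOfUnity.exists_primitiveRoot k ℓ
  exact ⟨algebraMap k E ζ, hζ.map_of_injective (algebraMap k E).injective,
    algebraMap_mem_geometricField ζ⟩

/-- Two Kummer polynomials of the same extension have proportional multiplicities. -/
lemma IsKummerPolynomial.exists_eq_mul [IsAlgClosed k] {ℓ : ℕ} (hp : ℓ.Prime) (hℓ : (ℓ : k) ≠ 0)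
    {K : IntermediateField (RatFunc F) E} {Y Y' : E} {g g' : k[X]}
    (h : IsKummerPolynomial ℓ K Y g) (h' : IsKummerPolynomial ℓ K Y' g')
    (hg : ∃ θ, ¬ ℓ ∣ rootMultiplicity θ g) (hg' : ∃ θ, ¬ ℓ ∣ rootMultiplicity θ g') :
    ∃ j : ZMod ℓ, j ≠ 0 ∧ ∀ θ, (rootMultiplicity θ g' : ZMod ℓ) = j * rootMultiplicity θ g := by
  obtain ⟨ζ, hζ, hζL⟩ := exists_primitiveRoot (F := F) (E := E) hℓ
  obtain ⟨θ, hθ⟩ := hg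
  obtain ⟨θ', hθ'⟩ := hg'
  have hℓE : (ℓ : E) ≠ 0 := by
    rw [← map_natCast (algebraMap k E)]
    exact (_root_.map_ne_zero _).2 hℓ
  obtain ⟨j, u, hu, hju⟩ := exists_eq_mul_pow_of_adjoin_eq hp hℓE hζ hζL
    (by rw [h.pow_eq]; exact polyEval_mem g) (by rw [h'.pow_eq]; exact polyEval_mem g')
    (by rw [h.pow_eq]; exact ne_pow_of_not_dvd_rootMultiplicity hp.ne_zero h.monic.ne_zero hθ)
    (show Y' ∈ _ by
      rw [← h.adjoin_eq, h'.adjoin_eq]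
      exact IntermediateField.mem_adjoin_simple_self _ _)
  have hmul : ∀ θ, (rootMultiplicity θ g' : ZMod ℓ) = j * rootMultiplicity θ g :=
    rootMultiplicity_eq_of_pow_mul hp.ne_zero h.monic.ne_zero h'.monic.ne_zero hu j
      (by rw [← h'.pow_eq, ← h.pow_eq, hju]; ring)
  refine ⟨j, fun hj => hθ' ?_, hmul⟩
  rw [← ZMod.natCast_eq_zero_iff, hmul, hj, zero_mul]

lemma adjoin_singleton_mul_eq {L : IntermediateField (RatFunc F) E} {u Y : E} (hu : u ∈ L)
    (hu0 : u ≠ 0) : IntermediateField.adjoin L {u * Y} = IntermediateField.adjoin L {Y} := by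
  have hmem : ∀ (v Z : E), v ∈ L → v * Z ∈ IntermediateField.adjoin L {Z} := fun v Z hv =>
    mul_mem ((IntermediateField.adjoin L {Z}).algebraMap_mem ⟨v, hv⟩)
      (IntermediateField.mem_adjoin_simple_self L Z)
  refine le_antisymm ?_ ?_
  · rw [IntermediateField.adjoin_simple_le_iff]
    exact hmem u Y hu
  · rw [IntermediateField.adjoin_simple_le_iff]
    have := hmem u⁻¹ (u * Y) (inv_mem hu)
    rwa [inv_mul_cancel_left₀ hu0] at this

/-- Every Galois extension of `F(t)` of degree `ℓ` that is not contained in `k(t)` has a Kummer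
polynomial. -/
lemma exists_isKummerPolynomial [IsAlgClosed k] {ℓ : ℕ} (hp : ℓ.Prime) (hℓ : (ℓ : k) ≠ 0)
    (K : IntermediateField (RatFunc F) E) [IsGalois (RatFunc F) K]
    (hK : Module.finrank (RatFunc F) K = ℓ) (hKL : ¬ K ≤ geometricField F k E) :
    ∃ (Y : E) (g : k[X]), IsKummerPolynomial ℓ K Y g := by
  obtain ⟨ζ, hζ, hζL⟩ := exists_primitiveRoot (F := F) (E := E) hℓ
  have hℓE : (ℓ : E) ≠ 0 := by
    rw [← map_natCast (algebraMap k E)]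
    exact (_root_.map_ne_zero _).2 hℓ
  obtain ⟨Y, hY, hadj⟩ := exists_kummer_generator hp hℓE hζ hζL K hK hKL
  obtain ⟨p, q, hq, hpq⟩ := mem_geometricField.1 hY
  have hp0 : p ≠ 0 := by
    rintro rfl
    rw [map_zero, zero_div, pow_eq_zero_iff hp.ne_zero] at hpq
    subst hpq
    apply hKL
    intro x hx
    have h1 : x ∈ IntermediateField.adjoin (geometricField F k E) {(0 : E)} := by
      rw [← hadj]; exact IntermediateField.subset_adjoin _ _ hx
    rw [IntermediateField.adjoin_zero, IntermediateField.mem_bot] at h1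
    obtain ⟨y, rfl⟩ := h1
    exact y.2
  -- Multiplying p/q by q^ℓ turns the radicand into a polynomial without changing its class modulo
  -- ℓ-th powers; the leading coefficient is itself an ℓ-th power c^ℓ in k, so it can be made monic.
  set w := p * q ^ (ℓ - 1) with hw
  have hw0 : w ≠ 0 := mul_ne_zero hp0 (pow_ne_zero _ hq)
  obtain ⟨c, hc⟩ := IsAlgClosed.exists_pow_nat_eq w.leadingCoeff hp.pos
  have hc0 : c ≠ 0 := by
    rintro rfl
    rw [zero_pow hp.ne_zero, eq_comm, leadingCoeff_eq_zero] at hc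
    exact hw0 hc
  have hu : algebraMap k E c⁻¹ * polyEval F k E q ∈ geometricField F k E :=
    mul_mem (algebraMap_mem_geometricField _) (polyEval_mem q)
  have hu0 : algebraMap k E c⁻¹ * polyEval F k E q ≠ 0 :=
    mul_ne_zero ((_root_.map_ne_zero _).2 (inv_ne_zero hc0)) (polyEval_ne_zero hq)
  refine ⟨algebraMap k E c⁻¹ * polyEval F k E q * Y, w * C w.leadingCoeff⁻¹,
    monic_mul_leadingCoeff_inv hw0, ?_, ?_⟩
  · rw [mul_pow, mul_pow, hpq, map_mul, polyEval_C, ← hc, hw, map_mul, map_pow,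
      ← inv_pow, map_pow]
    have := polyEval_ne_zero (F := F) (E := E) hq
    obtain ⟨n, rfl⟩ : ∃ n, ℓ = n + 1 := ⟨ℓ - 1, by have := hp.pos; omega⟩
    rw [Nat.add_sub_cancel, pow_succ (polyEval F k E q)]
    field_simp
  · rw [hadj, adjoin_singleton_mul_eq hu hu0]

end GeometricField

/-! ### Adjunction under ring homomorphisms, and their extension -/

section AdjoinLemmas

variable {A E : Type*} [Field A] [Field E] [Algebra A E]

/-- Stated for ring homomorphisms because a substitution moves t: it preserves the base field
without fixing it pointwise. -/
lemma map_mem_adjoin_image {Φ : E →+* E}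
    (hΦ : ∀ a : A, Φ (algebraMap A E a) ∈ (algebraMap A E).range) {S : Set E} {x : E}
    (hx : x ∈ IntermediateField.adjoin A S) : Φ x ∈ IntermediateField.adjoin A (Φ '' S) := by
  induction hx using IntermediateField.adjoin_induction with
  | mem x hx => exact IntermediateField.subset_adjoin _ _ ⟨x, hx, rfl⟩
  | algebraMap a =>
    obtain ⟨b, hb⟩ := hΦ a
    rw [← hb]
    exact IntermediateField.algebraMap_mem _ b
  | add x y _ _ hx hy => rw [map_add]; exact add_mem hx hy
  | inv x _ hx => rw [map_inv₀]; exact inv_mem hx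
  | mul x y _ _ hx hy => rw [map_mul]; exact mul_mem hx hy

lemma adjoin_coe_adjoin_eq (L : IntermediateField A E) (S : Set E) :
    IntermediateField.adjoin L (IntermediateField.adjoin A S : Set E) =
      IntermediateField.adjoin L S := by
  refine le_antisymm ?_ (IntermediateField.adjoin.mono _ _ _ (IntermediateField.subset_adjoin A S))
  rw [IntermediateField.adjoin_le_iff]
  intro x hx
  induction hx using IntermediateField.adjoin_induction with
  | mem x hx => exact IntermediateField.subset_adjoin _ _ hx
  | algebraMap a => exact (IntermediateField.adjoin L S).algebraMap_mem (algebraMap A L a)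
  | add x y _ _ hx hy => exact add_mem hx hy
  | inv x _ hx => exact inv_mem hx
  | mul x y _ _ hx hy => exact mul_mem hx hy

/-- A ring homomorphism into an algebraically closed field extends to algebraic extensions. -/
lemma exists_ringHom_extension {R S M : Type*} [CommRing R] [IsDomain R] [Field S] [Field M]
    [IsAlgClosed M] (f : R →+* S) (g : R →+* M) (hf : Function.Injective f)
    (hg : Function.Injective g) (halg : ∀ s : S, ∃ p : R[X], p ≠ 0 ∧ eval₂ f s p = 0) :
    ∃ Φ : S →+* M, ∀ r, Φ (f r) = g r := by
  let := f.toAlgebra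
  let := g.toAlgebra
  have : Module.IsTorsionFree R S := Module.isTorsionFree_iff_algebraMap_injective.2 hf
  have : Module.IsTorsionFree R M := Module.isTorsionFree_iff_algebraMap_injective.2 hg
  have : Algebra.IsAlgebraic R S := ⟨halg⟩
  exact ⟨(IsAlgClosed.lift : S →ₐ[R] M).toRingHom, fun r => (IsAlgClosed.lift).commutes r⟩

end AdjoinLemmas

/-! ### Constants in extensions of F(t) -/

section Constants

variable {F : Type*} [Field F] {k : Type*} [Field k] [Algebra F k] [Algebra.IsAlgebraic F k]
  {E : Type*} [Field E] [Algebra F E] [Algebra (RatFunc F) E] [Algebra k E]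
  [IsScalarTower F (RatFunc F) E] [IsScalarTower F k E]

lemma mem_range_of_isAlgebraic [IsAlgClosed k] {x : E} (hx : IsAlgebraic k x) :
    x ∈ (algebraMap k E).range :=
  minpoly.mem_range_of_degree_eq_one k x
    (IsAlgClosed.degree_eq_one_of_irreducible k (minpoly.irreducible hx.isIntegral))

/-- `F` is algebraically closed in `F(t)`. -/
lemma mem_range_of_algebraMap_eq {r : RatFunc F} {c : k}
    (h : algebraMap (RatFunc F) E r = algebraMap k E c) :
    algebraMap (RatFunc F) E r ∈ (algebraMap F E).range := by
  have hd : r.denom.map (algebraMap F k) ≠ 0 :=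
    (Polynomial.map_ne_zero_iff (algebraMap F k).injective).2 r.denom_ne_zero
  have h1 : r.num.map (algebraMap F k) = C c * r.denom.map (algebraMap F k) := by
    apply polyEval_injective (F := F) (E := E)
    rw [map_mul, polyEval_C, ← h, polyEval_map, polyEval_map, ← map_mul]
    congr 1
    rw [← div_eq_iff ((map_ne_zero_iff _ (IsFractionRing.injective F[X] (RatFunc F))).2
      r.denom_ne_zero), RatFunc.num_div_denom]
  -- The denominator is monic, so comparing leading coefficients exhibits c as the leading
  -- coefficient of the numerator, an element of F.
  have h2 := congrArg leadingCoeff h1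
  rw [leadingCoeff_mul, leadingCoeff_C, leadingCoeff_map, leadingCoeff_map,
    r.monic_denom.leadingCoeff, map_one, mul_one] at h2
  exact ⟨r.num.leadingCoeff, by rw [h, ← h2, ← IsScalarTower.algebraMap_apply]⟩

variable [Algebra.IsAlgebraic (RatFunc F) E]

/-- An extension of `F(t)` inside `k(t)` without new constants is trivial. -/
lemma le_bot_of_le_geometricField [PerfectField F] (K : IntermediateField (RatFunc F) E)
    [FiniteDimensional (RatFunc F) K]
    (hconst : ∀ x ∈ K, IsAlgebraic F x → x ∈ (algebraMap F E).range)
    (hKL : K ≤ geometricField F k E) : K ≤ ⊥ := by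
  classical
  obtain ⟨T, hT, hKT⟩ : ∃ T : Finset E, (T : Set E) ⊆ Set.range (algebraMap k E) ∧
      K ≤ IntermediateField.adjoin (RatFunc F) (T : Set E) := by
    have hb := fun i => IntermediateField.exists_finset_of_mem_adjoin
      (hKL (Module.finBasis (RatFunc F) K i).2)
    choose T hT hmem using hb
    refine ⟨Finset.univ.biUnion T, by simpa using hT, fun x hx => ?_⟩
    have hx' := congrArg (Subtype.val) ((Module.finBasis (RatFunc F) K).sum_repr ⟨x, hx⟩)
    change _ = x at hx'
    rw [← hx', IntermediateField.coe_sum]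
    refine sum_mem fun i _ => ?_
    rw [IntermediateField.coe_smul]
    exact IntermediateField.smul_mem _ (IntermediateField.adjoin.mono _ _ _
      (by exact_mod_cast Finset.subset_biUnion_of_mem T (Finset.mem_univ i)) (hmem i))
  have hTalg : ∀ x ∈ T, IsAlgebraic F x := by
    intro x hx
    obtain ⟨c, rfl⟩ := hT hx
    exact (Algebra.IsAlgebraic.isAlgebraic c).algebraMap
  have hTsep : ∀ x ∈ T, IsSeparable F x := fun x hx =>
    PerfectField.separable_of_irreducible (minpoly.irreducible (hTalg x hx).isIntegral)
  have : IsScalarTower F K E := IsScalarTower.of_algebraMap_eq fun x => rfl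
  set E₁ := IntermediateField.adjoin K (T : Set E) with hE₁
  have hfin : FiniteDimensional K E₁ := by
    refine IntermediateField.finiteDimensional_adjoin fun x hx => ?_
    exact (hTalg x hx).isIntegral.tower_top
  have hsep : Algebra.IsSeparable K E₁ :=
    (IntermediateField.isSeparable_adjoin_iff_isSeparable K E).2 fun x hx =>
      (hTsep x hx).tower_top K
  have hE₁mem : ∀ z ∈ E₁, z ∈ IntermediateField.adjoin (RatFunc F) (T : Set E) := by
    intro z hz
    induction hz using IntermediateField.adjoin_induction with
    | mem x hx => exact IntermediateField.subset_adjoin _ _ hx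
    | algebraMap a => exact hKT a.2
    | add x y _ _ hx hy => exact add_mem hx hy
    | inv x _ hx => exact inv_mem hx
    | mul x y _ _ hx hy => exact mul_mem hx hy
  have hclosure : ∀ z ∈ Submonoid.closure (T : Set E), ∃ hz : z ∈ E₁, IsIntegral F z := by
    intro z hz
    induction hz using Submonoid.closure_induction with
    | mem x hx => exact ⟨IntermediateField.subset_adjoin _ _ hx, (hTalg x hx).isIntegral⟩
    | one => exact ⟨one_mem _, isIntegral_one⟩
    | mul x y _ _ hx hy => exact ⟨mul_mem hx.1 hy.1, hx.2.mul hy.2⟩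
  -- The trace to K of a product of constants is algebraic over F, hence in F by `hconst`. By
  -- linearity all traces lie in F(t), while the trace of the separable extension E₁/K is onto K.
  have htrace : ∀ z ∈ Submodule.span (RatFunc F) (Submonoid.closure (T : Set E) : Set E),
      ∃ hz : z ∈ E₁, ((Algebra.trace K E₁ ⟨z, hz⟩ : K) : E) ∈
        (⊥ : IntermediateField (RatFunc F) E) := by
    intro z hz
    induction hz using Submodule.span_induction with
    | mem x hx =>
      obtain ⟨hx1, hx2⟩ := hclosure x hx
      refine ⟨hx1, ?_⟩
      have h1 : IsIntegral F (⟨x, hx1⟩ : E₁) :=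
        (isIntegral_algHom_iff (E₁.val.restrictScalars F) E₁.val.injective).1 hx2
      have h2 : IsIntegral F (Algebra.trace K E₁ ⟨x, hx1⟩) := Algebra.isIntegral_trace h1
      obtain ⟨c, hc⟩ := hconst _ (Algebra.trace K E₁ ⟨x, hx1⟩).2
        ((isIntegral_algHom_iff (K.val.restrictScalars F) K.val.injective).2 h2).isAlgebraic
      rw [← hc, IsScalarTower.algebraMap_apply F (RatFunc F) E]
      exact IntermediateField.algebraMap_mem _ _
    | zero =>
      refine ⟨zero_mem _, ?_⟩
      have : (⟨0, zero_mem _⟩ : E₁) = 0 := rfl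
      rw [this, map_zero]
      exact zero_mem _
    | add x y _ _ hx hy =>
      obtain ⟨hx1, hx2⟩ := hx
      obtain ⟨hy1, hy2⟩ := hy
      refine ⟨add_mem hx1 hy1, ?_⟩
      have : (⟨x + y, add_mem hx1 hy1⟩ : E₁) = ⟨x, hx1⟩ + ⟨y, hy1⟩ := rfl
      rw [this, map_add]
      exact add_mem hx2 hy2
    | smul a x _ hx =>
      obtain ⟨hx1, hx2⟩ := hx
      have hmem : a • x ∈ E₁ := by
        rw [Algebra.smul_def]
        exact mul_mem (E₁.algebraMap_mem (algebraMap (RatFunc F) K a)) hx1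
      refine ⟨hmem, ?_⟩
      have : (⟨a • x, hmem⟩ : E₁) = (algebraMap (RatFunc F) K a) • ⟨x, hx1⟩ := by
        ext
        simp only [Algebra.smul_def]
        rfl
      rw [this, map_smul, smul_eq_mul]
      exact mul_mem (IntermediateField.algebraMap_mem _ a) hx2
  intro x hx
  obtain ⟨z, hz⟩ := Algebra.trace_surjective K E₁ ⟨x, hx⟩
  have hz1 := hE₁mem z z.2
  rw [← IntermediateField.mem_toSubalgebra,
    IntermediateField.adjoin_toSubalgebra_of_isAlgebraic
      (fun x _ => Algebra.IsAlgebraic.isAlgebraic x),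
    ← Subalgebra.mem_toSubmodule, Algebra.adjoin_eq_span] at hz1
  obtain ⟨hz2, hz3⟩ := htrace z hz1
  rw [show (⟨z, hz2⟩ : E₁) = z from rfl, hz] at hz3
  exact hz3

end Constants

/-! ### Primitive elements and degrees -/

section PrimitiveElements

variable {A E : Type*} [Field A] [Field E] [Algebra A E]

lemma exists_eq_adjoin_singleton (K : IntermediateField A E) [FiniteDimensional A K]
    [Algebra.IsSeparable A K] : ∃ α : E, K = IntermediateField.adjoin A {α} := by
  obtain ⟨α, hα⟩ := Field.exists_primitive_element A K
  have h1 := congrArg (IntermediateField.map K.val) hα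
  rw [IntermediateField.adjoin_map, Set.image_singleton, ← AlgHom.fieldRange_eq_map,
    IntermediateField.fieldRange_val] at h1
  exact ⟨α, h1.symm⟩

lemma natDegree_minpoly_kummer {L : IntermediateField A E} {ℓ : ℕ} (hp : ℓ.Prime) {Y : E}
    (hY : Y ^ ℓ ∈ L) (hnot : ∀ u ∈ L, u ^ ℓ ≠ Y ^ ℓ) : (minpoly L Y).natDegree = ℓ := by
  have hirr : Irreducible (X ^ ℓ - C (⟨Y ^ ℓ, hY⟩ : L)) :=
    X_pow_sub_C_irreducible_of_prime hp fun b hb => hnot b b.2 (congrArg Subtype.val hb)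
  rw [← minpoly.eq_of_irreducible_of_monic hirr ?_ (monic_X_pow_sub_C _ hp.ne_zero),
    natDegree_X_pow_sub_C]
  rw [map_sub, map_pow, aeval_X, aeval_C]
  exact sub_self _

/-- The degree of z cannot grow when the base is enlarged from A to L, and over L it is the degree ℓ
of the Kummer generator. -/
lemma le_natDegree_minpoly_of_adjoin_eq [Algebra.IsAlgebraic A E] {L : IntermediateField A E}
    {ℓ : ℕ} (hp : ℓ.Prime) {z Y : E}
    (hadj : IntermediateField.adjoin L {z} = IntermediateField.adjoin L {Y})
    (hY : Y ^ ℓ ∈ L) (hnot : ∀ u ∈ L, u ^ ℓ ≠ Y ^ ℓ) : ℓ ≤ (minpoly A z).natDegree := by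
  have hint : ∀ x : E, IsIntegral A x := fun x => Algebra.IsIntegral.isIntegral x
  have h1 : (minpoly L z).natDegree = ℓ := by
    rw [← IntermediateField.adjoin.finrank (hint z).tower_top, hadj,
      IntermediateField.adjoin.finrank (hint Y).tower_top, natDegree_minpoly_kummer hp hY hnot]
  rw [← h1, ← natDegree_map (p := minpoly A z) (algebraMap A L)]
  exact natDegree_le_of_dvd (minpoly.dvd_map_of_isScalarTower _ _ _)
    ((minpoly.monic (hint z)).map _).ne_zero

end PrimitiveElements

/-! ### Pulling back covers along t ↦ a/b -/

section Substitution

variable {F : Type*} [Field F] [Fintype F]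
  {k : Type*} [Field k] [Algebra F k] [Algebra.IsAlgebraic F k] [IsAlgClosed k]
  {E : Type*} [Field E] [Algebra F E] [Algebra (RatFunc F) E] [Algebra k E]
  [IsScalarTower F (RatFunc F) E] [IsScalarTower F k E]
  [IsAlgClosed E] [Algebra.IsAlgebraic (RatFunc F) E]

variable (F k) in
/-- An endomorphism of `E` over `k` that maps `t` to `a / b`. -/
structure IsSubstitution (Φ : E →+* E) (v : F[X] × F[X]) : Prop where
  map_const : ∀ c : k, Φ (algebraMap k E c) = algebraMap k E c
  map_gen : Φ (algebraMap (RatFunc F) E RatFunc.X) =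
    polyEval F k E (form (some 0) v) / polyEval F k E (form none v)

lemma exists_isSubstitution {e : ℕ} {v : F[X] × F[X]} (hv : v ∈ monicPairs F e) :
    ∃ Φ : E →+* E, IsSubstitution F k Φ v := by
  have hb := polyEval_ne_zero (F := F) (E := E) (form_monic (k := k) hv none).1.ne_zero
  set h := polyEval F k E (form (some 0) v) / polyEval F k E (form none v) with hh
  -- Were a/b a constant β, the form a − βb would vanish, but it is monic.
  have htr : Transcendental k h := by
    intro halg
    obtain ⟨β, hβ⟩ := mem_range_of_isAlgebraic halg
    refine polyEval_ne_zero (F := F) (E := E) (form_monic (k := k) hv (some β)).1.ne_zero ?_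
    have h1 : form (some β) v = form (some 0) v - C β * form none v := by simp [form]
    rw [h1, map_sub, map_mul, polyEval_C, hβ, hh, div_mul_cancel₀ _ hb, sub_self]
  have halg : ∀ s : E, ∃ p : (k[X])[X], p ≠ 0 ∧ eval₂ (polyEval F k E).toRingHom s p = 0 := by
    intro s
    let : Algebra F[X] E := ((algebraMap (RatFunc F) E).comp (algebraMap F[X] (RatFunc F))).toAlgebra
    have : IsScalarTower F[X] (RatFunc F) E := IsScalarTower.of_algebraMap_eq fun x => rfl
    obtain ⟨p, hp, hps⟩ := (IsFractionRing.isAlgebraic_iff F[X] (RatFunc F) E).2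
      (Algebra.IsAlgebraic.isAlgebraic (R := RatFunc F) s)
    refine ⟨p.map (mapRingHom (algebraMap F k)),
      (Polynomial.map_ne_zero_iff (map_injective _ (algebraMap F k).injective)).2 hp, ?_⟩
    rw [eval₂_map, ← hps, aeval_def]
    congr 1
    exact RingHom.ext fun x => polyEval_map x
  obtain ⟨Φ, hΦ⟩ := exists_ringHom_extension (polyEval F k E).toRingHom (aeval h).toRingHom
    polyEval_injective (transcendental_iff_injective.1 htr) halg
  refine ⟨Φ, fun c => ?_, ?_⟩
  · have := hΦ (C c)
    simpa [polyEval_C] using this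
  · have := hΦ X
    simpa [polyEval_X] using this

namespace IsSubstitution

variable {Φ : E →+* E} {v : F[X] × F[X]} {e : ℕ}

lemma map_polyEval_X_sub_C (h : IsSubstitution F k Φ v) (hv : v ∈ monicPairs F e) (β : k) :
    Φ (polyEval F k E (X - C β)) =
      polyEval F k E (form (some β) v) / polyEval F k E (form none v) := by
  have hb := polyEval_ne_zero (F := F) (E := E) (form_monic (k := k) hv none).1.ne_zero
  have h1 : form (some β) v = form (some 0) v - C β * form none v := by simp [form]
  rw [map_sub, map_sub, polyEval_X, polyEval_C, h.map_const, h.map_gen, h1, map_sub, map_mul,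
    polyEval_C, sub_div, mul_div_cancel_right₀ _ hb]

lemma map_mem_geometricField (h : IsSubstitution F k Φ v) {x : E}
    (hx : x ∈ geometricField F k E) : Φ x ∈ geometricField F k E := by
  have hpoly : ∀ p : k[X], Φ (polyEval F k E p) ∈ geometricField F k E := by
    intro p
    rw [polyEval, aeval_def, hom_eval₂, eval₂_eq_sum_range]
    refine sum_mem fun i _ => mul_mem ?_ (pow_mem ?_ _)
    · rw [RingHom.comp_apply, h.map_const]
      exact algebraMap_mem_geometricField _
    · rw [h.map_gen]
      exact div_mem (polyEval_mem _) (polyEval_mem _)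
  obtain ⟨p, q, -, rfl⟩ := mem_geometricField.1 hx
  rw [map_div₀]
  exact div_mem (hpoly p) (hpoly q)

lemma map_algebraMap (h : IsSubstitution F k Φ v) (c : F) :
    Φ (algebraMap F E c) = algebraMap F E c := by
  rw [IsScalarTower.algebraMap_apply F k E, h.map_const]

lemma map_mem_range (h : IsSubstitution F k Φ v) (r : RatFunc F) :
    Φ (algebraMap (RatFunc F) E r) ∈ (algebraMap (RatFunc F) E).range := by
  have hpoly : ∀ p : F[X], Φ (algebraMap (RatFunc F) E (algebraMap F[X] (RatFunc F) p)) ∈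
      (algebraMap (RatFunc F) E).range := by
    intro p
    rw [← polyEval_map (k := k), polyEval, aeval_map_algebraMap, aeval_def, hom_eval₂,
      eval₂_eq_sum_range]
    refine sum_mem fun i _ => mul_mem ?_ (pow_mem ?_ _)
    · rw [RingHom.comp_apply, h.map_algebraMap, IsScalarTower.algebraMap_apply F (RatFunc F) E]
      exact ⟨_, rfl⟩
    · have h0 : form (some (0 : k)) v = v.1.map (algebraMap F k) := by simp [form]
      rw [h.map_gen, h0, form, polyEval_map, polyEval_map, ← map_div₀]
      exact ⟨_, rfl⟩
  rw [← RatFunc.num_div_denom r, map_div₀, map_div₀]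
  obtain ⟨x, hx⟩ := hpoly r.num
  obtain ⟨y, hy⟩ := hpoly r.denom
  exact ⟨x / y, by rw [map_div₀, hx, hy]⟩

lemma exists_ringHom (h : IsSubstitution F k Φ v) : ∃ φ : RatFunc F →+* RatFunc F,
    ∀ r, algebraMap (RatFunc F) E (φ r) = Φ (algebraMap (RatFunc F) E r) := by
  choose φ hφ using h.map_mem_range
  have hinj := (algebraMap (RatFunc F) E).injective
  exact ⟨{ toFun := φ
           map_one' := hinj (by simp [hφ])
           map_mul' := fun x y => hinj (by simp [hφ])
           map_zero' := hinj (by simp [hφ])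
           map_add' := fun x y => hinj (by simp [hφ]) }, hφ⟩

end IsSubstitution

/-- The pullback of the field `K₀` along a substitution. -/
noncomputable def pullback (K₀ : IntermediateField (RatFunc F) E) (Φ : E →+* E) :
    IntermediateField (RatFunc F) E :=
  IntermediateField.adjoin (RatFunc F) (Φ '' K₀)

lemma nonempty_algHom_pullback (K₀ : IntermediateField (RatFunc F) E) {Φ : E →+* E}
    {v : F[X] × F[X]} (h : IsSubstitution F k Φ v) :
    Nonempty (K₀ →ₐ[F] pullback K₀ Φ) :=
  ⟨{ toFun := fun x => ⟨Φ x, IntermediateField.subset_adjoin _ _ ⟨x, x.2, rfl⟩⟩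
     map_one' := by ext; exact map_one Φ
     map_mul' := fun x y => by ext; exact map_mul Φ _ _
     map_zero' := by ext; exact map_zero Φ
     map_add' := fun x y => by ext; exact map_add Φ _ _
     commutes' := fun c => by ext; exact h.map_algebraMap c }⟩

/-- Each Φ x is a root of the minimal polynomial of x with substituted coefficients. That polynomial
stays separable, and all its roots lie in Φ(K₀) because the original splits in K₀; so conjugation
preserves the generating set. -/
lemma isGalois_pullback (K₀ : IntermediateField (RatFunc F) E) [IsGalois (RatFunc F) K₀]
    {Φ : E →+* E} {v : F[X] × F[X]} (h : IsSubstitution F k Φ v) :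
    IsGalois (RatFunc F) (pullback K₀ Φ) := by
  obtain ⟨φ, hφ⟩ := h.exists_ringHom
  have hcomp : (algebraMap (RatFunc F) E).comp φ = Φ.comp (algebraMap (RatFunc F) E) :=
    RingHom.ext hφ
  have hroot : ∀ x ∈ K₀, aeval (Φ x) ((minpoly (RatFunc F) x).map φ) = 0 := by
    intro x hx
    rw [aeval_def, eval₂_map, hcomp, ← hom_eval₂, ← aeval_def, minpoly.aeval, map_zero]
  have hsep : Algebra.IsSeparable (RatFunc F) (pullback K₀ Φ) := by
    refine (IntermediateField.isSeparable_adjoin_iff_isSeparable _ _).2 ?_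
    rintro _ ⟨x, hx, rfl⟩
    exact (Polynomial.Separable.map (isSeparable_of_mem K₀ hx)).of_dvd
      (minpoly.dvd _ _ (hroot x hx))
  have hnormal : Normal (RatFunc F) (pullback K₀ Φ) := by
    have : IsAlgClosure (RatFunc F) E := ⟨inferInstance, inferInstance⟩
    have : Normal (RatFunc F) E := IsAlgClosure.normal _ _
    rw [IntermediateField.normal_iff_forall_map_le']
    intro σ
    rw [pullback, IntermediateField.adjoin_map, IntermediateField.adjoin_le_iff]
    rintro _ ⟨_, ⟨x, hx, rfl⟩, rfl⟩
    refine IntermediateField.subset_adjoin _ _ ?_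
    have hspl : ((minpoly (RatFunc F) (⟨x, hx⟩ : K₀)).map (algebraMap (RatFunc F) K₀)).Splits :=
      Normal.splits inferInstance _
    rw [IntermediateField.minpoly_eq] at hspl
    obtain ⟨y, hy⟩ := hspl.mem_range_of_isRoot
      ((minpoly.monic (Algebra.IsIntegral.isIntegral x)).map _).ne_zero
      (i := Φ.comp K₀.val.toRingHom) (x := σ (Φ x)) (by
        have h1 : (Φ.comp K₀.val.toRingHom).comp (algebraMap (RatFunc F) K₀) =
            (algebraMap (RatFunc F) E).comp φ := hcomp.symm
        rw [Polynomial.map_map, h1, ← Polynomial.map_map, IsRoot, eval_map_algebraMap]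
        exact (aeval_algHom_apply σ (Φ x) _).trans (by rw [hroot x hx, map_zero]))
    exact ⟨y, y.2, hy⟩
  exact ⟨⟩

section Kummer

variable {ℓ : ℕ} {K₀ : IntermediateField (RatFunc F) E} {Y : E} {f : k[X]}

open Classical in
variable (ℓ) in
/-- The Kummer polynomial of the pullback along `a / b` of the cover with Kummer polynomial `f`. -/
noncomputable def kummerForm (f : k[X]) (v : F[X] × F[X]) : k[X] :=
  (∏ β ∈ f.roots.toFinset, form (some β) v ^ rootMultiplicity β f) *
    form none v ^ ((ℓ - 1) * f.natDegree)

lemma sum_rootMultiplicity_eq_natDegree [DecidableEq k] (f : k[X]) :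
    ∑ β ∈ f.roots.toFinset, rootMultiplicity β f = f.natDegree := by
  simp_rw [← count_roots]
  rw [Multiset.toFinset_sum_count_eq, ← (IsAlgClosed.splits f).natDegree_eq_card_roots]

lemma kummerForm_monic {e : ℕ} {v : F[X] × F[X]} (hv : v ∈ monicPairs F e) (f : k[X]) :
    (kummerForm ℓ f v).Monic :=
  (monic_prod_of_monic _ _ fun β _ => (form_monic hv (some β)).1.pow _).mul
    ((form_monic hv none).1.pow _)

/-- Only the class modulo ℓ matters: it is that of deg f, as it should be since a/b sends ∞ to ∞
with multiplicity one. -/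
lemma natDegree_kummerForm {e : ℕ} {v : F[X] × F[X]} (hv : v ∈ monicPairs F e) (hℓ : 0 < ℓ)
    (f : k[X]) : (kummerForm ℓ f v).natDegree = f.natDegree + ℓ * (f.natDegree * e) := by
  classical
  have h1 := monic_prod_of_monic f.roots.toFinset (fun β => form (some β) v ^ rootMultiplicity β f)
    fun β _ => (form_monic hv (some β)).1.pow _
  rw [kummerForm, Monic.natDegree_mul (by convert h1) ((form_monic hv none).1.pow _),
    natDegree_prod_of_monic _ _ fun β _ => (form_monic hv (some β)).1.pow _,
    natDegree_pow, (form_monic (k := k) hv none).2]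
  simp_rw [natDegree_pow, (form_monic (k := k) hv (some _)).2]
  simp only [reduceCtorEq, if_false, if_true]
  obtain ⟨m, rfl⟩ : ∃ m, ℓ = m + 1 := ⟨ℓ - 1, by omega⟩
  rw [← Finset.sum_mul, sum_rootMultiplicity_eq_natDegree, Nat.add_sub_cancel]
  ring

/-- Clearing denominators in f(a/b) takes b^(deg f); using b^(ℓ deg f) instead also changes the
radicand only by an ℓ-th power. This explains the exponent (ℓ − 1) deg f in `kummerForm`. -/
lemma polyEval_kummerForm {e : ℕ} {v : F[X] × F[X]} (hv : v ∈ monicPairs F e) {Φ : E →+* E}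
    (h : IsSubstitution F k Φ v) (hℓ : 0 < ℓ) (hf : f.Monic) :
    polyEval F k E (kummerForm ℓ f v) =
      Φ (polyEval F k E f) * (polyEval F k E (form none v) ^ f.natDegree) ^ ℓ := by
  classical
  have hb := polyEval_ne_zero (F := F) (E := E) (form_monic (k := k) hv none).1.ne_zero
  have h1 : Φ (polyEval F k E f) * polyEval F k E (form none v) ^ f.natDegree =
      ∏ β ∈ f.roots.toFinset, polyEval F k E (form (some β) v) ^ rootMultiplicity β f := by
    rw [← sum_rootMultiplicity_eq_natDegree f, ← Finset.prod_pow_eq_pow_sum,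
      congrArg (fun p => Φ (polyEval F k E p)) hf.eq_prod_roots, map_prod, map_prod,
      ← Finset.prod_mul_distrib]
    refine Finset.prod_congr rfl fun β _ => ?_
    rw [map_pow, map_pow, h.map_polyEval_X_sub_C hv, ← mul_pow, div_mul_cancel₀ _ hb]
  obtain ⟨m, rfl⟩ : ∃ m, ℓ = m + 1 := ⟨ℓ - 1, by omega⟩
  rw [pow_succ', ← mul_assoc, h1, kummerForm, map_mul, map_prod, map_pow, Nat.add_sub_cancel,
    ← pow_mul, mul_comm m]
  simp_rw [map_pow]

lemma IsKummerPolynomial.pullback {e : ℕ} {v : F[X] × F[X]} (hv : v ∈ monicPairs F e)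
    {Φ : E →+* E} (h : IsSubstitution F k Φ v) (hℓ : 0 < ℓ) (hf : IsKummerPolynomial ℓ K₀ Y f) :
    IsKummerPolynomial ℓ (_root_.pullback K₀ Φ)
      (polyEval F k E (form none v) ^ f.natDegree * Φ Y) (kummerForm ℓ f v) := by
  have hb := polyEval_ne_zero (F := F) (E := E) (form_monic (k := k) hv none).1.ne_zero
  refine ⟨kummerForm_monic hv f, ?_, ?_⟩
  · rw [polyEval_kummerForm hv h hℓ hf.monic, mul_pow, ← map_pow Φ, hf.pow_eq, mul_comm]
  · rw [adjoin_singleton_mul_eq (pow_mem (polyEval_mem _) _) (pow_ne_zero _ hb),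
      _root_.pullback, adjoin_coe_adjoin_eq]
    have hL : ∀ a : geometricField F k E, Φ (algebraMap (geometricField F k E) E a) ∈
        (algebraMap (geometricField F k E) E).range := fun a =>
      ⟨⟨_, h.map_mem_geometricField a.2⟩, rfl⟩
    refine le_antisymm ?_ ?_
    · rw [IntermediateField.adjoin_le_iff]
      rintro _ ⟨x, hx, rfl⟩
      have h1 : x ∈ IntermediateField.adjoin (geometricField F k E) {Y} := by
        rw [← hf.adjoin_eq]
        exact IntermediateField.subset_adjoin _ _ hx
      have h2 := map_mem_adjoin_image hL h1
      rwa [Set.image_singleton] at h2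
    · rw [IntermediateField.adjoin_simple_le_iff]
      refine map_mem_adjoin_image hL ?_
      rw [hf.adjoin_eq]
      exact IntermediateField.mem_adjoin_simple_self _ _

lemma IsKummerPolynomial.not_le_geometricField {K : IntermediateField (RatFunc F) E} {g : k[X]}
    (h : IsKummerPolynomial ℓ K Y g) (hg : ∀ u ∈ geometricField F k E, u ^ ℓ ≠ polyEval F k E g) :
    ¬ K ≤ geometricField F k E := by
  intro hK
  have h1 : Y ∈ IntermediateField.adjoin (geometricField F k E) (K : Set E) := by
    rw [h.adjoin_eq]
    exact IntermediateField.mem_adjoin_simple_self _ _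
  have h2 : IntermediateField.adjoin (geometricField F k E) (K : Set E) ≤ ⊥ := by
    rw [IntermediateField.adjoin_le_iff]
    intro x hx
    exact IntermediateField.mem_bot.2 ⟨⟨x, hK hx⟩, rfl⟩
  obtain ⟨y, hy⟩ := IntermediateField.mem_bot.1 (h2 h1)
  exact hg Y (hy ▸ y.2) h.pow_eq

/-- The image of a primitive element of K₀ generates the pullback and has degree at most ℓ. Over
k(t) its degree is already ℓ, since some order of the Kummer polynomial is prime to ℓ. -/
lemma finrank_pullback [IsGalois (RatFunc F) K₀] (hp : ℓ.Prime)
    (hK₀ : Module.finrank (RatFunc F) K₀ = ℓ) {Φ : E →+* E} {v : F[X] × F[X]}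
    (h : IsSubstitution F k Φ v) {Y' : E} {g : k[X]}
    (hg : IsKummerPolynomial ℓ (pullback K₀ Φ) Y' g) (hθ : ∃ θ, ¬ ℓ ∣ rootMultiplicity θ g) :
    Module.finrank (RatFunc F) (pullback K₀ Φ) = ℓ := by
  have : FiniteDimensional (RatFunc F) K₀ := FiniteDimensional.of_finrank_pos (hK₀ ▸ hp.pos)
  obtain ⟨φ, hφ⟩ := h.exists_ringHom
  obtain ⟨α, hK₀α⟩ := exists_eq_adjoin_singleton K₀
  have hpull : pullback K₀ Φ = IntermediateField.adjoin (RatFunc F) {Φ α} := by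
    refine le_antisymm ?_ ?_
    · rw [pullback, IntermediateField.adjoin_le_iff]
      rintro _ ⟨x, hx, rfl⟩
      rw [hK₀α] at hx
      have h2 := map_mem_adjoin_image h.map_mem_range hx
      rwa [Set.image_singleton] at h2
    · rw [IntermediateField.adjoin_simple_le_iff]
      exact IntermediateField.subset_adjoin _ _
        ⟨α, hK₀α ▸ IntermediateField.mem_adjoin_simple_self _ _, rfl⟩
  have hdegα : (minpoly (RatFunc F) α).natDegree = ℓ := by
    rw [← IntermediateField.adjoin.finrank (Algebra.IsIntegral.isIntegral _), ← hK₀α, hK₀]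
  have hroot : aeval (Φ α) ((minpoly (RatFunc F) α).map φ) = 0 := by
    have hcomp : (algebraMap (RatFunc F) E).comp φ = Φ.comp (algebraMap (RatFunc F) E) :=
      RingHom.ext hφ
    rw [aeval_def, eval₂_map, hcomp, ← hom_eval₂, ← aeval_def, minpoly.aeval, map_zero]
  have hadj : IntermediateField.adjoin (geometricField F k E) {Φ α} =
      IntermediateField.adjoin (geometricField F k E) {Y'} := by
    rw [← hg.adjoin_eq, hpull, adjoin_coe_adjoin_eq]
  rw [hpull, IntermediateField.adjoin.finrank (Algebra.IsIntegral.isIntegral _)]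
  refine le_antisymm ?_ ?_
  · rw [← hdegα, ← natDegree_map (p := minpoly (RatFunc F) α) φ]
    exact natDegree_le_of_dvd (minpoly.dvd _ _ hroot)
      ((minpoly.monic (Algebra.IsIntegral.isIntegral _)).map _).ne_zero
  · obtain ⟨θ, hθ⟩ := hθ
    refine le_natDegree_minpoly_of_adjoin_eq (L := geometricField F k E) hp hadj ?_ ?_
    · rw [hg.pow_eq]; exact polyEval_mem _
    · rw [hg.pow_eq]
      exact ne_pow_of_not_dvd_rootMultiplicity hp.ne_zero hg.monic.ne_zero hθ

/-- An extension of prime degree not contained in `k(t)` has no new constants. -/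
lemma mem_range_of_isAlgebraic_of_not_le (hp : ℓ.Prime) {K : IntermediateField (RatFunc F) E}
    (hK : Module.finrank (RatFunc F) K = ℓ) (hKL : ¬ K ≤ geometricField F k E) {x : E}
    (hx : x ∈ K) (hxF : IsAlgebraic F x) : x ∈ (algebraMap F E).range := by
  obtain ⟨c, hc⟩ := mem_range_of_isAlgebraic (k := k) (hxF.tower_top k)
  have := IntermediateField.isSimpleOrder_of_finrank_prime (RatFunc F) K (by rwa [hK])
  rcases eq_bot_or_eq_top (IntermediateField.adjoin (RatFunc F) {(⟨x, hx⟩ : K)}) with h | h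
  · obtain ⟨r, hr⟩ := IntermediateField.mem_bot.1
      (h ▸ IntermediateField.mem_adjoin_simple_self (RatFunc F) (⟨x, hx⟩ : K))
    have hr' : algebraMap (RatFunc F) E r = x := congrArg Subtype.val hr
    rw [← hr']
    exact mem_range_of_algebraMap_eq (hr'.trans hc.symm)
  · refine absurd ?_ hKL
    have h1 := congrArg (IntermediateField.map K.val) h
    rw [IntermediateField.adjoin_map, Set.image_singleton, ← AlgHom.fieldRange_eq_map,
      IntermediateField.fieldRange_val] at h1
    rw [← h1, IntermediateField.adjoin_simple_le_iff]
    exact hc ▸ algebraMap_mem_geometricField c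

end Kummer

end Substitution

/-! ### Orders modulo ℓ on the projective line -/

section LocalOrders

variable {F : Type*} [Field F] [Fintype F]
  {k : Type*} [Field k] [Algebra F k] [Algebra.IsAlgebraic F k] [IsAlgClosed k]

/-- The order modulo `ℓ` of `f` at a point of the projective line. -/
noncomputable def color (ℓ : ℕ) (f : k[X]) (o : Option k) : ZMod ℓ :=
  match o with
  | some β => rootMultiplicity β f
  | none => -(f.natDegree : ZMod ℓ)

open Classical in
/-- The zeros of `f` on the projective line, together with the point at infinity. -/
noncomputable def supportSet (f : k[X]) : Finset (Option k) := f.roots.toFinset.insertNone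

open Classical in
/-- The points at which the order of `f` is not divisible by `ℓ`. -/
noncomputable def branchSet (ℓ : ℕ) (f : k[X]) : Finset (Option k) :=
  (supportSet f).filter fun o => color ℓ f o ≠ 0

/-- The order modulo `ℓ` at `θ` of the pullback of `f` along `a / b`. -/
noncomputable def localOrder (ℓ : ℕ) (f : k[X]) (v : F[X] × F[X]) (θ : k) : ZMod ℓ :=
  ∑ o ∈ supportSet f, color ℓ f o * rootMultiplicity θ (form o v)

/-- A principal divisor on the projective line has degree zero. -/
lemma sum_color (ℓ : ℕ) (f : k[X]) : ∑ o ∈ supportSet f, color ℓ f o = 0 := by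
  classical
  rw [supportSet, Finset.sum_insertNone]
  simp only [color]
  rw [← Nat.cast_sum, sum_rootMultiplicity_eq_natDegree, neg_add_cancel]

lemma mem_branchSet {ℓ : ℕ} {f : k[X]} {o : Option k} : o ∈ branchSet ℓ f ↔ color ℓ f o ≠ 0 := by
  classical
  rw [branchSet, Finset.mem_filter, and_iff_right_iff_imp]
  intro h
  match o with
  | none => simp [supportSet]
  | some β =>
    simp only [supportSet, Finset.some_mem_insertNone, Multiset.mem_toFinset]
    rw [← Multiset.count_pos, count_roots, Nat.pos_iff_ne_zero]
    intro h0
    simp [color, h0] at h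

lemma sum_branchSet_color (ℓ : ℕ) (f : k[X]) : ∑ o ∈ branchSet ℓ f, color ℓ f o = 0 := by
  classical
  rw [branchSet, Finset.sum_filter_ne_zero, sum_color]

/-- This links Kummer theory to the counting. At a simple root of one form that is not a common zero
of a and b, no other form vanishes, so a single term of the local order survives. -/
lemma isLocalInvariant_localOrder (ℓ : ℕ) (f : k[X]) :
    IsLocalInvariant ℓ (branchSet ℓ f) (color ℓ f) (localOrder (F := F) ℓ f) := by
  classical
  refine ⟨fun o ho => mem_branchSet.1 ho, sum_branchSet_color ℓ f, ?_, ?_⟩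
  · intro v θ h
    obtain ⟨o, -, ho⟩ := Finset.exists_ne_zero_of_sum_ne_zero h
    refine ⟨o, mem_branchSet.2 (left_ne_zero_of_mul ho), ?_⟩
    by_contra hcon
    rw [rootMultiplicity_eq_zero hcon] at ho
    simp at ho
  · intro v θ o ho h1 hnot
    have hroot : (form o v).eval θ = 0 := by
      by_contra hcon
      rw [rootMultiplicity_eq_zero hcon] at h1
      omega
    rw [localOrder, Finset.sum_eq_single_of_mem o (Finset.mem_filter.1 ho).1, h1, Nat.cast_one,
      mul_one]
    intro o' _ hne
    have : ¬ IsRoot (form o' v) θ := fun h' => hnot (aeval_eq_zero_of_forms hne h' hroot)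
    rw [rootMultiplicity_eq_zero this, Nat.cast_zero, mul_zero]

/-- A single nonzero order cannot sum to zero. -/
lemma two_le_card_branchSet {ℓ : ℕ} {f : k[X]} (hf : ∃ θ, ¬ ℓ ∣ rootMultiplicity θ f) :
    2 ≤ (branchSet ℓ f).card := by
  classical
  obtain ⟨θ, hθ⟩ := hf
  have hmem : some θ ∈ branchSet ℓ f :=
    mem_branchSet.2 fun h => hθ ((ZMod.natCast_eq_zero_iff _ _).1 h)
  by_contra hlt
  obtain ⟨o, ho⟩ := Finset.card_eq_one.1 (show (branchSet ℓ f).card = 1 by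
    have := Finset.card_pos.2 ⟨_, hmem⟩; omega)
  have hsum := sum_branchSet_color ℓ f
  rw [ho, Finset.sum_singleton] at hsum
  exact mem_branchSet.1 (ho ▸ Finset.mem_singleton_self o) hsum

lemma rootMultiplicity_prod_eq {ι : Type*} (s : Finset ι) (p : ι → k[X])
    (hp : ∀ i ∈ s, p i ≠ 0) (θ : k) :
    rootMultiplicity θ (∏ i ∈ s, p i) = ∑ i ∈ s, rootMultiplicity θ (p i) := by
  classical
  rw [← count_roots, roots_prod _ _ (Finset.prod_ne_zero_iff.2 hp), Multiset.count_bind]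
  simp_rw [count_roots]
  rfl

/-- Modulo ℓ the exponent (ℓ − 1) deg f of b is −deg f, the order of f at ∞. -/
lemma rootMultiplicity_kummerForm {ℓ e : ℕ} (hℓ : 0 < ℓ) (f : k[X]) {v : F[X] × F[X]}
    (hv : v ∈ monicPairs F e) (θ : k) :
    (rootMultiplicity θ (kummerForm ℓ f v) : ZMod ℓ) = localOrder ℓ f v θ := by
  classical
  have hmul : rootMultiplicity θ (kummerForm ℓ f v) =
      (∑ β ∈ f.roots.toFinset, rootMultiplicity β f * rootMultiplicity θ (form (some β) v)) +
        (ℓ - 1) * f.natDegree * rootMultiplicity θ (form none v) := by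
    have hne : ∀ β ∈ f.roots.toFinset, form (some β) v ^ rootMultiplicity β f ≠ 0 :=
      fun β _ => pow_ne_zero _ (form_monic hv (some β)).1.ne_zero
    rw [kummerForm, rootMultiplicity_mul (mul_ne_zero (Finset.prod_ne_zero_iff.2 hne)
      (pow_ne_zero _ (form_monic hv none).1.ne_zero)), rootMultiplicity_prod_eq _ _ hne,
      rootMultiplicity_pow_eq]
    simp_rw [rootMultiplicity_pow_eq]
  rw [hmul, localOrder, supportSet, Finset.sum_insertNone]
  simp only [color]
  push_cast [Nat.cast_sub (show 1 ≤ ℓ from hℓ)]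
  rw [CharP.cast_eq_zero (ZMod ℓ) ℓ]
  ring

end LocalOrders

/-! ### Extending and restricting valuation rings -/

section ValuationRings

lemma ValuationSubring.valuation_le_iff_of_comap_eq {K E Γ : Type*} [Field K] [Field E]
    [LinearOrderedCommGroupWithZero Γ] {f : K →+* E} {W : ValuationSubring E} {v : Valuation K Γ}
    (h : W.comap f = v.valuationSubring) (x y : K) :
    W.valuation (f x) ≤ W.valuation (f y) ↔ v x ≤ v y := by
  by_cases hy : y = 0
  · rw [hy, map_zero, map_zero, map_zero, le_zero_iff, le_zero_iff, map_eq_zero, map_eq_zero,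
      map_eq_zero]
  · have h1 : 0 < W.valuation (f y) :=
      zero_lt_iff.2 ((Valuation.ne_zero_iff _).2 ((_root_.map_ne_zero f).2 hy))
    have h2 : 0 < v y := zero_lt_iff.2 ((Valuation.ne_zero_iff _).2 hy)
    rw [← div_le_one₀ h1, ← div_le_one₀ h2, ← map_div₀, ← map_div₀, ← map_div₀,
      W.valuation_le_one_iff, ← ValuationSubring.mem_comap, h, Valuation.mem_valuationSubring_iff]

lemma ValuationSubring.valuation_lt_one_iff_of_comap_eq {K E Γ : Type*} [Field K] [Field E]
    [LinearOrderedCommGroupWithZero Γ] {f : K →+* E} {W : ValuationSubring E} {v : Valuation K Γ}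
    (h : W.comap f = v.valuationSubring) (x : K) : W.valuation (f x) < 1 ↔ v x < 1 := by
  have := ValuationSubring.valuation_le_iff_of_comap_eq h 1 x
  rw [map_one, map_one, map_one] at this
  rw [← not_le, this, not_le]

/-- Take a valuation ring of E dominating the image of W₀. If f x lies in it while x⁻¹ ∈ W₀, then f
x⁻¹ is a unit there, and locality makes x⁻¹ a unit of W₀. -/
lemma ValuationSubring.exists_comap_eq {K E : Type*} [Field K] [Field E] (f : K →+* E)
    (W₀ : ValuationSubring K) : ∃ W : ValuationSubring E, W.comap f = W₀ := by
  obtain ⟨W, hW, hloc⟩ := IsLocalRing.exists_factor_valuationRing (f.comp W₀.subtype)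
  refine ⟨W, le_antisymm ?_ fun x hx => hW ⟨x, hx⟩⟩
  intro x hx
  rcases W₀.mem_or_inv_mem x with h | h
  · exact h
  by_cases hx0 : x = 0
  · rw [hx0]; exact zero_mem _
  have h1 : IsUnit ((f.comp W₀.subtype).codRestrict W.toSubring hW ⟨x⁻¹, h⟩) := by
    refine IsUnit.of_mul_eq_one (⟨f x, hx⟩ : W.toSubring) ?_
    ext
    change f x⁻¹ * f x = 1
    rw [← map_mul, inv_mul_cancel₀ hx0, map_one]
  obtain ⟨u, hu⟩ := hloc.map_nonunit _ h1
  have h2 : ((↑u⁻¹ : W₀) : K) * x⁻¹ = 1 := by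
    have := congrArg Subtype.val u.inv_mul
    rw [hu] at this
    exact this
  rw [mul_inv_eq_one₀ hx0] at h2
  exact h2 ▸ (↑u⁻¹ : W₀).2

/-- Ramification in an intermediate field, read off from the valuation rings of the big field. -/
lemma isRamifiedIn_iff {A E Γ : Type*} [Field A] [Field E] [Algebra A E]
    [LinearOrderedCommGroupWithZero Γ] (v : Valuation A Γ) (K : IntermediateField A E) :
    IsRamifiedIn v K ↔ ∃ W : ValuationSubring E, W.comap (algebraMap A E) = v.valuationSubring ∧
      ∃ y ∈ K, ∀ x : A, W.valuation (algebraMap A E x) ≠ W.valuation y := by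
  have key : ∀ (W : ValuationSubring E) (x y : K),
      (W.comap (algebraMap K E)).valuation x = (W.comap (algebraMap K E)).valuation y ↔
        W.valuation x = W.valuation y := by
    intro W x y
    have h : W.comap (algebraMap K E) = (W.comap (algebraMap K E)).valuation.valuationSubring :=
      (ValuationSubring.valuationSubring_valuation _).symm
    rw [le_antisymm_iff, le_antisymm_iff (a := W.valuation _),
      ← ValuationSubring.valuation_le_iff_of_comap_eq h,
      ← ValuationSubring.valuation_le_iff_of_comap_eq h]
    rfl
  constructor
  · rintro ⟨W₀, hW₀, y, hy⟩
    obtain ⟨W, rfl⟩ := ValuationSubring.exists_comap_eq (algebraMap K E) W₀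
    refine ⟨W, ?_, y, y.2, fun x hx => hy x ?_⟩
    · rw [← hW₀, ValuationSubring.comap_comap]
      rfl
    · rw [key]
      exact hx
  · rintro ⟨W, hW, y, hyK, hy⟩
    refine ⟨W.comap (algebraMap K E), ?_, ⟨y, hyK⟩, fun x hx => hy x ?_⟩
    · rw [← hW, ValuationSubring.comap_comap]
      rfl
    · rw [key] at hx
      exact hx

end ValuationRings

/-! ### Valuations of constants and of polynomials in a local coordinate -/

section Constants

variable {k : Type*} [Field k] {E : Type*} [Field E] [Algebra k E]

/-- A nonzero element algebraic over a finite field is a root of unity, so every valuation takes the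
value 1 on it. -/
lemma valuation_const (F : Type*) [Field F] [Fintype F] [Algebra F k]
    [Algebra.IsAlgebraic F k] (W : ValuationSubring E) {c : k} (hc : c ≠ 0) :
    W.valuation (algebraMap k E c) = 1 := by
  have hint : IsIntegral F c := Algebra.IsIntegral.isIntegral c
  have : FiniteDimensional F (IntermediateField.adjoin F {c}) :=
    IntermediateField.adjoin.finiteDimensional hint
  have : Finite (IntermediateField.adjoin F {c}) := Module.finite_of_finite F
  have := Fintype.ofFinite (IntermediateField.adjoin F {c})
  have h1 := congrArg (algebraMap _ k) (FiniteField.pow_card_sub_one_eq_one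
    (IntermediateField.AdjoinSimple.gen F c) (fun h => hc (congrArg Subtype.val h)))
  rw [map_pow, IntermediateField.AdjoinSimple.algebraMap_gen, map_one] at h1
  have h2 : W.valuation (algebraMap k E c) ^
      (Fintype.card (IntermediateField.adjoin F {c}) - 1) = 1 := by
    rw [← map_pow, ← map_pow, h1, map_one, map_one]
  refine (pow_eq_one_iff_of_nonneg zero_le ?_).1 h2
  have := Fintype.one_lt_card (α := IntermediateField.adjoin F {c})
  omega

lemma algebraMap_mem_valuationSubring (F : Type*) [Field F] [Fintype F] [Algebra F k]
    [Algebra.IsAlgebraic F k] (W : ValuationSubring E) (c : k) :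
    algebraMap k E c ∈ W := by
  by_cases hc : c = 0
  · rw [hc, map_zero]; exact zero_mem _
  · exact (W.valuation_le_one_iff _).1 (valuation_const F W hc).le

/-- A polynomial in an element of positive valuation is congruent to its constant coefficient. -/
lemma valuation_aeval_sub_lt_one (F : Type*) [Field F] [Fintype F] [Algebra F k]
    [Algebra.IsAlgebraic F k] (W : ValuationSubring E) {s : E} (hs : W.valuation s < 1)
    (q : k[X]) : W.valuation (aeval s q - algebraMap k E (q.coeff 0)) < 1 := by
  have h1 : aeval s q - algebraMap k E (q.coeff 0) = aeval s q.divX * s := by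
    conv_lhs => rw [← divX_mul_X_add q]
    simp
  have h2 : aeval s q.divX ∈ W := by
    rw [aeval_def, eval₂_eq_sum_range]
    exact sum_mem fun i _ => mul_mem (algebraMap_mem_valuationSubring F W _)
      (pow_mem ((W.valuation_le_one_iff _).1 hs.le) _)
  rw [h1, map_mul]
  exact mul_lt_of_le_one_of_lt ((W.valuation_le_one_iff _).2 h2) hs

lemma valuation_aeval_eq_one (F : Type*) [Field F] [Fintype F] [Algebra F k]
    [Algebra.IsAlgebraic F k] (W : ValuationSubring E) {s : E} (hs : W.valuation s < 1) {q : k[X]}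
    (hq : q.coeff 0 ≠ 0) : W.valuation (aeval s q) = 1 := by
  have h1 := valuation_aeval_sub_lt_one F W hs q
  rw [← valuation_const F W hq] at h1 ⊢
  have := Valuation.map_add_eq_of_lt_left W.valuation h1
  rwa [add_sub_cancel] at this

end Constants

/-! ### Local coordinates at finite points and at infinity -/

section Ramification

variable {F : Type*} [Field F] [Fintype F]
  {k : Type*} [Field k] [Algebra F k] [Algebra.IsAlgebraic F k]
  {E : Type*} [Field E] [Algebra F E] [Algebra (RatFunc F) E] [Algebra k E]
  [IsScalarTower F (RatFunc F) E] [IsScalarTower F k E]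

/-- `s` is a coordinate of `k(t)`, positive on `W`, in terms of which `p ≠ 0` has order `n p`. -/
structure IsLocalCoordinate (W : ValuationSubring E) (s : E) (n : k[X] → ℤ) : Prop where
  mem : s ∈ geometricField F k E
  ne_zero : s ≠ 0
  lt_one : W.valuation s < 1
  exists_eq : ∀ p : k[X], p ≠ 0 → ∃ q : k[X], q.coeff 0 ≠ 0 ∧
    polyEval F k E p = aeval s q * s ^ n p

namespace IsLocalCoordinate

variable {W : ValuationSubring E} {s : E} {n : k[X] → ℤ}

lemma valuation_polyEval (h : IsLocalCoordinate (F := F) (k := k) W s n) {p : k[X]} (hp : p ≠ 0) :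
    W.valuation (polyEval F k E p) = W.valuation s ^ n p := by
  obtain ⟨q, hq, hpq⟩ := h.exists_eq p hp
  rw [hpq, map_mul, valuation_aeval_eq_one F W h.lt_one hq, one_mul, map_zpow₀]

lemma isUniformizer (h : IsLocalCoordinate (F := F) (k := k) W s n) :
    IsUniformizer (geometricField F k E) W s := by
  refine ⟨h.mem, h.ne_zero, h.lt_one, fun x hx hx0 => ?_⟩
  obtain ⟨p, q, hq, rfl⟩ := mem_geometricField.1 hx
  have hp : p ≠ 0 := by
    rintro rfl
    rw [map_zero, zero_div] at hx0
    exact hx0 rfl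
  refine ⟨n p - n q, ?_⟩
  rw [map_div₀, h.valuation_polyEval hp, h.valuation_polyEval hq,
    zpow_sub₀ ((Valuation.ne_zero_iff _).2 h.ne_zero)]

end IsLocalCoordinate

/-- Factor out (X − θ) to the multiplicity of θ and expand the cofactor around θ; its constant term
is its nonzero value there. -/
lemma isLocalCoordinate_finite {W : ValuationSubring E} {θ : k}
    (hθ : W.valuation (polyEval F k E (X - C θ)) < 1) :
    IsLocalCoordinate (F := F) W (polyEval F k E (X - C θ))
      fun p : k[X] => rootMultiplicity θ p := by
  refine ⟨polyEval_mem _, polyEval_ne_zero (X_sub_C_ne_zero θ), hθ, fun p hp => ?_⟩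
  obtain ⟨q, hpq, hq⟩ := exists_eq_pow_rootMultiplicity_mul_and_not_dvd p hp θ
  refine ⟨q.comp (X + C θ), ?_, ?_⟩
  · rw [coeff_zero_eq_eval_zero, eval_comp, eval_add, eval_X, eval_C, zero_add]
    exact fun h => hq (dvd_iff_isRoot.2 h)
  · have h1 : aeval (polyEval F k E (X - C θ)) (q.comp (X + C θ)) = polyEval F k E q := by
      rw [aeval_comp]
      simp [polyEval]
    rw [h1, zpow_natCast, ← map_pow, ← map_mul, mul_comm q, ← hpq]

/-- In the coordinate 1/t a polynomial is its reverse times t^(deg p), and the constant term of the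
reverse is the leading coefficient. -/
lemma isLocalCoordinate_infinite {W : ValuationSubring E}
    (hW : W.valuation (polyEval F k E (X : k[X]))⁻¹ < 1) :
    IsLocalCoordinate (F := F) W (polyEval F k E (X : k[X]))⁻¹
      fun p : k[X] => -(p.natDegree : ℤ) := by
  have ht := polyEval_ne_zero (F := F) (E := E) (X_ne_zero (R := k))
  refine ⟨inv_mem (polyEval_mem _), inv_ne_zero ht, hW, fun p hp => ⟨p.reverse, ?_, ?_⟩⟩
  · rw [coeff_zero_reverse]
    exact leadingCoeff_ne_zero.2 hp
  · let := invertibleOfNonzero ht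
    have := eval₂_reverse_mul_pow (algebraMap k E) (polyEval F k E X) p
    rw [invOf_eq_inv] at this
    rw [zpow_neg, zpow_natCast, inv_pow, inv_inv, aeval_def, this, polyEval, aeval_X, aeval_def]

/-- A transcendental element is positive on some valuation ring. -/
lemma exists_valuation_lt_one {s : E} (hs : Transcendental k s) :
    ∃ W : ValuationSubring E, W.valuation s < 1 := by
  set R : Subring E := (aeval (R := k) s).toRingHom.range with hR
  have hsR : s ∈ R := ⟨X, aeval_X s⟩
  have hI : Ideal.span {(⟨s, hsR⟩ : R)} ≠ ⊤ := by
    rw [Ne, Ideal.span_singleton_eq_top]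
    intro hu
    obtain ⟨⟨_, ⟨p, rfl⟩⟩, hp⟩ := hu.exists_right_inv
    have h1 : s * aeval s p = 1 := congrArg Subtype.val hp
    have h2 : aeval s (X * p) = aeval s (1 : k[X]) := by
      rw [map_mul, aeval_X, h1, map_one]
    exact not_isUnit_X (IsUnit.of_mul_eq_one _ (transcendental_iff_injective.1 hs h2))
  obtain ⟨W, -, hW⟩ := Ideal.image_subset_nonunits_valuationSubring _ hI
  exact ⟨W, (W.mem_nonunits_iff).1 (hW ⟨⟨s, hsR⟩, Ideal.mem_span_singleton_self _, rfl⟩)⟩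

lemma transcendental_polyEval_X : Transcendental k (polyEval F k E X) := by
  have h := polyEval_injective (F := F) (k := k) (E := E)
  rw [polyEval, ← transcendental_iff_injective] at h
  rwa [polyEval_X]

variable (F E) in
lemma exists_valuation_finite_lt_one (θ : k) :
    ∃ W : ValuationSubring E, W.valuation (polyEval F k E (X - C θ)) < 1 := by
  refine exists_valuation_lt_one (k := k) fun h => transcendental_polyEval_X (F := F) (k := k) (E := E) ?_
  have := h.add (isAlgebraic_algebraMap (A := E) θ)
  rwa [map_sub, polyEval_C, sub_add_cancel] at this

variable (F k E) in
lemma exists_valuation_infinite_lt_one :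
    ∃ W : ValuationSubring E, W.valuation (polyEval F k E (X : k[X]))⁻¹ < 1 :=
  exists_valuation_lt_one (k := k) fun h => transcendental_polyEval_X (F := F) (k := k) (E := E)
    (by have := h.inv; rwa [inv_inv] at this)

end Ramification

lemma div_le_one_iff_not_lt_one {Γ : Type*} [LinearOrderedCommGroupWithZero Γ] {x y : Γ}
    (hx : x ≤ 1) (hy0 : 0 < y) (h : ¬ (x < 1 ∧ y < 1)) : x / y ≤ 1 ↔ ¬ y < 1 := by
  rw [div_le_one₀ hy0]
  constructor
  · exact fun hxy hy1 => h ⟨hxy.trans_lt hy1, hy1⟩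
  · exact fun hy1 => hx.trans (not_lt.1 hy1)

/-! ### Ramified places read off from a Kummer polynomial -/

section KummerRamification

variable {F : Type*} [Field F] [Fintype F]
  {k : Type*} [Field k] [Algebra F k] [Algebra.IsAlgebraic F k] [IsAlgClosed k]
  {E : Type*} [Field E] [Algebra F E] [Algebra (RatFunc F) E] [Algebra k E]
  [IsScalarTower F (RatFunc F) E] [IsScalarTower F k E]
  [IsAlgClosed E] [Algebra.IsAlgebraic (RatFunc F) E]

variable {W : ValuationSubring E} {s : E} {n : k[X] → ℤ} {ℓ : ℕ}
  {K : IntermediateField (RatFunc F) E} {Y : E} {g : k[X]}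

/-- If the order of `g` is divisible by `ℓ`, then `K` has no new values. -/
lemma IsLocalCoordinate.exists_zpow_of_dvd (h : IsLocalCoordinate (F := F) W s n) (hp : ℓ.Prime)
    (hℓ : (ℓ : k) ≠ 0) (hg : IsKummerPolynomial ℓ K Y g) (hdvd : (ℓ : ℤ) ∣ n g) {x : E}
    (hx : x ∈ K) (hx0 : x ≠ 0) : ∃ m : ℤ, W.valuation x = W.valuation s ^ m := by
  obtain ⟨ζ, hζ, hζL⟩ := exists_primitiveRoot (F := F) (E := E) hℓ
  obtain ⟨r, hr⟩ := hdvd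
  obtain ⟨q, hq, hgq⟩ := h.exists_eq g hg.monic.ne_zero
  obtain ⟨d, hd⟩ := IsAlgClosed.exists_pow_nat_eq (q.coeff 0) hp.pos
  have hd0 : d ≠ 0 := by
    rintro rfl
    rw [zero_pow hp.ne_zero] at hd
    exact hq hd.symm
  have hsr : s ^ (-r) ∈ geometricField F k E := zpow_mem h.mem _
  have hsr0 : s ^ (-r) ≠ 0 := zpow_ne_zero _ h.ne_zero
  -- Dividing Y by s^r makes the radicand a unit congruent to its constant term d^ℓ, the situation
  -- of `IsUniformizer.exists_zpow_of_unit`.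
  have hY' : (s ^ (-r) * Y) ^ ℓ = aeval s q := by
    rw [mul_pow, hg.pow_eq, hgq, hr, mul_comm (ℓ : ℤ) r, zpow_mul, zpow_natCast, mul_left_comm,
      ← mul_pow, ← zpow_add₀ h.ne_zero, neg_add_cancel, zpow_zero, one_pow, mul_one]
  have hvℓ : W.valuation (ℓ : E) = 1 := by
    rw [← map_natCast (algebraMap k E)]
    exact valuation_const F W hℓ
  refine h.isUniformizer.exists_zpow_of_unit hp.pos hvℓ hζ hζL (Y := s ^ (-r) * Y)
    (s₀ := algebraMap k E d) ?_ (algebraMap_mem_geometricField d) (valuation_const F W hd0) ?_ ?_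
    hx0
  · rw [mul_pow, hg.pow_eq]
    exact mul_mem (pow_mem hsr _) (polyEval_mem g)
  · rw [hY', ← map_pow, hd]
    exact valuation_aeval_sub_lt_one F W h.lt_one q
  · rw [adjoin_singleton_mul_eq hsr hsr0, ← hg.adjoin_eq]
    exact IntermediateField.subset_adjoin _ _ hx

/-- If the order of `g` is not divisible by `ℓ`, then `K` has a new value. -/
lemma IsLocalCoordinate.exists_ne_zpow_of_not_dvd (h : IsLocalCoordinate (F := F) W s n)
    (hp : ℓ.Prime) (hℓ : (ℓ : k) ≠ 0) [IsGalois (RatFunc F) K] (hg : IsKummerPolynomial ℓ K Y g)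
    (hndvd : ¬ (ℓ : ℤ) ∣ n g) :
    ∃ y ∈ K, y ≠ 0 ∧ ∀ m : ℤ, W.valuation y ≠ W.valuation s ^ m := by
  obtain ⟨ζ, hζ, hζL⟩ := exists_primitiveRoot (F := F) (E := E) hℓ
  have hℓE : (ℓ : E) ≠ 0 := by
    rw [← map_natCast (algebraMap k E)]
    exact (_root_.map_ne_zero _).2 hℓ
  have hgval := h.valuation_polyEval hg.monic.ne_zero
  have hnot : ∀ u ∈ geometricField F k E, u ^ ℓ ≠ polyEval F k E g := by
    intro u hu hug
    have hu0 : u ≠ 0 := by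
      rintro rfl
      rw [zero_pow hp.ne_zero] at hug
      exact polyEval_ne_zero hg.monic.ne_zero hug.symm
    obtain ⟨r, hr⟩ := h.isUniformizer.exists_zpow u hu hu0
    rw [← hug, map_pow, hr, ← zpow_natCast, ← zpow_mul] at hgval
    exact hndvd ⟨r, by rw [← h.isUniformizer.zpow_inj hgval, mul_comm]⟩
  have hYL : Y ^ ℓ ∈ geometricField F k E := by rw [hg.pow_eq]; exact polyEval_mem g
  obtain ⟨τ, hτ⟩ := exists_algEquiv_kummer hp hYL (by rwa [hg.pow_eq]) hζ.pow_eq_one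
  obtain ⟨x, hxK, hxL⟩ := SetLike.not_le_iff_exists.1 (hg.not_le_geometricField hnot)
  have hτK : ∀ m : ℕ, (τ ^ m) x ∈ K := by
    intro m
    have h1 := IntermediateField.restrictRestrictAlgEquivMapHom_apply K (geometricField F k E)
      (τ ^ m) ⟨x, hxK⟩
    rw [← h1]
    exact (IntermediateField.restrictRestrictAlgEquivMapHom (RatFunc F) K (geometricField F k E) E
      (τ ^ m) ⟨x, hxK⟩).2
  obtain ⟨c, hc, hxc⟩ := exists_sum_of_mem_adjoin_root hp.pos hYL (x := x) (by
    rw [← hg.adjoin_eq]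
    exact IntermediateField.subset_adjoin _ _ hxK)
  have htr := sum_pow_algEquiv_apply hp τ hζ hζL hτ c hc
  rw [← hxc] at htr
  -- The new value must come from K, not merely from the compositum with k(t). Subtracting from ℓx
  -- the sum of its τ-conjugates stays in K and removes exactly the constant coefficient.
  set c' : ℕ → E := fun i => if i = 0 then 0 else ℓ * c i with hc'
  have hy : ℓ * x - ∑ m ∈ Finset.range ℓ, (τ ^ m) x = ∑ i ∈ Finset.range ℓ, c' i * Y ^ i := by
    obtain ⟨ℓ', hℓ'⟩ : ∃ m, ℓ = m + 1 := ⟨ℓ - 1, by have := hp.pos; omega⟩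
    rw [htr, ← mul_sub, hxc, hℓ', Finset.sum_range_succ', Finset.sum_range_succ']
    simp only [hc', Nat.succ_ne_zero, if_false, if_true, pow_zero, mul_one, add_sub_cancel_right,
      add_zero, Finset.mul_sum, hℓ']
    exact Finset.sum_congr rfl fun i _ => (mul_assoc _ _ _).symm
  have hy0 : ℓ * x - ∑ m ∈ Finset.range ℓ, (τ ^ m) x ≠ 0 := by
    rw [htr, ← mul_sub]
    exact mul_ne_zero hℓE (sub_ne_zero.2 fun h => hxL (h ▸ hc 0))
  refine ⟨ℓ * x - ∑ m ∈ Finset.range ℓ, (τ ^ m) x,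
    sub_mem (mul_mem (natCast_mem K ℓ) hxK) (sum_mem fun m _ => hτK m), hy0, ?_⟩
  rw [hy] at hy0 ⊢
  refine h.isUniformizer.ne_zpow_of_not_dvd hp (by rw [hg.pow_eq]; exact hgval) hndvd c' ?_
    (by simp [hc']) hy0
  intro i
  simp only [hc']
  split_ifs
  · exact zero_mem _
  · exact mul_mem (natCast_mem _ ℓ) (hc i)

section Valuations

variable {Γ : Type*} [LinearOrderedCommGroupWithZero Γ] {v : Valuation (RatFunc F) Γ}

lemma not_isRamifiedIn_of_dvd (hp : ℓ.Prime) (hℓ : (ℓ : k) ≠ 0) (hg : IsKummerPolynomial ℓ K Y g)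
    (h : ∀ W : ValuationSubring E, W.comap (algebraMap (RatFunc F) E) = v.valuationSubring →
      ∃ (s : E) (n : k[X] → ℤ), IsLocalCoordinate (F := F) W s n ∧ (ℓ : ℤ) ∣ n g ∧
        ∃ r : RatFunc F, W.valuation (algebraMap (RatFunc F) E r) = W.valuation s) :
    ¬ IsRamifiedIn v K := by
  rw [isRamifiedIn_iff]
  rintro ⟨W, hW, y, hyK, hy⟩
  obtain ⟨s, n, hs, hdvd, r, hr⟩ := h W hW
  by_cases hy0 : y = 0
  · exact hy 0 (by rw [hy0, map_zero])
  · obtain ⟨m, hm⟩ := hs.exists_zpow_of_dvd hp hℓ hg hdvd hyK hy0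
    exact hy (r ^ m) (by rw [map_zpow₀, map_zpow₀, hr, hm])

lemma isRamifiedIn_of_not_dvd (hp : ℓ.Prime) (hℓ : (ℓ : k) ≠ 0) [IsGalois (RatFunc F) K]
    (hg : IsKummerPolynomial ℓ K Y g) {W : ValuationSubring E}
    (hW : W.comap (algebraMap (RatFunc F) E) = v.valuationSubring)
    (h : IsLocalCoordinate (F := F) W s n) (hndvd : ¬ (ℓ : ℤ) ∣ n g) : IsRamifiedIn v K := by
  rw [isRamifiedIn_iff]
  obtain ⟨y, hyK, hy0, hy⟩ := h.exists_ne_zpow_of_not_dvd hp hℓ hg hndvd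
  refine ⟨W, hW, y, hyK, fun r hr => ?_⟩
  by_cases hr0 : r = 0
  · rw [hr0, map_zero, map_zero, eq_comm, map_eq_zero] at hr
    exact hy0 hr
  · obtain ⟨m, hm⟩ := h.isUniformizer.exists_zpow (algebraMap (RatFunc F) E r)
      (IntermediateField.algebraMap_mem _ r) ((_root_.map_ne_zero _).2 hr0)
    exact hy m (hr.symm.trans hm)

end Valuations

section Places

lemma algebraMap_ratFunc_eq (r : RatFunc F) : algebraMap (RatFunc F) E r =
    polyEval F k E (r.num.map (algebraMap F k)) / polyEval F k E (r.denom.map (algebraMap F k)) := by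
  rw [polyEval_map, polyEval_map, ← map_div₀, RatFunc.num_div_denom]

lemma exists_root_of_valuation_lt_one {p : k[X]} (hp : p ≠ 0)
    (h : W.valuation (polyEval F k E p) < 1) :
    ∃ θ, p.eval θ = 0 ∧ W.valuation (polyEval F k E (X - C θ)) < 1 := by
  by_contra! hcon
  have h1 : 1 ≤ W.valuation (polyEval F k E (p.roots.map fun a => X - C a).prod) := by
    refine Multiset.prod_induction (fun q => 1 ≤ W.valuation (polyEval F k E q)) _ ?_ ?_ ?_
    · intro a b ha hb
      rw [map_mul, map_mul]
      exact one_le_mul ha hb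
    · rw [map_one, map_one]
    · intro a ha
      obtain ⟨θ, hθ, rfl⟩ := Multiset.mem_map.1 ha
      exact hcon θ (isRoot_of_mem_roots hθ)
  rw [(IsAlgClosed.splits p).eq_prod_roots, map_mul, map_mul, polyEval_C,
    valuation_const F W (leadingCoeff_ne_zero.2 hp), one_mul] at h
  exact absurd h (not_lt.2 h1)

variable (v : HeightOneSpectrum F[X])

lemma mem_asIdeal_iff {θ : k} (hθ : v.asIdeal = Ideal.span {minpoly F θ}) (p : F[X]) :
    p ∈ v.asIdeal ↔ (p.map (algebraMap F k)).eval θ = 0 := by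
  rw [hθ, Ideal.mem_span_singleton, minpoly.dvd_iff, eval_map_algebraMap]

lemma exists_minpoly_of_comap_eq
    (hW : W.comap (algebraMap (RatFunc F) E) = (v.valuation (RatFunc F)).valuationSubring) :
    ∃ θ : k, v.asIdeal = Ideal.span {minpoly F θ} ∧
      W.valuation (polyEval F k E (X - C θ)) < 1 := by
  obtain ⟨P, hP⟩ := (IsPrincipalIdealRing.principal v.asIdeal).principal
  rw [Ideal.submodule_span_eq] at hP
  have hP0 : P ≠ 0 := by
    rintro rfl
    exact v.ne_bot (by rw [hP, Ideal.span_singleton_eq_bot])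
  have hprime : Prime P := (Ideal.span_singleton_prime hP0).1 (hP ▸ v.isPrime)
  have hlt : W.valuation (polyEval F k E (P.map (algebraMap F k))) < 1 := by
    rw [polyEval_map, ValuationSubring.valuation_lt_one_iff_of_comap_eq hW]
    exact (v.valuation_lt_one_iff_mem P).2 (hP ▸ Ideal.mem_span_singleton_self P)
  obtain ⟨θ, hθ, hlt'⟩ := exists_root_of_valuation_lt_one
    ((Polynomial.map_ne_zero_iff (algebraMap F k).injective).2 hP0) hlt
  refine ⟨θ, ?_, hlt'⟩
  rw [eval_map_algebraMap] at hθ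
  rw [hP, Ideal.span_singleton_eq_span_singleton]
  exact ((minpoly.irreducible (Algebra.IsIntegral.isIntegral θ)).associated_of_dvd
    hprime.irreducible (minpoly.dvd F θ hθ)).symm

/-- In lowest terms, a fraction lies in either ring exactly when its denominator is not in the prime
ideal v. -/
lemma comap_eq_of_valuation_lt_one {θ : k} (hθ : v.asIdeal = Ideal.span {minpoly F θ})
    (hW : W.valuation (polyEval F k E (X - C θ)) < 1) :
    W.comap (algebraMap (RatFunc F) E) = (v.valuation (RatFunc F)).valuationSubring := by
  have hval : ∀ p : F[X], (W.valuation (polyEval F k E (p.map (algebraMap F k))) ≤ 1 ∧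
      v.valuation (RatFunc F) (algebraMap F[X] (RatFunc F) p) ≤ 1) ∧
      (W.valuation (polyEval F k E (p.map (algebraMap F k))) < 1 ↔ p ∈ v.asIdeal) ∧
      (v.valuation (RatFunc F) (algebraMap F[X] (RatFunc F) p) < 1 ↔ p ∈ v.asIdeal) := by
    intro p
    have h2 := v.valuation_lt_one_iff_mem (K := RatFunc F) p
    have h3 := v.valuation_le_one (K := RatFunc F) p
    by_cases hp : p = 0
    · simp [hp]
    have h1 := (isLocalCoordinate_finite hW).valuation_polyEval
      ((Polynomial.map_ne_zero_iff (algebraMap F k).injective).2 hp)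
    rw [zpow_natCast] at h1
    refine ⟨⟨?_, h3⟩, ?_, h2⟩
    · rw [h1]
      exact pow_le_one₀ zero_le hW.le
    · have hroot : 0 < rootMultiplicity θ (p.map (algebraMap F k)) ↔ p ∈ v.asIdeal := by
        rw [mem_asIdeal_iff v hθ,
          rootMultiplicity_pos ((Polynomial.map_ne_zero_iff (algebraMap F k).injective).2 hp),
          IsRoot.def]
      rw [h1, ← hroot]
      refine ⟨fun h => Nat.pos_of_ne_zero fun h0 => ?_, fun h => pow_lt_one₀ zero_le hW h.ne'⟩
      rw [h0, pow_zero] at h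
      exact lt_irrefl _ h
  ext r
  have hpos : ∀ p : F[X], p ≠ 0 → 0 < W.valuation (polyEval F k E (p.map (algebraMap F k))) ∧
      0 < v.valuation (RatFunc F) (algebraMap F[X] (RatFunc F) p) := fun p hp =>
    ⟨zero_lt_iff.2 ((Valuation.ne_zero_iff _).2 (polyEval_ne_zero
      ((Polynomial.map_ne_zero_iff (algebraMap F k).injective).2 hp))),
    zero_lt_iff.2 ((Valuation.ne_zero_iff _).2
      ((map_ne_zero_iff _ (IsFractionRing.injective F[X] (RatFunc F))).2 hp))⟩
  have hnot : ¬ (r.num ∈ v.asIdeal ∧ r.denom ∈ v.asIdeal) := by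
    rintro ⟨h1, h2⟩
    obtain ⟨a, b, hab⟩ := RatFunc.isCoprime_num_denom r
    exact v.isPrime.ne_top ((Ideal.eq_top_iff_one _).2 (hab ▸ add_mem
      (Ideal.mul_mem_left _ a h1) (Ideal.mul_mem_left _ b h2)))
  obtain ⟨⟨a1, a2⟩, a3, a4⟩ := hval r.num
  obtain ⟨-, b3, b4⟩ := hval r.denom
  obtain ⟨c1, c2⟩ := hpos r.denom r.denom_ne_zero
  rw [ValuationSubring.mem_comap, Valuation.mem_valuationSubring_iff, ← W.valuation_le_one_iff,
    algebraMap_ratFunc_eq (k := k) (E := E) r, map_div₀,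
    div_le_one_iff_not_lt_one a1 c1 (by rwa [a3, b3]), b3]
  conv_rhs => rw [← RatFunc.num_div_denom r]
  rw [map_div₀, div_le_one_iff_not_lt_one a2 c2 (by rwa [a4, b4]), b4]

/-- Extending constants is unramified: θ is a simple root of its minimal polynomial, which therefore
has the value of X − θ. -/
lemma exists_valuation_eq_of_root {θ : k} (hW : W.valuation (polyEval F k E (X - C θ)) < 1) :
    ∃ r : RatFunc F, W.valuation (algebraMap (RatFunc F) E r) =
      W.valuation (polyEval F k E (X - C θ)) := by
  have hint : IsIntegral F θ := Algebra.IsIntegral.isIntegral θ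
  have hP0 : (minpoly F θ).map (algebraMap F k) ≠ 0 := ((minpoly.monic hint).map _).ne_zero
  refine ⟨algebraMap F[X] (RatFunc F) (minpoly F θ), ?_⟩
  have h1 : rootMultiplicity θ ((minpoly F θ).map (algebraMap F k)) = 1 := by
    refine le_antisymm ?_ ((rootMultiplicity_pos hP0).2 ?_)
    · exact rootMultiplicity_le_one_of_separable
        (PerfectField.separable_of_irreducible (minpoly.irreducible hint)).map θ
    · rw [IsRoot.def, eval_map_algebraMap, minpoly.aeval]
  rw [← polyEval_map (k := k), (isLocalCoordinate_finite hW).valuation_polyEval hP0, h1,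
    Nat.cast_one, zpow_one]

/-- Excluding ramification requires all valuation rings above v, each centred at some root θ of the
prime polynomial; proving it requires only one ring centred at the given θ. -/
lemma isRamifiedIn_finite_iff (hp : ℓ.Prime) (hℓ : (ℓ : k) ≠ 0) [IsGalois (RatFunc F) K]
    (hg : IsKummerPolynomial ℓ K Y g) :
    IsRamifiedIn (v.valuation (RatFunc F)) K ↔
      ∃ θ : k, v.asIdeal = Ideal.span {minpoly F θ} ∧ ¬ ℓ ∣ rootMultiplicity θ g := by
  constructor
  · contrapose!
    intro h
    refine not_isRamifiedIn_of_dvd hp hℓ hg fun W hW => ?_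
    obtain ⟨θ, hθ, hlt⟩ := exists_minpoly_of_comap_eq (k := k) v hW
    exact ⟨_, _, isLocalCoordinate_finite hlt, Int.natCast_dvd_natCast.2 (h θ hθ),
      exists_valuation_eq_of_root hlt⟩
  · rintro ⟨θ, hθ, hndvd⟩
    obtain ⟨W, hW⟩ := exists_valuation_finite_lt_one F E θ
    exact isRamifiedIn_of_not_dvd hp hℓ hg (comap_eq_of_valuation_lt_one v hθ hW)
      (isLocalCoordinate_finite hW) (fun h => hndvd (Int.natCast_dvd_natCast.1 h))

variable [DecidableEq (RatFunc F)]

variable (k) in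
lemma valuation_inv_lt_one_of_comap_eq
    (hW : W.comap (algebraMap (RatFunc F) E) = (RatFunc.inftyValuation F).valuationSubring) :
    W.valuation (polyEval F k E (X : k[X]))⁻¹ < 1 := by
  rw [polyEval_X, ← map_inv₀, ValuationSubring.valuation_lt_one_iff_of_comap_eq hW, map_inv₀,
    RatFunc.inftyValuation.X, ← WithZero.exp_neg, ← WithZero.exp_zero, WithZero.exp_lt_exp]
  norm_num

lemma comap_eq_of_valuation_inv_lt_one
    (hW : W.valuation (polyEval F k E (X : k[X]))⁻¹ < 1) :
    W.comap (algebraMap (RatFunc F) E) = (RatFunc.inftyValuation F).valuationSubring := by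
  ext r
  rw [ValuationSubring.mem_comap, Valuation.mem_valuationSubring_iff, ← W.valuation_le_one_iff]
  by_cases hr : r = 0
  · simp [hr]
  have hs := isLocalCoordinate_infinite hW
  have hnum : r.num.map (algebraMap F k) ≠ 0 :=
    (Polynomial.map_ne_zero_iff (algebraMap F k).injective).2 (RatFunc.num_ne_zero hr)
  have hden : r.denom.map (algebraMap F k) ≠ 0 :=
    (Polynomial.map_ne_zero_iff (algebraMap F k).injective).2 r.denom_ne_zero
  rw [RatFunc.inftyValuation_apply, RatFunc.inftyValuation_of_nonzero _ hr, ← WithZero.exp_zero, WithZero.exp_le_exp,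
    algebraMap_ratFunc_eq (k := k) (E := E) r, map_div₀, hs.valuation_polyEval hnum,
    hs.valuation_polyEval hden, ← zpow_sub₀ ((Valuation.ne_zero_iff _).2 hs.ne_zero),
    natDegree_map, natDegree_map, RatFunc.intDegree, ← zpow_zero (W.valuation _),
    (zpow_right_strictAnti₀ hs.isUniformizer.pos hs.lt_one).le_iff_ge]
  constructor <;> intro h <;> linarith

lemma isRamifiedIn_infinite_iff (hp : ℓ.Prime) (hℓ : (ℓ : k) ≠ 0) [IsGalois (RatFunc F) K]
    (hg : IsKummerPolynomial ℓ K Y g) :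
    IsRamifiedIn (RatFunc.inftyValuation F) K ↔ ¬ ℓ ∣ g.natDegree := by
  constructor
  · contrapose!
    intro h
    refine not_isRamifiedIn_of_dvd hp hℓ hg fun W hW => ?_
    refine ⟨_, _, isLocalCoordinate_infinite (valuation_inv_lt_one_of_comap_eq k hW),
      (Int.natCast_dvd_natCast.2 h).neg_right, RatFunc.X⁻¹, ?_⟩
    rw [map_inv₀ (algebraMap (RatFunc F) E), polyEval_X]
  · intro hndvd
    obtain ⟨W, hW⟩ := exists_valuation_infinite_lt_one F k E
    exact isRamifiedIn_of_not_dvd hp hℓ hg (comap_eq_of_valuation_inv_lt_one hW)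
      (isLocalCoordinate_infinite hW)
      (fun h => hndvd (Int.natCast_dvd_natCast.1 ((dvd_neg).1 h)))

end Places

end KummerRamification

/-! ### The conductor of a pullback -/

section Conductor

variable {F : Type*} [Field F] [Fintype F]
  {k : Type*} [Field k] [Algebra F k] [Algebra.IsAlgebraic F k] [IsAlgClosed k]
  {E : Type*} [Field E] [Algebra F E] [Algebra (RatFunc F) E] [Algebra k E]
  [IsScalarTower F (RatFunc F) E] [IsScalarTower F k E]
  [IsAlgClosed E] [Algebra.IsAlgebraic (RatFunc F) E]

open Classical in
variable (F) in
/-- The monic irreducible polynomials over `F` at whose roots the order of `g` is prime to `ℓ`. -/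
noncomputable def ramifiedPolynomials (ℓ : ℕ) (g : k[X]) : Finset F[X] :=
  (g.roots.toFinset.filter fun θ => ¬ ℓ ∣ rootMultiplicity θ g).image (minpoly F)

lemma mem_ramifiedPolynomials {ℓ : ℕ} {g : k[X]} {p : F[X]} :
    p ∈ ramifiedPolynomials F ℓ g ↔ ∃ θ, ¬ ℓ ∣ rootMultiplicity θ g ∧ minpoly F θ = p := by
  classical
  simp only [ramifiedPolynomials, Finset.mem_image, Finset.mem_filter, Multiset.mem_toFinset]
  refine exists_congr fun θ => and_congr_left fun _ => and_iff_right_iff_imp.2 fun h => ?_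
  rw [← Multiset.count_pos, count_roots, Nat.pos_iff_ne_zero]
  intro h0
  exact h (h0 ▸ dvd_zero ℓ)

lemma monic_irreducible_of_mem {ℓ : ℕ} {g : k[X]} {p : F[X]}
    (hp : p ∈ ramifiedPolynomials F ℓ g) : p.Monic ∧ Irreducible p := by
  obtain ⟨θ, -, rfl⟩ := mem_ramifiedPolynomials.1 hp
  have hint : IsIntegral F θ := Algebra.IsIntegral.isIntegral θ
  exact ⟨minpoly.monic hint, minpoly.irreducible hint⟩

lemma eq_of_span_eq_of_monic {p q : F[X]} (hp : p.Monic) (hq : q.Monic)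
    (h : Ideal.span {p} = Ideal.span {q}) : p = q :=
  eq_of_monic_of_associated hp hq (Ideal.span_singleton_eq_span_singleton.1 h)

lemma exists_monic_generator (v : HeightOneSpectrum F[X]) :
    ∃ p : F[X], p.Monic ∧ v.asIdeal = Ideal.span {p} := by
  obtain ⟨P, hP⟩ := (IsPrincipalIdealRing.principal v.asIdeal).principal
  rw [Ideal.submodule_span_eq] at hP
  have hP0 : P ≠ 0 := by
    rintro rfl
    exact v.ne_bot (by rw [hP, Ideal.span_singleton_eq_bot])
  refine ⟨P * C P.leadingCoeff⁻¹, monic_mul_leadingCoeff_inv hP0, ?_⟩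
  rw [hP, Ideal.span_singleton_eq_span_singleton]
  exact (associated_mul_isUnit_left_iff (isUnit_C.2 (IsUnit.mk0 _
    (inv_ne_zero (leadingCoeff_ne_zero.2 hP0))))).2 (Associated.refl P) |>.symm

/-- Sending a finite place to its monic generator identifies the ramified places with
`ramifiedPolynomials`, and residue degrees with polynomial degrees. -/
lemma conductorDegree_eq {ℓ : ℕ} (hp : ℓ.Prime) (hℓ : (ℓ : k) ≠ 0)
    {K : IntermediateField (RatFunc F) E} [IsGalois (RatFunc F) K] {Y : E} {g : k[X]}
    (hg : IsKummerPolynomial ℓ K Y g) :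
    conductorDegree F K = ∑ p ∈ ramifiedPolynomials F ℓ g, p.natDegree +
      if ℓ ∣ g.natDegree then 0 else 1 := by
  classical
  have hinf := isRamifiedIn_infinite_iff (F := F) hp hℓ hg
  unfold conductorDegree
  congr 1
  · choose P hPm hP using exists_monic_generator (F := F)
    refine (finsum_mem_eq_of_bijOn (s := {v | IsRamifiedIn (v.valuation (RatFunc F)) K}) P
      ⟨?_, ?_, ?_⟩ ?_).trans (finsum_mem_coe_finset (fun p : F[X] => p.natDegree) _)
    · intro v hv
      obtain ⟨θ, hθ, hndvd⟩ := (isRamifiedIn_finite_iff v hp hℓ hg).1 hv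
      refine mem_ramifiedPolynomials.2 ⟨θ, hndvd, ?_⟩
      exact eq_of_span_eq_of_monic (minpoly.monic (Algebra.IsIntegral.isIntegral θ)) (hPm v)
        (hθ.symm.trans (hP v))
    · intro v _ w _ hvw
      exact HeightOneSpectrum.ext ((hP v).trans (hvw ▸ (hP w).symm))
    · intro p hpmem
      obtain ⟨hmonic, hirr⟩ := monic_irreducible_of_mem hpmem
      obtain ⟨θ, hndvd, rfl⟩ := mem_ramifiedPolynomials.1 hpmem
      let v : HeightOneSpectrum F[X] := ⟨Ideal.span {minpoly F θ},
        (Ideal.span_singleton_prime hirr.ne_zero).2 hirr.prime,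
        by rw [Ne, Ideal.span_singleton_eq_bot]; exact hirr.ne_zero⟩
      refine ⟨v, (isRamifiedIn_finite_iff v hp hℓ hg).2 ⟨θ, rfl, hndvd⟩, ?_⟩
      exact eq_of_span_eq_of_monic (hPm v) hmonic (hP v).symm
    · intro v _
      rw [hP v, finrank_quotient_span_eq_natDegree]
  · by_cases h : ℓ ∣ g.natDegree
    · rw [if_pos h, if_neg (fun h' => hinf.1 (by convert h') h)]
    · rw [if_neg h, if_pos (by convert hinf.2 h)]

lemma conductorDegree_pos {ℓ : ℕ} (hp : ℓ.Prime) (hℓ : (ℓ : k) ≠ 0)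
    {K : IntermediateField (RatFunc F) E} [IsGalois (RatFunc F) K] {Y : E} {g : k[X]}
    (hg : IsKummerPolynomial ℓ K Y g) (hθ : ∃ θ, ¬ ℓ ∣ rootMultiplicity θ g) :
    0 < conductorDegree F K := by
  obtain ⟨θ, hθ⟩ := hθ
  have hmem : minpoly F θ ∈ ramifiedPolynomials F ℓ g := mem_ramifiedPolynomials.2 ⟨θ, hθ, rfl⟩
  rw [conductorDegree_eq hp hℓ hg]
  have := Finset.single_le_sum (f := fun p : F[X] => p.natDegree) (fun _ _ => Nat.zero_le _) hmem
  have := minpoly.natDegree_pos (Algebra.IsIntegral.isIntegral (R := F) θ)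
  omega

/-- The ramified places of the pullback lie above those of the base cover. -/
lemma sum_natDegree_ramifiedPolynomials_kummerForm_le {ℓ e : ℕ} (hℓ : 0 < ℓ) (f : k[X])
    {v : F[X] × F[X]} (hv : v ∈ monicPairs F e) :
    ∑ p ∈ ramifiedPolynomials F ℓ (kummerForm ℓ f v), p.natDegree ≤
      (∑ p ∈ ramifiedPolynomials F ℓ f, p.natDegree) * (e + 1) +
        if ℓ ∣ f.natDegree then 0 else e := by
  classical
  obtain ⟨ha, hb⟩ := Finset.mem_product.1 hv
  set Q₁ : F[X] := ∏ p ∈ ramifiedPolynomials F ℓ f, homEval p v.1 v.2 with hQ₁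
  set Q₂ : F[X] := if ℓ ∣ f.natDegree then 1 else v.2 with hQ₂
  have hm₁ : Q₁.Monic := monic_prod_of_monic _ _ fun p hp =>
    (homEval_monic (monic_irreducible_of_mem hp).1 ha hb).1
  have hm₂ : Q₂.Monic := by
    rw [hQ₂]
    split_ifs
    · exact monic_one
    · exact (mem_monics.1 hb).1
  have hdvd : ∏ p ∈ ramifiedPolynomials F ℓ (kummerForm ℓ f v), p ∣ Q₁ * Q₂ := by
    refine Finset.prod_dvd_of_coprime ?_ ?_
    · intro p hp q hq hne
      obtain ⟨hpm, hpi⟩ := monic_irreducible_of_mem hp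
      obtain ⟨hqm, hqi⟩ := monic_irreducible_of_mem hq
      exact (hpi.coprime_iff_not_dvd.2 fun h =>
        hne (eq_of_monic_of_associated hpm hqm (hpi.associated_of_dvd hqi h)))
    · intro p hp
      obtain ⟨θ, hθ, rfl⟩ := mem_ramifiedPolynomials.1 hp
      rw [← ZMod.natCast_eq_zero_iff, rootMultiplicity_kummerForm hℓ f hv] at hθ
      obtain ⟨o, ho, hroot⟩ := (isLocalInvariant_localOrder ℓ f).exists_form v θ hθ
      have h1 := minpoly_dvd_placeForm hroot
      rw [mem_branchSet] at ho
      match o with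
      | some β =>
        refine (h1.trans ?_).mul_right _
        refine Finset.dvd_prod_of_mem (fun p => homEval p v.1 v.2)
          (mem_ramifiedPolynomials.2 ⟨β, fun h => ho ?_, rfl⟩)
        exact (ZMod.natCast_eq_zero_iff _ _).2 h
      | none =>
        have : ¬ ℓ ∣ f.natDegree := fun h => ho (by
          rw [color, (ZMod.natCast_eq_zero_iff _ _).2 h, neg_zero])
        rw [hQ₂, if_neg this]
        exact h1.mul_left _
  have hdeg := natDegree_le_of_dvd hdvd (mul_ne_zero hm₁.ne_zero hm₂.ne_zero)
  rw [natDegree_prod_of_monic _ _ fun p hp => (monic_irreducible_of_mem hp).1,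
    hm₁.natDegree_mul hm₂] at hdeg
  refine hdeg.trans (add_le_add ?_ ?_)
  · rw [hQ₁, natDegree_prod_of_monic _ _ fun p hp =>
      (homEval_monic (monic_irreducible_of_mem hp).1 ha hb).1, Finset.sum_mul]
    exact Finset.sum_le_sum fun p hp => (homEval_monic (monic_irreducible_of_mem hp).1 ha hb).2.le
  · rw [hQ₂]
    split_ifs
    · exact natDegree_one.le
    · exact (mem_monics.1 hb).2.le

/-- A finite place of degree r in the base conductor contributes at most r(e + 1). If ∞ ramifies,
the zeros of b contribute at most e and ∞ itself 1, again e + 1 in all. -/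
lemma conductorDegree_pullback_le {ℓ e : ℕ} (hp : ℓ.Prime) (hℓ : (ℓ : k) ≠ 0)
    {K₀ : IntermediateField (RatFunc F) E} [IsGalois (RatFunc F) K₀] {Y : E} {f : k[X]}
    (hf : IsKummerPolynomial ℓ K₀ Y f) {v : F[X] × F[X]} (hv : v ∈ monicPairs F e) {Φ : E →+* E}
    (h : IsSubstitution F k Φ v) :
    conductorDegree F (pullback K₀ Φ) ≤ (e + 1) * conductorDegree F K₀ := by
  have := isGalois_pullback K₀ h
  rw [conductorDegree_eq hp hℓ hf, conductorDegree_eq hp hℓ (hf.pullback hv h hp.pos),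
    natDegree_kummerForm hv hp.pos]
  simp only [Nat.dvd_add_left (dvd_mul_right ℓ _)]
  have h1 := sum_natDegree_ramifiedPolynomials_kummerForm_le (ℓ := ℓ) hp.pos f hv
  split_ifs at h1 ⊢ <;> linarith

end Conductor

/-! ### Many pullbacks, and the theorem -/

section Main

variable {F : Type*} [Field F] [Fintype F]
  {k : Type*} [Field k] [Algebra F k] [Algebra.IsAlgebraic F k] [IsAlgClosed k]
  {E : Type*} [Field E] [Algebra F E] [Algebra (RatFunc F) E] [Algebra k E]
  [IsScalarTower F (RatFunc F) E] [IsScalarTower F k E]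
  [IsAlgClosed E] [Algebra.IsAlgebraic (RatFunc F) E]

variable (k) in
/-- Pulling back a cover of degree `ℓ` along rational functions of degree `e + 1` gives a
positive proportion of `q ^ (2 * e)` covers. -/
theorem exists_many_pullbacks {ℓ : ℕ} (hp : ℓ.Prime) (hodd : Odd ℓ) (hℓ : (ℓ : k) ≠ 0)
    (K₀ : IntermediateField (RatFunc F) E) [IsGalois (RatFunc F) K₀]
    (hK₀ : Module.finrank (RatFunc F) K₀ = ℓ)
    (hconst : ∀ x ∈ K₀, IsAlgebraic F x → x ∈ (algebraMap F E).range) :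
    0 < conductorDegree F K₀ ∧ ∃ c : ℝ, 0 < c ∧ ∃ e₀ : ℕ, ∀ e : ℕ, e₀ ≤ e →
      ∃ S : Finset (IntermediateField (RatFunc F) E),
        (∀ K ∈ S, IsGalois (RatFunc F) K ∧ Module.finrank (RatFunc F) K = ℓ ∧
          (∀ x ∈ K, IsAlgebraic F x → x ∈ (algebraMap F E).range) ∧
          conductorDegree F K ≤ (e + 1) * conductorDegree F K₀ ∧ Nonempty (K₀ →ₐ[F] K)) ∧
        c * (Fintype.card F : ℝ) ^ (2 * e) ≤ S.card := by
  classical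
  have : Fact ℓ.Prime := ⟨hp⟩
  have : FiniteDimensional (RatFunc F) K₀ := FiniteDimensional.of_finrank_pos (hK₀ ▸ hp.pos)
  have hK₀L : ¬ K₀ ≤ geometricField F k E := by
    intro h
    have h1 := le_bot_iff.1 (le_bot_of_le_geometricField K₀ hconst h)
    rw [h1, IntermediateField.finrank_bot] at hK₀
    exact hp.one_lt.ne hK₀
  obtain ⟨Y, f, hf⟩ := exists_isKummerPolynomial (k := k) hp hℓ K₀ hK₀ hK₀L
  -- Otherwise f is an ℓ-th power u^ℓ in k(t); then Y is u times an ℓ-th root of unity and lies in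
  -- k(t), contrary to K₀ ⊄ k(t).
  have hfroot : ∃ θ, ¬ ℓ ∣ rootMultiplicity θ f := by
    refine exists_not_dvd_rootMultiplicity (F := F) (E := E) hf.monic fun u hu huf => ?_
    obtain ⟨ζ, hζ, hζL⟩ := exists_primitiveRoot (F := F) (E := E) hℓ
    refine hf.not_le hK₀L ?_
    by_cases hu0 : u = 0
    · rw [hu0, zero_pow hp.ne_zero] at huf
      exact absurd huf.symm (polyEval_ne_zero hf.monic.ne_zero)
    have h1 : (Y / u) ^ ℓ = 1 := by
      rw [div_pow, hf.pow_eq, huf, div_self (polyEval_ne_zero hf.monic.ne_zero)]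
    have : NeZero ℓ := ⟨hp.ne_zero⟩
    obtain ⟨i, -, hi⟩ := hζ.eq_pow_of_pow_eq_one h1
    rw [← div_mul_cancel₀ Y hu0, ← hi]
    exact mul_mem (pow_mem hζL i) hu
  obtain ⟨c, hc, e₀, he₀⟩ := exists_many_classes hodd (two_le_card_branchSet hfroot)
    (isLocalInvariant_localOrder (F := F) ℓ f)
  refine ⟨conductorDegree_pos hp hℓ hf hfroot, c, hc, e₀, fun e he => ?_⟩
  obtain ⟨G, hG, hGne, hGcard⟩ := he₀ e he
  -- One substitution is chosen for each pair of G; the identity elsewhere is only a default value.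
  have hsub : ∀ v : F[X] × F[X], ∃ Φ : E →+* E, v ∈ G → IsSubstitution F k Φ v := by
    intro v
    by_cases hv : v ∈ G
    · obtain ⟨Φ, hΦ⟩ := exists_isSubstitution (k := k) (E := E) (hG hv)
      exact ⟨Φ, fun _ => hΦ⟩
    · exact ⟨RingHom.id E, fun h => absurd h hv⟩
  choose Φ hΦ using hsub
  have hkummer : ∀ v ∈ G, IsKummerPolynomial ℓ (pullback K₀ (Φ v))
      (polyEval F k E (form none v) ^ f.natDegree * Φ v Y) (kummerForm ℓ f v) := fun v hv =>
    hf.pullback (hG hv) (hΦ v hv) hp.pos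
  have hroot : ∀ v ∈ G, ∃ θ, ¬ ℓ ∣ rootMultiplicity θ (kummerForm ℓ f v) := by
    intro v hv
    obtain ⟨θ, hθ⟩ := hGne v hv
    rw [← rootMultiplicity_kummerForm hp.pos f (hG hv), Ne, ZMod.natCast_eq_zero_iff] at hθ
    exact ⟨θ, hθ⟩
  refine ⟨G.image fun v => pullback K₀ (Φ v), ?_, hGcard _ fun v hv v' hv' heq => ?_⟩
  · intro K hK
    obtain ⟨v, hv, rfl⟩ := Finset.mem_image.1 hK
    have hfin := finrank_pullback hp hK₀ (hΦ v hv) (hkummer v hv) (hroot v hv)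
    refine ⟨isGalois_pullback K₀ (hΦ v hv), hfin, fun x hx hxF => ?_,
      conductorDegree_pullback_le hp hℓ hf (hG hv) (hΦ v hv), nonempty_algHom_pullback K₀ (hΦ v hv)⟩
    refine mem_range_of_isAlgebraic_of_not_le (k := k) hp hfin
      ((hkummer v hv).not_le_geometricField ?_) hx hxF
    obtain ⟨θ, hθ⟩ := hroot v hv
    exact ne_pow_of_not_dvd_rootMultiplicity hp.ne_zero (hkummer v hv).monic.ne_zero hθ
  -- Equal pullbacks make both Kummer polynomials belong to one field, so their orders are
  -- proportional, which is the hypothesis of `exists_many_classes`.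
  · have h' := hkummer v' hv'
    rw [← heq] at h'
    obtain ⟨j, hj, hmul⟩ := (hkummer v hv).exists_eq_mul hp hℓ h' (hroot v hv) (hroot v' hv')
    refine ⟨j, hj, fun θ => ?_⟩
    rw [← rootMultiplicity_kummerForm hp.pos f (hG hv), ← hmul,
      rootMultiplicity_kummerForm hp.pos f (hG hv')]

end Main

/-- The constant 4 is 2(⌊n/d⌋ + 1) − 2(⌊n/d⌋ − 1): it covers both the rounding of n/d and the shift
e = ⌊n/d⌋ − 1. -/
lemma rpow_two_mul_div_le {q : ℝ} (hq : 1 ≤ q) {n d : ℕ} (hd : 0 < d) (hdn : d ≤ n) :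
    q ^ (2 * (n : ℝ) / (d : ℝ)) ≤ q ^ 4 * q ^ (2 * (n / d - 1)) := by
  rw [← pow_add, ← Real.rpow_natCast]
  refine Real.rpow_le_rpow_of_exponent_le hq ?_
  have hd' : (0 : ℝ) < d := by exact_mod_cast hd
  rw [div_le_iff₀ hd']
  have h1 : 0 < n / d := Nat.div_pos hdn hd
  have h2 : n < d * (n / d + 1) := Nat.lt_mul_div_succ n hd
  have h3 : 4 + 2 * (n / d - 1) = 2 * (n / d + 1) := by omega
  rw [h3]
  have h4 : (n : ℝ) ≤ d * ((n / d : ℕ) + 1) := by exact_mod_cast h2.le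
  push_cast
  nlinarith

theorem proposition4p1 (F : Type*) [Field F] [Fintype F]
    (ℓ : ℕ) (hℓ : ℓ.Prime) (hodd : Odd ℓ) (hcop : (Fintype.card F).Coprime ℓ)
    (K₀ : IntermediateField (RatFunc F) (AlgebraicClosure (RatFunc F)))
    (hK₀ : IsCyclicCover F ℓ K₀) :
    ∃ c : ℝ, 0 < c ∧ ∃ N : ℕ, ∀ n : ℕ, N ≤ n →
      ∃ S : Finset (IntermediateField (RatFunc F) (AlgebraicClosure (RatFunc F))),
        (∀ K ∈ S, IsCyclicCover F ℓ K ∧ conductorDegree F K ≤ n ∧ HasNonconstantMap F K K₀) ∧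
        c * (Fintype.card F : ℝ) ^ (2 * (n : ℝ) / (conductorDegree F K₀ : ℝ)) ≤ (S.card : ℝ) := by
  have : Fact ℓ.Prime := ⟨hℓ⟩
  have hconst : ∀ (K : IntermediateField (RatFunc F) (AlgebraicClosure (RatFunc F))),
      (∀ x : K, IsAlgebraic F x → x ∈ (algebraMap F K).range) ↔
      ∀ x ∈ K, IsAlgebraic F x → x ∈ (algebraMap F (AlgebraicClosure (RatFunc F))).range := by
    intro K
    have halg : ∀ x : K, IsAlgebraic F (x : AlgebraicClosure (RatFunc F)) ↔ IsAlgebraic F x :=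
      fun x => isAlgebraic_algHom_iff (K.val.restrictScalars F) K.val.injective
    constructor
    · intro h x hx hxF
      obtain ⟨c, hc⟩ := h ⟨x, hx⟩ ((halg ⟨x, hx⟩).1 hxF)
      exact ⟨c, congrArg Subtype.val hc⟩
    · intro h x hxF
      obtain ⟨c, hc⟩ := h x x.2 ((halg x).2 hxF)
      exact ⟨c, Subtype.ext hc⟩
  have hℓF : (ℓ : F) ≠ 0 := by
    obtain ⟨p, hp⟩ := CharP.exists F
    obtain ⟨n, hpp, hcard⟩ := FiniteField.card F p
    rw [Ne, CharP.cast_eq_zero_iff F p]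
    intro hdvd
    rw [(Nat.prime_dvd_prime_iff_eq hpp hℓ).1 hdvd] at hcard
    have h1 : ℓ ∣ Fintype.card F := hcard ▸ dvd_pow_self ℓ n.ne_zero
    exact hℓ.one_lt.ne' (Nat.eq_one_of_dvd_coprimes hcop h1 dvd_rfl)
  -- The field k is taken to be the algebraic closure of F inside the fixed algebraic closure of
  -- F(t).
  have : IsAlgClosed (algebraicClosure F (AlgebraicClosure (RatFunc F))) :=
    IsAlgClosure.isAlgClosed F
  have hℓk : (ℓ : algebraicClosure F (AlgebraicClosure (RatFunc F))) ≠ 0 := by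
    rw [← map_natCast (algebraMap F _)]
    exact (_root_.map_ne_zero _).2 hℓF
  have := hK₀.isGalois
  obtain ⟨hd, c, hc, e₀, he₀⟩ := exists_many_pullbacks
    (algebraicClosure F (AlgebraicClosure (RatFunc F))) hℓ hodd hℓk K₀ hK₀.finrank_eq
    ((hconst K₀).1 hK₀.constants)
  have hq : (1 : ℝ) ≤ Fintype.card F := by exact_mod_cast Fintype.card_pos
  refine ⟨c / (Fintype.card F : ℝ) ^ 4, by positivity, (e₀ + 1) * conductorDegree F K₀,
    fun n hn => ?_⟩
  have he : e₀ + 1 ≤ n / conductorDegree F K₀ := (Nat.le_div_iff_mul_le hd).2 hn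
  -- The largest e allowed by (e + 1)d₀ ≤ n.
  obtain ⟨S, hS, hcard⟩ := he₀ (n / conductorDegree F K₀ - 1) (by omega)
  refine ⟨S, fun K hK => ?_, le_trans ?_ hcard⟩
  · obtain ⟨h1, h2, h3, h4, h5⟩ := hS K hK
    have : FiniteDimensional (RatFunc F) K := FiniteDimensional.of_finrank_pos (h2 ▸ hℓ.pos)
    refine ⟨⟨h1, isCyclic_of_prime_card (p := ℓ) ?_, h2, (hconst K).2 h3⟩, h4.trans ?_, h5⟩
    · rw [IsGalois.card_aut_eq_finrank, h2]
    · rw [Nat.sub_add_cancel (by omega)]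
      exact Nat.div_mul_le_self _ _
  · have h1 := rpow_two_mul_div_le hq hd
      (le_trans (Nat.le_mul_of_pos_left _ (Nat.succ_pos e₀)) hn)
    rw [div_mul_eq_mul_div, div_le_iff₀ (by positivity), mul_assoc]
    refine mul_le_mul_of_nonneg_left (h1.trans ?_) hc.le
    rw [mul_comm]
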